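/- Let $H=(\mathbb C^\times)^r$ be an algebraic torus with maximal compact torus $T=(S^1)^r$, and identify $\mathrm{Lie}(T)^*=\mathbb R^r$, with weight lattice $\mathbb Z^r$. Let $X$ be an irreducible affine complex variety with an algebraic action of $H$. Let $\Lambda(X)\subset\mathbb Z^r$ be the set of weights of $H$ on $\mathbb C[X]$ and $\Gamma(X)\subset\mathbb R^r$ the cone it generates. For each closed face $\overline\sigma$ of $\Gamma(X)$ (with relative interior $\sigma$), let $H^{\overline\sigma}\subset H$ be the connected subtorus whose Lie algebra is the annihilator of $\mathrm{span}(\overline\sigma)$, let $X^{\overline\sigma}$ be the set of points of $X$ fixed by $H^{\overline\sigma}$, and put $X^{\sigma}=X^{\overline\sigma}\setminus\bigcup_{\overline\tau\subsetneq\overline\sigma}X^{\overline\tau}$. Assume (D1') the sets $X^\sigma$ make $X$ a decomposed variety: they form a finite partition of $X$ by smooth irreducible locally closed subvarieties such that, in the analytic topology, $X^\sigma\cap\overline{X^\tau}\neq\emptyset$ implies $X^\sigma\subset\overline{X^\tau}$. Let $(E,h_E)$ and $(E',h_{E'})$ be finite-dimensional unitary $T$-modules, regarded also as algebraic $H$-modules,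 with linear symplectic forms $\omega_E=-\operatorname{Im}h_E$, $\omega_{E'}=-\operatorname{Im}h_{E'}$ ($h_E$, $h_{E'}$ conjugate-linear in the first variable) and quadratic moment maps $\mu\colon E\to\mathrm{Lie}(T)^*$, $\mu'\colon E'\to\mathrm{Lie}(T)^*$ with $\mu(0)=0$, $\mu'(0)=0$. Let $i\colon X\hookrightarrow E$ and $i'\colon X\hookrightarrow E'$ be closed $H$-equivariant embeddings of varieties. Assume (D2') for all $\sigma,\tau$, the pair $(i(X^\sigma),i(X^\tau))$ satisfies Whitney's condition (A) in $E$: if $x_k\in i(X^\tau)$ converges to $x\in i(X^\sigma)$ and the tangent spaces $T_{x_k}i(X^\tau)$ converge to a subspace $L$ in the Grassmannian, then $T_x i(X^\sigma)\subset L$; and likewise for $i'$ in $E'$. Assume finally that $\mu$ and $\mu'$ are proper maps. Then, for every $\sigma$, $i(X^\sigma)\subset E$ and $i'(X^\sigma)\subset E'$ are $T$-invariant symplectic submanifolds on which the restrictions of $\mu$ and $\mu'$ are moment maps, so that $i$ and $i'$ each make $X$ a Hamiltonian $T$-space, denoted $(X_E,\mu)$ and $(X_{E'},\mu')$; and these are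 isomorphic as Hamiltonian $T$-spaces. That is, there is a $T$-equivariant homeomorphism $\phi\colon X\to X$ (for the analytic topology) with $\mu'\circ i'\circ\phi=\mu\circ i$ such that, for every $\sigma$, $\phi(X^\sigma)=X^\sigma$ and $i'\circ\phi\circ i^{-1}\colon (i(X^\sigma),\omega_E)\to(i'(X^\sigma),\omega_{E'})$ is a symplectomorphism. -/

import Mathlib

open Filter Topology
open scoped ContDiff

noncomputable section

/-! ### Tori and their characters

The algebraic torus of rank `r` is `H = (ℂˣ)^r`, with maximal compact torus `T = (S¹)^r`.  We have
`Lie(T) = ℝ^r`, `exp(ξ) = (e^{i ξ_j})_j`, and the lattice of real weights is `ℤ^r ⊂ ℝ^r = Lie(T)*`. -/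

/-- The algebraic torus `H = (ℂˣ)^r`. -/
abbrev AlgTorus (r : ℕ) : Type := Fin r → ℂˣ

/-- The maximal compact torus `T = (S¹)^r` of `H`. -/
abbrev CompactTorus (r : ℕ) : Type := Fin r → Circle

/-- The inclusion `T ⊂ H`. -/
def CompactTorus.incl {r : ℕ} (t : CompactTorus r) : AlgTorus r := fun j => Circle.toUnits (t j)

/-- The exponential map `Lie(T) = ℝ^r → T`. -/
def CompactTorus.exp {r : ℕ} (ξ : Fin r → ℝ) : CompactTorus r := fun j => Circle.exp (ξ j)

/-- The character `h ↦ h^m` of `H` attached to the weight `m ∈ ℤ^r`. -/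
def AlgTorus.character {r : ℕ} (m : Fin r → ℤ) (h : AlgTorus r) : ℂ :=
  ((∏ j, h j ^ m j : ℂˣ) : ℂ)

/-! ### Affine varieties

An irreducible affine variety is a set `X` of closed points with its algebra `ℂ[X]` of regular
functions: a finitely generated domain of functions on `X` such that the points of `X` are
exactly the `ℂ`-algebra homomorphisms `ℂ[X] → ℂ`. -/

/-- The structure of an (irreducible) affine variety over `ℂ` on a set `X`. -/
structure AffineVariety (X : Type*) where
  /-- the algebra `ℂ[X]` of regular functions -/
  coord : Subalgebra ℂ (X → ℂ)
  fg : coord.FG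
  isDomain : IsDomain coord
  points : ∀ χ : coord →ₐ[ℂ] ℂ, ∃! x : X, ∀ f : coord, χ f = (f : X → ℂ) x

namespace AffineVariety

variable {X : Type*} (V : AffineVariety X)

/-- The Zariski topology. -/
@[reducible] def zariski : TopologicalSpace X :=
  TopologicalSpace.generateFrom {U | ∃ f ∈ V.coord, U = {x | f x ≠ 0}}

/-- The analytic topology: the coarsest one for which all regular functions are continuous. -/
@[reducible] def analytic : TopologicalSpace X :=
  TopologicalSpace.induced (fun x (f : V.coord) => (f : X → ℂ) x) inferInstance

/-- The restrictions to `S` of the regular functions on `X`.  This is the coordinate ring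
`ℂ[X] / I(S)` of the Zariski closure of `S`, as functions on `S`. -/
def restrict (S : Set X) : Subalgebra ℂ (S → ℂ) :=
  V.coord.map (AlgHom.pi (fun s => Pi.evalAlgHom ℂ (fun _ : X => ℂ) s.1))

/-- Evaluation at a point of `S`. -/
def evalAt {S : Set X} (x : S) : V.restrict S →ₐ[ℂ] ℂ :=
  (Pi.evalAlgHom ℂ (fun _ : S => ℂ) x).comp (V.restrict S).val

instance {S : Set X} (x : S) : (RingHom.ker (V.evalAt x)).IsPrime := RingHom.ker_isPrime _

/-- A (Zariski locally closed) subset `S` is a smooth subvariety if, at each of its points, the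
local ring of its Zariski closure is smooth over `ℂ`. -/
def IsSmoothSubvariety (S : Set X) : Prop :=
  ∀ x : S, Algebra.IsSmoothAt ℂ (RingHom.ker (V.evalAt x))

/-- A finite family of subsets makes `X` a decomposed variety: it is a partition of `X` by smooth
irreducible (Zariski locally closed) subvarieties that satisfies the frontier condition for the
analytic topology. -/
structure IsDecomposed {ι : Type*} (P : ι → Set X) : Prop where
  finite : Finite ι
  disjoint : ∀ σ τ, σ ≠ τ → Disjoint (P σ) (P τ)
  cover : ⋃ σ, P σ = Set.univ
  locallyClosed : ∀ σ, @IsLocallyClosed X V.zariski (P σ)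
  irreducible : ∀ σ, @IsIrreducible X V.zariski (P σ)
  smooth : ∀ σ, V.IsSmoothSubvariety (P σ)
  frontier : ∀ σ τ, (P σ ∩ closure[V.analytic] (P τ)).Nonempty → P σ ⊆ closure[V.analytic] (P τ)

variable {r : ℕ} [MulAction (AlgTorus r) X]

/-- The action of `H` on `X` is algebraic: the action map `H × X → X` is a morphism, that is, it
pulls regular functions on `X` back to elements of `ℂ[H × X] = ℂ[H] ⊗ ℂ[X]`.  An affine
`H`-variety is an affine variety with such an action. -/
def IsAlgebraicAction (r : ℕ) [MulAction (AlgTorus r) X] : Prop :=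
  ∀ f ∈ V.coord, (fun p : AlgTorus r × X => f (p.1 • p.2)) ∈
    Submodule.span ℂ {F : AlgTorus r × X → ℂ | ∃ (m : Fin r → ℤ) (g : X → ℂ), g ∈ V.coord ∧
      F = fun p => AlgTorus.character m p.1 * g p.2}

/-- `Λ(X)`: the weights of the nonzero homogeneous regular functions.  (A function has degree `m`
if `f (h • x) = h^m f(x)`; the opposite sign convention replaces `Λ(X)` by `-Λ(X)` and leads to
the same decomposition of `X`.) -/
def weights (r : ℕ) [MulAction (AlgTorus r) X] : Set (Fin r → ℝ) :=
  {l | ∃ m : Fin r → ℤ, (l = fun j => (m j : ℝ)) ∧ ∃ f ∈ V.coord, f ≠ 0 ∧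
    ∀ (h : AlgTorus r) (x : X), f (h • x) = AlgTorus.character m h * f x}

/-- `Γ(X)`: the cone generated by `Λ(X)`. -/
def weightCone (r : ℕ) [MulAction (AlgTorus r) X] : PointedCone ℝ (Fin r → ℝ) :=
  Submodule.span _ (V.weights r)

/-- The closed faces `σ̄` of `Γ(X)`; they index the pieces `σ ∈ Σ(X)` (their relative interiors). -/
abbrev Face (r : ℕ) [MulAction (AlgTorus r) X] : Type :=
  {F : PointedCone ℝ (Fin r → ℝ) // F.IsFaceOf (V.weightCone r)}

end AffineVariety

/-- The subtorus `H^σ̄` of `H`: the connected subgroup whose Lie algebra is the annihilator in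
`Lie(H) = ℂ^r` of the span of the face `F = σ̄`.  Its maximal compact torus is the connected
subtorus `T^σ̄` of `T` with `ann(Lie(T^σ̄)) = span(σ̄)`. -/
def faceTorus {r : ℕ} (F : PointedCone ℝ (Fin r → ℝ)) : Set (AlgTorus r) :=
  {h | ∃ ζ : Fin r → ℂ, (∀ l ∈ F, ∑ j, (l j : ℂ) * ζ j = 0) ∧
    ∀ j, (h j : ℂ) = Complex.exp (Complex.I * ζ j)}

namespace AffineVariety

variable {X : Type*} (V : AffineVariety X)

/-- `X^σ̄`: the points of `X` fixed by `H^σ̄`. -/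
def closedPiece {r : ℕ} [MulAction (AlgTorus r) X] (F : V.Face r) : Set X :=
  {x | ∀ h ∈ faceTorus F.1, h • x = x}

/-- `X^σ = X^σ̄ \ ⋃_{τ ≺ σ} X^τ̄`. -/
def piece {r : ℕ} [MulAction (AlgTorus r) X] (F : V.Face r) : Set X :=
  V.closedPiece F \ ⋃ (G : V.Face r) (_ : G < F), V.closedPiece G

end AffineVariety

/-! ### Unitary modules and quadratic moment maps -/

/-- A unitary `T`-module on the complex inner product space `E`, with the extension of the action
to an algebraic action of `H`. -/
structure UnitaryTorusModule (r : ℕ) (E : Type*) [NormedAddCommGroup E] [InnerProductSpace ℂ E] where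
  rep : Representation ℂ (AlgTorus r) E
  /-- the matrix coefficients are Laurent polynomials on `H` -/
  algebraic : ∀ (v : E) (ℓ : E →ₗ[ℂ] ℂ),
    (fun h : AlgTorus r => ℓ (rep h v)) ∈ Submodule.span ℂ (Set.range AlgTorus.character)
  unitary : ∀ (t : CompactTorus r) (v w : E), inner ℂ (rep t.incl v) (rep t.incl w) = inner ℂ v w

/-- The linear symplectic form `ω = -Im h` of a complex inner product space `(E, h)`. -/
def symplForm {E : Type*} [NormedAddCommGroup E] [InnerProductSpace ℂ E] (v w : E) : ℝ :=
  -(inner ℂ v w).im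

namespace UnitaryTorusModule

variable {r : ℕ} {E : Type*} [NormedAddCommGroup E] [InnerProductSpace ℂ E]
  (ρ : UnitaryTorusModule r E)

/-- The fundamental vector field `ξ_E(v) = d/ds|₀ exp(sξ) v` of `ξ ∈ Lie(T)`. -/
def fundVF (ξ : Fin r → ℝ) (v : E) : E :=
  deriv (fun s : ℝ => ρ.rep (CompactTorus.exp (s • ξ)).incl v) 0

/-- The quadratic moment map `μ : E → Lie(T)* = ℝ^r` with `μ(0) = 0`, given by
`⟨μ(v), ξ⟩ = ω(ξ_E(v), v) / 2`. -/
def momentMap (v : E) : Fin r → ℝ :=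
  fun j => symplForm (ρ.fundVF (Pi.single j 1) v) v / 2

end UnitaryTorusModule

/-! ### Submanifolds of a vector space -/

section Submanifolds

variable {E : Type*} [NormedAddCommGroup E] [NormedSpace ℝ E]

/-- `S` is an embedded smooth submanifold of `E`: locally it can be straightened to a linear
subspace by a diffeomorphism between open subsets of `E`. -/
def IsSmoothSubmanifold (S : Set E) : Prop :=
  ∀ p ∈ S, ∃ (Φ : OpenPartialHomeomorph E E) (L : Submodule ℝ E), p ∈ Φ.source ∧
    ContDiffOn ℝ ∞ Φ Φ.source ∧ ContDiffOn ℝ ∞ Φ.symm Φ.target ∧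
    Φ.source ∩ S = Φ.source ∩ Φ ⁻¹' (L : Set E)

/-- The tangent space at `p` of a smooth submanifold `S`, as a linear subspace of `E`. -/
def tangentSpaceOf (S : Set E) (p : E) : Submodule ℝ E :=
  Submodule.span ℝ (tangentConeAt ℝ S p)

end Submanifolds

/-- Whitney's condition (A) for a pair `(N', N)` of submanifolds.  Convergence of tangent spaces in
the Grassmannian (of real subspaces of `E`) is convergence of the orthogonal projections. -/
def WhitneyA {E : Type*} [NormedAddCommGroup E] [InnerProductSpace ℂ E] [FiniteDimensional ℂ E]
    (N' N : Set E) : Prop :=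
  letI : InnerProductSpace ℝ E := InnerProductSpace.complexToReal
  ∀ (x : ℕ → E) (p : E) (L : Submodule ℝ E), (∀ k, x k ∈ N) → p ∈ N' →
    Tendsto x atTop (𝓝 p) →
    Tendsto (fun k => (tangentSpaceOf N (x k)).starProjection) atTop (𝓝 L.starProjection) →
    tangentSpaceOf N' p ≤ L

/-- A smooth submanifold `S` of a unitary `T`-module `E` is a Hamiltonian `T`-manifold for the
restrictions of `ω`, of the action and of the moment map: `ω` is nondegenerate on `S`, `S` is
`T`-invariant, and `ω(ξ_S, ·) = d⟨μ, ξ⟩` on `S`.  (The restriction of the constant form `ω` is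
closed, and it is `T`-invariant because the action is unitary.) -/
structure IsHamiltonianSubmanifold {r : ℕ} {E : Type*} [NormedAddCommGroup E]
    [InnerProductSpace ℂ E] (ρ : UnitaryTorusModule r E) (S : Set E) : Prop where
  submanifold : IsSmoothSubmanifold S
  nondegenerate : ∀ p ∈ S, ∀ v ∈ tangentSpaceOf S p, v ≠ 0 →
    ∃ w ∈ tangentSpaceOf S p, symplForm v w ≠ 0
  invariant : ∀ (t : CompactTorus r), ∀ p ∈ S, ρ.rep t.incl p ∈ S
  moment_equivariant : ∀ (t : CompactTorus r), ∀ p ∈ S,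
    ρ.momentMap (ρ.rep t.incl p) = ρ.momentMap p
  moment : ∀ p ∈ S, ∀ ξ : Fin r → ℝ, ρ.fundVF ξ p ∈ tangentSpaceOf S p ∧
    ∃ D : E →L[ℝ] ℝ, HasFDerivWithinAt (fun q => ∑ j, ρ.momentMap q j * ξ j) D S p ∧
      ∀ v ∈ tangentSpaceOf S p, symplForm (ρ.fundVF ξ p) v = D v

/-- `F : S → S'` is a symplectomorphism with inverse `G`, for the restrictions of the linear
symplectic forms to the submanifolds `S ⊂ E` and `S' ⊂ E'`. -/
structure IsSymplectomorphismOn {E E' : Type*} [NormedAddCommGroup E] [InnerProductSpace ℂ E]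
    [NormedAddCommGroup E'] [InnerProductSpace ℂ E'] (F : E → E') (G : E' → E)
    (S : Set E) (S' : Set E') : Prop where
  mapsTo : Set.MapsTo F S S'
  mapsTo_inv : Set.MapsTo G S' S
  invOn : Set.InvOn G F S S'
  smooth : ContDiffOn ℝ ∞ F S
  smooth_inv : ContDiffOn ℝ ∞ G S'
  symplectic : ∀ p ∈ S, ∀ v ∈ tangentSpaceOf S p, ∀ w ∈ tangentSpaceOf S p,
    symplForm (fderivWithin ℝ F S p v) (fderivWithin ℝ F S p w) = symplForm v w

/-! ### Embeddings of affine `H`-varieties and the induced Hamiltonian `T`-spaces -/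

section Embeddings

variable {r : ℕ} {X : Type*} [MulAction (AlgTorus r) X] (V : AffineVariety X)
  {E : Type*} [NormedAddCommGroup E] [InnerProductSpace ℂ E]

/-- `i : X → E` is an `H`-equivariant closed embedding of varieties: the pullback of polynomial
functions on `E` is defined and maps onto `ℂ[X]`. -/
structure IsClosedEquivariantEmbedding (ρ : UnitaryTorusModule r E) (i : X → E) : Prop where
  closedEmbedding : Algebra.adjoin ℂ {f : X → ℂ | ∃ ℓ : E →ₗ[ℂ] ℂ, f = fun x => ℓ (i x)} = V.coord
  equivariant : ∀ (h : AlgTorus r) (x : X), i (h • x) = ρ.rep h (i x)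

variable {E' : Type*} [NormedAddCommGroup E'] [InnerProductSpace ℂ E']

/-- `φ` is an isomorphism from the Hamiltonian `T`-space `X_E` to the Hamiltonian `T`-space
`X_{E'}`, where `X_E` is `X` with its analytic topology, the action of `T`, the partition by the
pieces `X^σ`, the symplectic structure on `X^σ` restricted from `E` along `i`, and the moment map
`μ ∘ i`; similarly for `X_{E'}`.  That is, `φ` is an equivariant homeomorphism which intertwines
the moment maps and restricts to symplectomorphisms between the pieces. -/
structure IsHamiltonianIso (ρ : UnitaryTorusModule r E) (ρ' : UnitaryTorusModule r E')
    (i : X → E) (i' : X → E') (φ : X ≃ X) : Prop where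
  continuous : Continuous[V.analytic, V.analytic] φ
  continuous_inv : Continuous[V.analytic, V.analytic] φ.symm
  equivariant : ∀ (t : CompactTorus r) (x : X), φ (t.incl • x) = t.incl • φ x
  pieces : ∀ σ : V.Face r, φ '' V.piece σ = V.piece σ
  /-- the map `i' ∘ φ ∘ i⁻¹ : i(X^σ) → i'(X^σ)` is a symplectomorphism -/
  symplectic : ∀ σ : V.Face r,
    IsSymplectomorphismOn (Function.extend i (fun x => i' (φ x)) 0)
      (Function.extend i' (fun x => i (φ.symm x)) 0) (i '' V.piece σ) (i' '' V.piece σ)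
  moment : ∀ x, ρ'.momentMap (i' (φ x)) = ρ.momentMap (i x)

end Embeddings

end

/-! The map `x ↦ (i x, i' x)` embeds `X` in `E × E'`, and the structures to be compared become the
restrictions to the strata of the forms `ω₀` and `ω₁` pulled back from the two factors. The
isomorphism is the time-one flow of Moser's method for `ω_a = (1 - a) ω₀ + a ω₁`. Each stratum is a
complex submanifold, so `ω_a` comes there from a positive definite metric `g_a` and is
nondegenerate. The forms have primitives `½ ω_k(x, ·)`, and Moser's equation for their difference
reads, in terms of metrics, `g_a(ζ, v) = -½ (g₁ - g₀)(x, v)` for tangent `v`: up to a constant, `ζ`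
is the gradient of the difference of the Kähler potentials. The resulting invariance of `ω_a` is
`MoserData.moser_identity`, integrated in `MoserData.exists_fderiv_flow`.

Completeness. The fields `-J ξ_X` are tangent to the strata, and testing the equation of `ζ` on them
shows that the interpolated moment map is constant along trajectories
(`MoserData.hasDerivWithinAt_moment`). Properness puts all weights that occur in either embedding
into one open half-space, so the level sets are bounded uniformly in `a` (`exists_norm_le`). A value
of the moment map lies in a face exactly when the point lies in the corresponding closed piece
(`moment_interpolation_mem_iff`), so the value determines the stratum (`face_eq_of_moment_eq`). A
trajectory is thus confined to a compact subset of one stratum (`MoserData.exists_isAdapted`,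
`MoserData.IsAdapted.isTraj`).

Continuity across strata. The projection onto the weight spaces with weights in a face is linear,
selfadjoint for both metrics, and maps `X` to the closed piece of the face (`exists_eq_coneProj`).
With Whitney's condition (A) and a uniform lower bound for the metrics on tangent vectors, it takes
the Moser field of a nearby stratum approximately to the Moser field at the projected point
(`MoserData.eventually_moser_close`). Gronwall's inequality does the rest
(`MoserData.continuousOn_flow`).

Two foundations are needed. Smooth dependence on initial values comes from the implicit function
theorem in `C([0,1], W)` (`exists_contDiffAt_solution`). That algebraically smooth pieces are
complex submanifolds follows from formal smoothness and Nakayama's lemma (`exists_local_generators`,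
`AffineVariety.IsEmbedding.exists_isStraightening`). -/

noncomputable section

/-! ### Smooth dependence of solutions of differential equations on the initial value -/

/-! ### Postcomposition operators on spaces of paths -/

section Nemytskii

variable {I : Type*} [TopologicalSpace I] [CompactSpace I]
  {V V' : Type*} [NormedAddCommGroup V] [NormedSpace ℝ V] [NormedAddCommGroup V'] [NormedSpace ℝ V']

/-- Pointwise application of a continuous family of operators. -/
def ContinuousMap.pointwiseApply :
    C(I, V →L[ℝ] V') →L[ℝ] C(I, V) →L[ℝ] C(I, V') :=
  LinearMap.mkContinuous₂
    (LinearMap.mk₂ ℝ (fun (L : C(I, V →L[ℝ] V')) (h : C(I, V)) =>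
      (⟨fun s => L s (h s), L.continuous.clm_apply h.continuous⟩ : C(I, V')))
      (fun _ _ _ => by ext; simp) (fun _ _ _ => by ext; simp) (fun _ _ _ => by ext; simp)
      (fun _ _ _ => by ext; simp)) 1 (by
    intro L h
    refine (ContinuousMap.norm_le _ (by positivity)).2 fun s => ?_
    rw [one_mul]
    exact ((L s).le_opNorm _).trans (mul_le_mul (L.norm_coe_le_norm s) (h.norm_coe_le_norm s)
      (norm_nonneg _) (norm_nonneg L)))

@[simp]
theorem ContinuousMap.pointwiseApply_apply (L : C(I, V →L[ℝ] V')) (h : C(I, V)) (s : I) :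
    ContinuousMap.pointwiseApply L h s = L s (h s) := rfl

/-- The range of `γ` is compact, so `fderiv ℝ f` is uniformly continuous near it, and the mean value
inequality bounds the remainder at all parameters with one radius `δ`. -/
theorem hasFDerivAt_postcomp {f : V → V'} (hf : ContDiff ℝ 1 f) (γ : C(I, V)) :
    HasFDerivAt (fun γ : C(I, V) => (⟨f, hf.continuous⟩ : C(V, V')).comp γ)
      (ContinuousMap.pointwiseApply
        ((⟨fderiv ℝ f, hf.continuous_fderiv one_ne_zero⟩ : C(V, V →L[ℝ] V')).comp γ)) γ := by
  rw [hasFDerivAt_iff_isLittleO, Asymptotics.isLittleO_iff]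
  intro c hc
  have hK : IsCompact (Set.range γ) := isCompact_range γ.continuous
  have hu := hK.uniformContinuousAt_of_continuousAt (fderiv ℝ f)
    (fun x _ => (hf.continuous_fderiv one_ne_zero).continuousAt) (Metric.dist_mem_uniformity hc)
  obtain ⟨δ, hδ, hδ'⟩ := Metric.mem_uniformity_dist.1 hu
  filter_upwards [Metric.ball_mem_nhds γ hδ] with η hη
  refine (ContinuousMap.norm_le _ (by positivity)).2 fun s => ?_
  have hs : dist (η s) (γ s) < δ := (ContinuousMap.dist_apply_le_dist s).trans_lt hη
  have key := (convex_ball (γ s) δ).norm_image_sub_le_of_norm_hasFDerivWithin_le'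
    (f := f) (f' := fderiv ℝ f) (φ := fderiv ℝ f (γ s)) (C := c) (x := γ s) (y := η s)
    (fun x _ => (hf.differentiable one_ne_zero x).hasFDerivAt.hasFDerivWithinAt)
    (fun x hx => by
      have := hδ' (a := γ s) (b := x) (by rw [dist_comm]; exact hx) (Set.mem_range_self s)
      have h2 : dist (fderiv ℝ f (γ s)) (fderiv ℝ f x) < c := this
      rw [dist_comm, dist_eq_norm] at h2
      exact h2.le)
    (Metric.mem_ball_self hδ) hs
  refine le_trans ?_ (key.trans (mul_le_mul_of_nonneg_left ((η - γ).norm_coe_le_norm s) hc.le))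
  simp

/-- The derivative is again a postcomposition, with `fderiv ℝ f`, followed by a bounded linear map.
The target `V'` varies in the induction and shares the universe of `V`, so that `V →L[ℝ] V'` is an
admissible target. -/
theorem contDiff_postcomp_nat.{u} (n : ℕ) {V : Type u} [NormedAddCommGroup V] [NormedSpace ℝ V] :
    ∀ {V' : Type u} [NormedAddCommGroup V'] [NormedSpace ℝ V'] {f : V → V'}
      (hf : Continuous f), ContDiff ℝ n f →
      ContDiff ℝ n (fun γ : C(I, V) => (⟨f, hf⟩ : C(V, V')).comp γ) := by
  induction n with
  | zero =>
    intro V' _ _ f hf _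
    exact contDiff_zero.2 (ContinuousMap.continuous_postcomp _)
  | succ n ih =>
    intro V' _ _ f hf hn
    push_cast at hn ⊢
    have h1 : ContDiff ℝ 1 f := hn.of_le (by simp)
    have hd := (contDiff_succ_iff_fderiv.1 hn).2.2
    refine contDiff_succ_iff_fderiv.2 ⟨fun γ => (hasFDerivAt_postcomp h1 γ).differentiableAt,
      by simp, ?_⟩
    have : fderiv ℝ (fun γ : C(I, V) => (⟨f, hf⟩ : C(V, V')).comp γ) = fun γ =>
        ContinuousMap.pointwiseApply
        ((⟨fderiv ℝ f, h1.continuous_fderiv one_ne_zero⟩ : C(V, V →L[ℝ] V')).comp γ) :=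
      funext fun γ => (hasFDerivAt_postcomp h1 γ).fderiv
    rw [this]
    exact ContinuousMap.pointwiseApply.contDiff.comp (ih _ hd)

end Nemytskii

/-! ### The Volterra operator on `C([0,1], V)` -/

section Volterra

variable {V : Type*} [NormedAddCommGroup V]

/-- The extension of a function on `[0,1]` to the real line by constants. -/
def extendUnit (γ : C(unitInterval, V)) : ℝ → V := Set.IccExtend zero_le_one γ

theorem continuous_extendUnit (γ : C(unitInterval, V)) : Continuous (extendUnit γ) :=
  γ.continuous.Icc_extend'

theorem extendUnit_of_mem (γ : C(unitInterval, V)) {s : ℝ} (hs : s ∈ Set.Icc (0 : ℝ) 1) :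
    extendUnit γ s = γ ⟨s, hs⟩ := Set.IccExtend_of_mem _ _ hs

@[simp]
theorem extendUnit_coe (γ : C(unitInterval, V)) (s : unitInterval) :
    extendUnit γ s = γ s := Set.IccExtend_val _ _ s

theorem norm_extendUnit_le (γ : C(unitInterval, V)) (s : ℝ) : ‖extendUnit γ s‖ ≤ ‖γ‖ :=
  γ.norm_coe_le_norm _

variable [NormedSpace ℝ V]

/-- The primitive of a continuous function on `[0,1]` that vanishes at `0`. -/
def volterra : C(unitInterval, V) →L[ℝ] C(unitInterval, V) :=
  LinearMap.mkContinuous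
    { toFun := fun γ => ⟨fun t => ∫ s in (0 : ℝ)..t, extendUnit γ s,
        (intervalIntegral.continuous_primitive
          (fun _ _ => (continuous_extendUnit γ).intervalIntegrable _ _) 0).comp
            continuous_subtype_val⟩
      map_add' := fun γ η => by
        ext t
        exact intervalIntegral.integral_add ((continuous_extendUnit γ).intervalIntegrable _ _)
          ((continuous_extendUnit η).intervalIntegrable _ _)
      map_smul' := fun c γ => by
        ext t
        exact intervalIntegral.integral_smul c (extendUnit γ) } 1 (by
    intro γ
    refine (ContinuousMap.norm_le _ (by positivity)).2 fun t => ?_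
    refine (intervalIntegral.norm_integral_le_of_norm_le_const
      (fun s _ => norm_extendUnit_le γ s)).trans ?_
    rw [sub_zero, abs_of_nonneg t.2.1, mul_comm]
    exact mul_le_mul_of_nonneg_right t.2.2 (norm_nonneg _))

theorem volterra_apply (γ : C(unitInterval, V)) (t : unitInterval) :
    volterra γ t = ∫ s in (0 : ℝ)..t, extendUnit γ s := rfl

theorem hasDerivWithinAt_volterra [CompleteSpace V] (γ : C(unitInterval, V)) {s : ℝ}
    (hs : s ∈ Set.Icc (0 : ℝ) 1) :
    HasDerivWithinAt (extendUnit (volterra γ)) (extendUnit γ s) (Set.Icc 0 1) s := by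
  have h : HasDerivWithinAt (fun t : ℝ => ∫ s in (0 : ℝ)..t, extendUnit γ s) (extendUnit γ s)
      (Set.Icc 0 1) s :=
    (intervalIntegral.integral_hasDerivAt_right
      ((continuous_extendUnit γ).intervalIntegrable _ _)
      ((continuous_extendUnit γ).stronglyMeasurableAtFilter _ _)
      (continuous_extendUnit γ).continuousAt).hasDerivWithinAt
  refine h.congr (fun t ht => ?_) ?_
  · rw [extendUnit_of_mem _ ht, volterra_apply]
  · rw [extendUnit_of_mem _ hs, volterra_apply]

/-- Keeping the dependence on `t` in the bound is what produces the factorial: each integration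
turns `s ^ n` into `t ^ (n + 1) / (n + 1)`. -/
theorem norm_volterra_pow_le (L : C(unitInterval, V →L[ℝ] V)) (n : ℕ) (h : C(unitInterval, V))
    (t : unitInterval) :
    ‖((volterra ∘L ContinuousMap.pointwiseApply L) ^ n) h t‖
      ≤ (‖L‖ * t) ^ n / n.factorial * ‖h‖ := by
  induction n generalizing t with
  | zero => simpa using h.norm_coe_le_norm t
  | succ n ih =>
    rw [pow_succ', mul_apply_eq_comp, ContinuousLinearMap.comp_apply, volterra_apply]
    set g := ((volterra ∘L ContinuousMap.pointwiseApply L) ^ n) h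
    have hb : ∀ s ∈ Set.Ioc (0 : ℝ) t, ‖extendUnit (ContinuousMap.pointwiseApply L g) s‖ ≤
        ‖L‖ ^ (n + 1) / n.factorial * ‖h‖ * s ^ n := by
      intro s hs
      have hs' : s ∈ Set.Icc (0 : ℝ) 1 := ⟨hs.1.le, hs.2.trans t.2.2⟩
      rw [extendUnit_of_mem _ hs']
      calc ‖L ⟨s, hs'⟩ (g ⟨s, hs'⟩)‖ ≤ ‖L‖ * ((‖L‖ * s) ^ n / n.factorial * ‖h‖) :=
            ((L _).le_opNorm _).trans (mul_le_mul (L.norm_coe_le_norm _) (ih _)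
              (norm_nonneg _) (norm_nonneg L))
        _ = _ := by rw [mul_pow]; ring
    refine (intervalIntegral.norm_integral_le_of_norm_le t.2.1
      (MeasureTheory.ae_of_all _ fun s hs => hb s hs)
      ((continuous_const.mul (continuous_pow n)).intervalIntegrable _ _)).trans (le_of_eq ?_)
    rw [intervalIntegral.integral_const_mul, integral_pow, Nat.factorial_succ]
    have : ((n : ℝ) + 1) ≠ 0 := by positivity
    have h2 : (n.factorial : ℝ) ≠ 0 := by positivity
    push_cast
    field_simp
    ring

/-- Some power of `K` has norm below `1`, and `1 - K` is a commuting factor of the unit `1 - K ^ n`.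
No smallness of `L` or of the time interval is needed. -/
theorem isInvertible_one_sub_volterra [CompleteSpace V] (L : C(unitInterval, V →L[ℝ] V)) :
    IsUnit (1 - volterra ∘L ContinuousMap.pointwiseApply L) := by
  set K := volterra ∘L ContinuousMap.pointwiseApply L
  obtain ⟨n, hn⟩ : ∃ n : ℕ, ‖L‖ ^ n / n.factorial < 1 :=
    ((FloorSemiring.tendsto_pow_div_factorial_atTop ‖L‖).eventually (gt_mem_nhds one_pos)).exists
  have hK : ‖K ^ n‖ < 1 := by
    refine lt_of_le_of_lt (ContinuousLinearMap.opNorm_le_bound _ (by positivity) fun h => ?_) hn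
    refine (ContinuousMap.norm_le _ (by positivity)).2 fun t => ?_
    refine (norm_volterra_pow_le L n h t).trans ?_
    have ht : ‖L‖ * (t : ℝ) ≤ ‖L‖ := mul_le_of_le_one_right (norm_nonneg L) t.2.2
    have h0 : 0 ≤ ‖L‖ * (t : ℝ) := mul_nonneg (norm_nonneg L) t.2.1
    gcongr
  have hu : IsUnit (1 - K ^ n) :=
    isUnit_one_sub_of_norm_lt_one (R := C(unitInterval, V) →L[ℝ] C(unitInterval, V)) hK
  have hc : Commute (1 - K) (∑ i ∈ Finset.range n, K ^ i) :=
    (Commute.one_left _).sub_left (Commute.sum_right _ _ _ fun i _ => Commute.self_pow K i)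
  rw [← mul_neg_geom_sum K n] at hu
  exact (hc.isUnit_mul_iff.1 hu).1

end Volterra

/-! ### Dependence on initial values -/

section Dependence

variable {W : Type*} [NormedAddCommGroup W] [NormedSpace ℝ W]

/-- The graph of a path. -/
def pathGraph (γ : C(unitInterval, W)) : C(unitInterval, ℝ × W) :=
  ⟨fun s => ((s : ℝ), γ s), continuous_subtype_val.prodMk γ.continuous⟩

theorem hasFDerivAt_pathGraph (γ : C(unitInterval, W)) :
    HasFDerivAt pathGraph
      ((ContinuousLinearMap.inr ℝ ℝ W).compLeftContinuous ℝ unitInterval) γ := by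
  have h : (pathGraph : C(unitInterval, W) → _) = fun γ =>
      pathGraph 0 + (ContinuousLinearMap.inr ℝ ℝ W).compLeftContinuous ℝ unitInterval γ := by
    ext γ s <;> simp [pathGraph]
  rw [h]
  exact (ContinuousLinearMap.hasFDerivAt _).const_add _

theorem contDiff_pathGraph {n : WithTop ℕ∞} :
    ContDiff ℝ n (pathGraph : C(unitInterval, W) → _) := by
  have h : (pathGraph : C(unitInterval, W) → _) = fun γ =>
      pathGraph 0 + (ContinuousLinearMap.inr ℝ ℝ W).compLeftContinuous ℝ unitInterval γ := by
    ext γ s <;> simp [pathGraph]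
  rw [h]
  exact contDiff_const.add (ContinuousLinearMap.contDiff _)

theorem contDiff_postcomp_pathGraph {f : ℝ × W → W} (hf : ContDiff ℝ ∞ f) :
    ContDiff ℝ ∞ (fun γ : C(unitInterval, W) =>
      (⟨f, hf.continuous⟩ : C(ℝ × W, W)).comp (pathGraph γ)) :=
  (contDiff_infty.2 fun n => contDiff_postcomp_nat n hf.continuous
    (hf.of_le (by exact_mod_cast le_top))).comp contDiff_pathGraph

/-- The integral equation of an initial value problem. -/
theorem eq_const_add_volterra_iff [CompleteSpace W] {f : ℝ × W → W} (hf : Continuous f)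
    (γ : C(unitInterval, W)) (x : W) :
    γ = ContinuousMap.const _ x + volterra ((⟨f, hf⟩ : C(ℝ × W, W)).comp (pathGraph γ)) ↔
      extendUnit γ 0 = x ∧ ∀ s ∈ Set.Icc (0 : ℝ) 1,
        HasDerivWithinAt (extendUnit γ) (f (s, extendUnit γ s)) (Set.Icc 0 1) s := by
  set g := (⟨f, hf⟩ : C(ℝ × W, W)).comp (pathGraph γ) with hg
  have hgs : ∀ s ∈ Set.Icc (0 : ℝ) 1, extendUnit g s = f (s, extendUnit γ s) := by
    intro s hs
    rw [extendUnit_of_mem _ hs, extendUnit_of_mem _ hs]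
    rfl
  constructor
  · intro h
    have he : ∀ s ∈ Set.Icc (0 : ℝ) 1, extendUnit γ s = x + extendUnit (volterra g) s := by
      intro s hs
      rw [extendUnit_of_mem _ hs, extendUnit_of_mem _ hs, h]
      simp [hg]
    have h0 : (0 : ℝ) ∈ Set.Icc (0 : ℝ) 1 := ⟨le_rfl, zero_le_one⟩
    refine ⟨?_, fun s hs => ?_⟩
    · rw [he 0 h0, extendUnit_of_mem _ h0, volterra_apply]
      simp
    · rw [← hgs s hs]
      exact ((hasDerivWithinAt_volterra g hs).const_add x).congr he (he s hs)
  · rintro ⟨h0, h⟩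
    ext s
    have hd : ∀ t ∈ Set.Icc (0 : ℝ) 1, HasDerivWithinAt
        (fun t => extendUnit γ t - extendUnit (volterra g) t) 0 (Set.Icc 0 1) t := by
      intro t ht
      simpa [hgs t ht] using (h t ht).fun_sub (hasDerivWithinAt_volterra g ht)
    have hz : (0 : ℝ) ∈ Set.Icc (0 : ℝ) 1 := ⟨le_rfl, zero_le_one⟩
    have key := (convex_Icc (0 : ℝ) 1).norm_image_sub_le_of_norm_hasDerivWithin_le
      (C := 0) hd (by simp) hz s.2
    have hv : extendUnit (volterra g) 0 = 0 := by
      rw [extendUnit_of_mem _ hz, volterra_apply]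
      simp
    rw [zero_mul, h0, hv, sub_zero, norm_le_zero_iff, extendUnit_coe, extendUnit_coe, sub_eq_zero,
      sub_eq_iff_eq_add] at key
    simpa using key

/-- Smooth dependence of the solutions of an ordinary differential equation on the initial value,
near a given solution on `[0,1]`. -/
theorem exists_contDiffAt_solution [CompleteSpace W] {f : ℝ × W → W} (hf : ContDiff ℝ ∞ f)
    (γ₀ : C(unitInterval, W)) (x₀ : W) (h0 : extendUnit γ₀ 0 = x₀)
    (h : ∀ s ∈ Set.Icc (0 : ℝ) 1,
        HasDerivWithinAt (extendUnit γ₀) (f (s, extendUnit γ₀ s)) (Set.Icc 0 1) s) :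
    ∃ Ψ : W → C(unitInterval, W), ContDiffAt ℝ ∞ Ψ x₀ ∧ Ψ x₀ = γ₀ ∧
      ∀ᶠ x in 𝓝 x₀, extendUnit (Ψ x) 0 = x ∧ ∀ s ∈ Set.Icc (0 : ℝ) 1,
        HasDerivWithinAt (extendUnit (Ψ x)) (f (s, extendUnit (Ψ x) s)) (Set.Icc 0 1) s := by
  set N : C(unitInterval, W) → C(unitInterval, W) := fun γ =>
    (⟨f, hf.continuous⟩ : C(ℝ × W, W)).comp (pathGraph γ) with hN
  let c : W →L[ℝ] C(unitInterval, W) := ContinuousLinearMap.const ℝ unitInterval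
  -- The zeros of `G` are the pairs of an initial value and its solution. The partial derivative in
  -- the path is `1` minus a Volterra operator, so the implicit function theorem applies.
  let G : W × C(unitInterval, W) → C(unitInterval, W) := fun p => p.2 - c p.1 - volterra (N p.2)
  have hG : ContDiff ℝ ∞ G := (contDiff_snd.sub (c.contDiff.comp contDiff_fst)).sub
    (volterra.contDiff.comp ((contDiff_postcomp_pathGraph hf).comp contDiff_snd))
  set L : C(unitInterval, W →L[ℝ] W) := ⟨fun s => fderiv ℝ f (s, γ₀ s) ∘L .inr ℝ ℝ W,
    ((hf.continuous_fderiv (by simp)).comp (pathGraph γ₀).continuous).clm_comp continuous_const⟩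
  have hNd : HasFDerivAt N (ContinuousMap.pointwiseApply L) γ₀ :=
    (hasFDerivAt_postcomp (hf.of_le (by simp)) (pathGraph γ₀)).comp γ₀ (hasFDerivAt_pathGraph γ₀)
  have hG2 : fderiv ℝ G (x₀, γ₀) ∘L .inr ℝ W _ =
      1 - volterra ∘L ContinuousMap.pointwiseApply L := by
    have h1 : HasFDerivAt (fun γ => G (x₀, γ))
        (1 - volterra ∘L ContinuousMap.pointwiseApply L) γ₀ := by
      have h3 : HasFDerivAt (fun γ => volterra (N γ))
          (volterra ∘L ContinuousMap.pointwiseApply L) γ₀ :=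
        (volterra (V := W)).hasFDerivAt.comp γ₀ hNd
      exact ((hasFDerivAt_id γ₀).sub_const (c x₀)).sub h3
    have h2 : HasFDerivAt (fun γ => G (x₀, γ)) (fderiv ℝ G (x₀, γ₀) ∘L .inr ℝ W _) γ₀ :=
      (hG.differentiable (by simp) _).hasFDerivAt.comp γ₀ (hasFDerivAt_prodMk_right x₀ γ₀)
    exact h2.unique h1
  have hinv : (fderiv ℝ G (x₀, γ₀) ∘L .inr ℝ W _).IsInvertible := by
    rw [hG2]
    obtain ⟨u, hu⟩ := isInvertible_one_sub_volterra L
    exact ⟨ContinuousLinearEquiv.unitsEquiv ℝ _ u, hu⟩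
  have hc := hG.contDiffAt (x := (x₀, γ₀))
  have hsol : ∀ x γ, G (x, γ) = 0 ↔ extendUnit γ 0 = x ∧ ∀ s ∈ Set.Icc (0 : ℝ) 1,
        HasDerivWithinAt (extendUnit γ) (f (s, extendUnit γ s)) (Set.Icc 0 1) s := by
    intro x γ
    rw [← eq_const_add_volterra_iff hf.continuous γ x, ← sub_eq_zero (a := γ), ← sub_sub]
    rfl
  refine ⟨hc.implicitFunction (by simp) hinv, hc.contDiffAt_implicitFunction _ hinv,
    hc.implicitFunction_apply_self _ hinv, ?_⟩
  filter_upwards [hc.eventually_apply_implicitFunction (by simp) hinv] with x hx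
  rwa [(hsol x₀ γ₀).2 ⟨h0, h⟩, hsol] at hx

/-- The derivative of a family of solutions with respect to the initial value solves the
variational equation. -/
theorem hasDerivWithinAt_fderiv_solution [CompleteSpace W] {f : ℝ × W → W} (hf : ContDiff ℝ ∞ f)
    {Y : Type*} [NormedAddCommGroup Y] [NormedSpace ℝ Y]
    {Ψ : Y → C(unitInterval, W)} {x₀ : Y} {u : Y → W}
    (hΨ : DifferentiableAt ℝ Ψ x₀) (hu : DifferentiableAt ℝ u x₀)
    (h : ∀ᶠ x in 𝓝 x₀, extendUnit (Ψ x) 0 = u x ∧ ∀ s ∈ Set.Icc (0 : ℝ) 1,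
        HasDerivWithinAt (extendUnit (Ψ x)) (f (s, extendUnit (Ψ x) s)) (Set.Icc 0 1) s)
    (a : Y) :
    extendUnit (fderiv ℝ Ψ x₀ a) 0 = fderiv ℝ u x₀ a ∧ ∀ s ∈ Set.Icc (0 : ℝ) 1,
      HasDerivWithinAt (extendUnit (fderiv ℝ Ψ x₀ a))
        (fderiv ℝ f (s, extendUnit (Ψ x₀) s) (0, extendUnit (fderiv ℝ Ψ x₀ a) s))
        (Set.Icc 0 1) s := by
  let c : W →L[ℝ] C(unitInterval, W) := ContinuousLinearMap.const ℝ unitInterval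
  set L : C(unitInterval, W →L[ℝ] W) := ⟨fun s => fderiv ℝ f (s, Ψ x₀ s) ∘L .inr ℝ ℝ W,
    ((hf.continuous_fderiv (by simp)).comp (pathGraph (Ψ x₀)).continuous).clm_comp
      continuous_const⟩
  have hNd : HasFDerivAt (fun γ : C(unitInterval, W) =>
      (⟨f, hf.continuous⟩ : C(ℝ × W, W)).comp (pathGraph γ))
      (ContinuousMap.pointwiseApply L) (Ψ x₀) :=
    (hasFDerivAt_postcomp (hf.of_le (by simp)) (pathGraph _)).comp _ (hasFDerivAt_pathGraph _)
  -- The integral equation holds identically near `x₀`; differentiating it gives the integral form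
  -- of the variational equation.
  have hd : HasFDerivAt Ψ (c ∘L fderiv ℝ u x₀ +
      volterra ∘L (ContinuousMap.pointwiseApply L ∘L fderiv ℝ Ψ x₀)) x₀ := by
    have h1 := (c.hasFDerivAt.comp x₀ hu.hasFDerivAt).add
      ((volterra (V := W)).hasFDerivAt.comp x₀ (hNd.comp x₀ hΨ.hasFDerivAt))
    refine h1.congr_of_eventuallyEq ?_
    filter_upwards [h] with x hx
    exact (eq_const_add_volterra_iff hf.continuous (Ψ x) (u x)).2 hx
  set g := ContinuousMap.pointwiseApply L (fderiv ℝ Ψ x₀ a)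
  have he : fderiv ℝ Ψ x₀ a = c (fderiv ℝ u x₀ a) + volterra g := by
    conv_lhs => rw [hd.fderiv]
    rfl
  have hes : ∀ s ∈ Set.Icc (0 : ℝ) 1, extendUnit (fderiv ℝ Ψ x₀ a) s =
      fderiv ℝ u x₀ a + extendUnit (volterra g) s := by
    intro s hs
    rw [he, extendUnit_of_mem _ hs, extendUnit_of_mem _ hs]
    rfl
  have hz : (0 : ℝ) ∈ Set.Icc (0 : ℝ) 1 := ⟨le_rfl, zero_le_one⟩
  refine ⟨?_, fun s hs => ?_⟩
  · rw [hes 0 hz, extendUnit_of_mem _ hz, volterra_apply]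
    simp
  · have := ((hasDerivWithinAt_volterra g hs).const_add (fderiv ℝ u x₀ a)).congr hes (hes s hs)
    rw [extendUnit_of_mem g hs] at this
    rw [extendUnit_of_mem (Ψ x₀) hs, extendUnit_of_mem (fderiv ℝ Ψ x₀ a) hs]
    exact this

end Dependence

/-! ### Tangent spaces of submanifolds and vector fields along them -/

section Tangent

variable {W : Type*} [NormedAddCommGroup W] [NormedSpace ℝ W]
  {W' : Type*} [NormedAddCommGroup W'] [NormedSpace ℝ W']

theorem HasFDerivWithinAt.mapsTo_tangentSpaceOf {S : Set W} {S' : Set W'} {f : W → W'}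
    {f' : W →L[ℝ] W'} {p : W} (hf : HasFDerivWithinAt f f' S p)
    (hm : ∀ᶠ q in 𝓝[S] p, f q ∈ S') {v : W} (hv : v ∈ tangentSpaceOf S p) :
    f' v ∈ tangentSpaceOf S' (f p) := by
  obtain ⟨U, hU, hUS⟩ := mem_nhdsWithin_iff_exists_mem_nhds_inter.1 hm
  have key : tangentSpaceOf S p ≤ (tangentSpaceOf S' (f p)).comap f'.toLinearMap := by
    refine Submodule.span_le.2 fun v hv => Submodule.subset_span ?_
    rw [← tangentConeAt_inter_nhds hU] at hv
    refine tangentConeAt_mono ?_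
      ((hf.mono Set.inter_subset_left).mapsTo_tangent_cone hv)
    rintro _ ⟨q, hq, rfl⟩
    exact hUS ⟨hq.2, hq.1⟩
  exact key hv

/-- Derivatives within `S` are determined on the tangent cone, hence on its span. This compares
different ambient extensions of one map on a stratum. -/
theorem HasFDerivWithinAt.eq_on_tangentSpaceOf {S : Set W} {f : W → W'}
    {f₁ f₂ : W →L[ℝ] W'} {p : W} (h₁ : HasFDerivWithinAt f f₁ S p)
    (h₂ : HasFDerivWithinAt f f₂ S p) {v : W} (hv : v ∈ tangentSpaceOf S p) : f₁ v = f₂ v := by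
  have key : tangentSpaceOf S p ≤ (f₁.toLinearMap.eqLocus f₂.toLinearMap) :=
    Submodule.span_le.2 fun v hv => h₁.unique_on h₂ hv
  exact key hv

theorem HasDerivWithinAt.mem_tangentSpaceOf {S : Set W} {γ : ℝ → W} {γ' : W} {A : Set ℝ} {s : ℝ}
    (h : HasDerivWithinAt γ γ' A s) (hA : UniqueDiffWithinAt ℝ A s)
    (hm : ∀ᶠ t in 𝓝[A] s, γ t ∈ S) : γ' ∈ tangentSpaceOf S (γ s) := by
  have h1 : (1 : ℝ) ∈ tangentSpaceOf A s := by
    have hne : (Submodule.span ℝ (tangentConeAt ℝ A s)) = ⊤ := by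
      have := hA.dense_tangentConeAt
      rw [Submodule.dense_iff_topologicalClosure_eq_top,
        (Submodule.closed_of_finiteDimensional _).submodule_topologicalClosure_eq] at this
      exact this
    rw [tangentSpaceOf, hne]
    trivial
  simpa using h.hasFDerivWithinAt.mapsTo_tangentSpaceOf hm h1

theorem tangentSpaceOf_submodule [FiniteDimensional ℝ W] (L : Submodule ℝ W) {x : W} (hx : x ∈ L) :
    tangentSpaceOf (L : Set W) x = L := by
  refine le_antisymm (Submodule.span_le.2 fun v hv => ?_) fun v hv => ?_
  · obtain ⟨α, l, hl, c, d, -, hd, hcd⟩ := exists_fun_of_mem_tangentConeAt hv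
    refine L.closed_of_finiteDimensional.mem_of_tendsto hcd (hd.mono fun n hn => ?_)
    have : d n ∈ L := by simpa using L.sub_mem hn hx
    exact L.smul_mem _ this
  · refine Submodule.subset_span (mem_tangentConeAt_of_add_smul_mem
      (l := 𝓝[≠] (0 : ℝ)) tendsto_id ?_)
    exact Filter.Eventually.of_forall fun n => L.add_mem hx (L.smul_mem _ hv)

/-- The data of a chart which straightens `S` to the linear subspace `L`. -/
structure IsStraightening (S : Set W) (Φ : OpenPartialHomeomorph W W) (L : Submodule ℝ W) :
    Prop where
  contDiffOn : ContDiffOn ℝ ∞ Φ Φ.source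
  contDiffOn_symm : ContDiffOn ℝ ∞ Φ.symm Φ.target
  inter_eq : Φ.source ∩ S = Φ.source ∩ Φ ⁻¹' (L : Set W)

namespace IsStraightening

variable {S : Set W} {Φ : OpenPartialHomeomorph W W} {L : Submodule ℝ W} {p : W}

theorem contDiffAt (h : IsStraightening S Φ L) (hp : p ∈ Φ.source) : ContDiffAt ℝ ∞ Φ p :=
  h.contDiffOn.contDiffAt (Φ.open_source.mem_nhds hp)

theorem contDiffAt_symm (h : IsStraightening S Φ L) {z : W} (hz : z ∈ Φ.target) :
    ContDiffAt ℝ ∞ Φ.symm z :=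
  h.contDiffOn_symm.contDiffAt (Φ.open_target.mem_nhds hz)

theorem hasFDerivAt (h : IsStraightening S Φ L) (hp : p ∈ Φ.source) :
    HasFDerivAt Φ (fderiv ℝ Φ p) p :=
  ((h.contDiffAt hp).differentiableAt (by simp)).hasFDerivAt

theorem hasFDerivAt_symm (h : IsStraightening S Φ L) {z : W} (hz : z ∈ Φ.target) :
    HasFDerivAt Φ.symm (fderiv ℝ Φ.symm z) z :=
  ((h.contDiffAt_symm hz).differentiableAt (by simp)).hasFDerivAt

theorem fderiv_symm_fderiv (h : IsStraightening S Φ L) (hp : p ∈ Φ.source) (v : W) :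
    fderiv ℝ Φ.symm (Φ p) (fderiv ℝ Φ p v) = v := by
  have h1 := (h.hasFDerivAt_symm (Φ.map_source hp)).comp p (h.hasFDerivAt hp)
  have h2 : HasFDerivAt (Φ.symm ∘ Φ) (ContinuousLinearMap.id ℝ W) p :=
    (hasFDerivAt_id p).congr_of_eventuallyEq (Φ.eventually_left_inverse hp)
  exact congrArg (fun A => A v) (h1.unique h2)

theorem fderiv_fderiv_symm (h : IsStraightening S Φ L) (hp : p ∈ Φ.source) (v : W) :
    fderiv ℝ Φ p (fderiv ℝ Φ.symm (Φ p) v) = v := by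
  have h0 : HasFDerivAt Φ (fderiv ℝ Φ p) (Φ.symm (Φ p)) := by
    rw [Φ.left_inv hp]; exact h.hasFDerivAt hp
  have h1 := h0.comp (Φ p) (h.hasFDerivAt_symm (Φ.map_source hp))
  have h2 : HasFDerivAt (Φ ∘ Φ.symm) (ContinuousLinearMap.id ℝ W) (Φ p) :=
    (hasFDerivAt_id _).congr_of_eventuallyEq (Φ.eventually_right_inverse (Φ.map_source hp))
  exact congrArg (fun A => A v) (h1.unique h2)

theorem mem_iff (h : IsStraightening S Φ L) (hp : p ∈ Φ.source) : p ∈ S ↔ Φ p ∈ L := by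
  have := Set.ext_iff.1 h.inter_eq p
  simpa [hp] using this

theorem symm_mem_iff (h : IsStraightening S Φ L) {z : W} (hz : z ∈ Φ.target) :
    Φ.symm z ∈ S ↔ z ∈ L := by
  rw [h.mem_iff (Φ.map_target hz), Φ.right_inv hz]

theorem mem_tangentSpaceOf_iff [FiniteDimensional ℝ W] (h : IsStraightening S Φ L)
    (hp : p ∈ Φ.source) (hpS : p ∈ S) (v : W) :
    v ∈ tangentSpaceOf S p ↔ fderiv ℝ Φ p v ∈ L := by
  have hL := (h.mem_iff hp).1 hpS
  constructor
  · intro hv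
    have := (h.hasFDerivAt hp).hasFDerivWithinAt.mapsTo_tangentSpaceOf (S' := (L : Set W)) ?_ hv
    · rwa [tangentSpaceOf_submodule L hL] at this
    · filter_upwards [self_mem_nhdsWithin, mem_nhdsWithin_of_mem_nhds (Φ.open_source.mem_nhds hp)]
        with q hq hqs using (h.mem_iff hqs).1 hq
  · intro hv
    rw [← tangentSpaceOf_submodule L hL] at hv
    have ht := Φ.map_source hp
    have := (h.hasFDerivAt_symm ht).hasFDerivWithinAt.mapsTo_tangentSpaceOf (S' := S) ?_ hv
    · rwa [h.fderiv_symm_fderiv hp, Φ.left_inv hp] at this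
    · filter_upwards [self_mem_nhdsWithin, mem_nhdsWithin_of_mem_nhds (Φ.open_target.mem_nhds ht)]
        with q hq hqs using (h.symm_mem_iff hqs).2 hq

end IsStraightening

theorem IsSmoothSubmanifold.exists_isStraightening {S : Set W} (hS : IsSmoothSubmanifold S) {p : W}
    (hp : p ∈ S) : ∃ (Φ : OpenPartialHomeomorph W W) (L : Submodule ℝ W), p ∈ Φ.source ∧
      IsStraightening S Φ L := by
  obtain ⟨Φ, L, h1, h2, h3, h4⟩ := hS p hp
  exact ⟨Φ, L, h1, h2, h3, h4⟩

end Tangent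

/-! ### Gradient fields along a submanifold -/

section Fields

theorem ContDiffOn.clm_flip {P Y W Z : Type*} [NormedAddCommGroup P] [NormedSpace ℝ P]
    [NormedAddCommGroup Y] [NormedSpace ℝ Y] [NormedAddCommGroup W] [NormedSpace ℝ W]
    [NormedAddCommGroup Z] [NormedSpace ℝ Z] {U : Set P} {g : P → Y →L[ℝ] W →L[ℝ] Z}
    {n : WithTop ℕ∞} (hg : ContDiffOn ℝ n g U) : ContDiffOn ℝ n (fun x => (g x).flip) U := by
  have h := LinearIsometryEquiv.contDiff (𝕜 := ℝ) (n := n) (E := Y →L[ℝ] W →L[ℝ] Z)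
    (F := W →L[ℝ] Y →L[ℝ] Z) (ContinuousLinearMap.flipₗᵢ ℝ Y W Z)
  exact h.comp_contDiffOn hg

/-- Smooth solutions of a smooth family of nondegenerate linear systems, one for each point of the
parameter space `P`, on the image of a family of injections `β x : Y → W`. -/
theorem exists_contDiffOn_dual {P Y W : Type*} [NormedAddCommGroup P] [NormedSpace ℝ P]
    [NormedAddCommGroup Y] [NormedSpace ℝ Y] [FiniteDimensional ℝ Y]
    [NormedAddCommGroup W] [NormedSpace ℝ W] {U : Set P} (hU : IsOpen U) {x₀ : P} (hx₀ : x₀ ∈ U)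
    {g : P → W →L[ℝ] W →L[ℝ] ℝ} {b : P → W →L[ℝ] ℝ} {β : P → Y →L[ℝ] W}
    (hg : ContDiffOn ℝ ∞ g U) (hb : ContDiffOn ℝ ∞ b U) (hβ : ContDiffOn ℝ ∞ β U)
    (hpos : ∀ y, y ≠ 0 → g x₀ (β x₀ y) (β x₀ y) ≠ 0) :
    ∃ V ∈ 𝓝 x₀, V ⊆ U ∧ ∃ η : P → Y, ContDiffOn ℝ ∞ η V ∧
      ∀ x ∈ V, ∀ y, g x (β x (η x)) (β x y) = b x (β x y) := by
  let M : P → Y →L[ℝ] Y →L[ℝ] ℝ := fun x => ((g x).flip ∘L β x).flip ∘L β x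
  have hMa : ∀ x l l', M x l l' = g x (β x l) (β x l') := fun _ _ _ => rfl
  have hM : ContDiffOn ℝ ∞ M U :=
    (hg.clm_flip.clm_comp hβ).clm_flip.clm_comp hβ
  have hinj : Function.Injective (M x₀).toLinearMap := by
    rw [← LinearMap.ker_eq_bot, LinearMap.ker_eq_bot']
    intro l hl
    by_contra hne
    refine hpos l hne ?_
    have hl' : M x₀ l = 0 := hl
    rw [← hMa, hl']
    rfl
  have hfin : Module.finrank ℝ Y = Module.finrank ℝ (Y →L[ℝ] ℝ) := by
    rw [← (LinearMap.toContinuousLinearMap : (Y →ₗ[ℝ] ℝ) ≃ₗ[ℝ] _).finrank_eq]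
    exact (Subspace.dual_finrank_eq).symm
  let e : Y ≃L[ℝ] (Y →L[ℝ] ℝ) := (LinearEquiv.ofInjectiveOfFinrankEq
    (M x₀).toLinearMap hinj hfin).toContinuousLinearEquiv
  have he : (e : Y →L[ℝ] Y →L[ℝ] ℝ) = M x₀ := rfl
  have hV : U ∩ M ⁻¹' Set.range
      ((↑) : (Y ≃L[ℝ] (Y →L[ℝ] ℝ)) → Y →L[ℝ] Y →L[ℝ] ℝ) ∈ 𝓝 x₀ :=
    inter_mem (hU.mem_nhds hx₀) ((hM.continuousOn.continuousAt (hU.mem_nhds hx₀)).preimage_mem_nhds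
      (ContinuousLinearEquiv.isOpen.mem_nhds ⟨e, he⟩))
  refine ⟨_, hV, Set.inter_subset_left, fun x => (M x).inverse (b x ∘L β x), ?_, ?_⟩
  · have hinv : ContDiffOn ℝ ∞ (fun x => (M x).inverse) (U ∩ M ⁻¹' Set.range
        ((↑) : (Y ≃L[ℝ] (Y →L[ℝ] ℝ)) → Y →L[ℝ] Y →L[ℝ] ℝ)) := by
      rintro x ⟨hx, e', he'⟩
      have : ContDiffAt ℝ ∞ ContinuousLinearMap.inverse (M x) := he' ▸ contDiffAt_map_inverse e'
      exact this.comp_contDiffWithinAt x ((hM x hx).mono Set.inter_subset_left)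
    exact hinv.clm_apply ((hb.clm_comp hβ).mono
      Set.inter_subset_left)
  · rintro x ⟨hx, e', he'⟩ l
    rw [← hMa]
    change M x ((M x).inverse (b x ∘L β x)) l = _
    rw [← he', ContinuousLinearMap.inverse_equiv]
    simp

variable {W : Type*} [NormedAddCommGroup W] [NormedSpace ℝ W]
  {S : Set W} {G : ℝ → W →L[ℝ] W →L[ℝ] ℝ} {B : W → W →L[ℝ] ℝ}

/-- `ζ` is the vector in the tangent space of `S` at `x` dual to the covector `B x` with respect
to the bilinear form `G s`. -/
def IsGradientAt (S : Set W) (G : ℝ → W →L[ℝ] W →L[ℝ] ℝ) (B : W → W →L[ℝ] ℝ) (s : ℝ) (x ζ : W) :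
    Prop :=
  ζ ∈ tangentSpaceOf S x ∧ ∀ v ∈ tangentSpaceOf S x, G s ζ v = B x v

theorem IsGradientAt.unique {s : ℝ} {x ζ ζ' : W} (h : IsGradientAt S G B s x ζ)
    (h' : IsGradientAt S G B s x ζ')
    (hpos : ∀ v ∈ tangentSpaceOf S x, v ≠ 0 → G s v v ≠ 0) : ζ = ζ' := by
  by_contra hne
  have hm := Submodule.sub_mem _ h.1 h'.1
  refine hpos _ hm (sub_ne_zero.2 hne) ?_
  rw [map_sub (G s), sub_apply, h.2 _ hm, h'.2 _ hm, sub_self]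

variable [FiniteDimensional ℝ W]

/-- A straightening extends the tangent spaces of `S` to a smooth family of subspaces on an open set
of the ambient space. Solving the Gram system on this family gives a field that is smooth on an open
set and not merely along `S`. -/
theorem exists_local_gradient (hS : IsSmoothSubmanifold S) (hG : ContDiff ℝ ∞ G)
    (hB : ContDiff ℝ ∞ B) {x₀ : ℝ × W} (hx₀ : x₀.2 ∈ S)
    (hpos : ∀ v ∈ tangentSpaceOf S x₀.2, v ≠ 0 → G x₀.1 v v ≠ 0) :
    ∃ U ∈ 𝓝 x₀, ∃ ζ : ℝ × W → W, ContDiffOn ℝ ∞ ζ U ∧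
      ∀ x ∈ U, x.2 ∈ S → IsGradientAt S G B x.1 x.2 (ζ x) := by
  obtain ⟨Φ, L, hps, h⟩ := hS.exists_isStraightening hx₀
  let β : W → L →L[ℝ] W := fun q => fderiv ℝ Φ.symm (Φ q) ∘L L.subtypeL
  have hβ : ContDiffOn ℝ ∞ β Φ.source := by
    have h1 : ContDiffOn ℝ ∞ (fderiv ℝ Φ.symm) Φ.target :=
      h.contDiffOn_symm.fderiv_of_isOpen Φ.open_target (by simp)
    exact (h1.comp h.contDiffOn Φ.mapsTo).clm_comp contDiffOn_const
  have hβT : ∀ q ∈ Φ.source, q ∈ S → ∀ v, v ∈ tangentSpaceOf S q ↔ ∃ l, β q l = v := by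
    intro q hq hqS v
    rw [h.mem_tangentSpaceOf_iff hq hqS]
    constructor
    · intro hv
      exact ⟨⟨_, hv⟩, h.fderiv_symm_fderiv hq v⟩
    · rintro ⟨l, rfl⟩
      have := h.fderiv_fderiv_symm hq l
      simp only [β, ContinuousLinearMap.comp_apply, Submodule.subtypeL_apply, this]
      exact l.2
  have hβi : ∀ q ∈ Φ.source, ∀ l, β q l = 0 → l = 0 := by
    intro q hq l hl
    have := h.fderiv_fderiv_symm hq l
    have h2 : fderiv ℝ Φ.symm (Φ q) l = 0 := hl
    rw [h2, map_zero] at this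
    exact Subtype.ext this.symm
  have hβ2 : ContDiffOn ℝ ∞ (fun x : ℝ × W => β x.2) (Set.univ ×ˢ Φ.source) :=
    hβ.comp contDiffOn_snd fun x hx => hx.2
  obtain ⟨V, hV, hVs, η, hη, hηg⟩ := exists_contDiffOn_dual
    (U := (Set.univ : Set ℝ) ×ˢ Φ.source) (isOpen_univ.prod Φ.open_source)
    (x₀ := x₀) ⟨trivial, hps⟩
    (hG.comp contDiff_fst).contDiffOn (hB.comp contDiff_snd).contDiffOn
    hβ2 (fun y hy => hpos _ ((hβT _ hps hx₀ _).2 ⟨y, rfl⟩) fun h0 => hy (hβi _ hps y h0))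
  refine ⟨V, hV, fun x => β x.2 (η x), (hβ2.mono hVs).clm_apply hη, fun x hx hxS => ?_⟩
  refine ⟨(hβT _ (hVs hx).2 hxS _).2 ⟨_, rfl⟩, fun v hv => ?_⟩
  obtain ⟨l, rfl⟩ := (hβT _ (hVs hx).2 hxS _).1 hv
  exact hηg x hx l

/-- A smooth compactly supported vector field which is the gradient along a compact set. -/
theorem exists_global_gradient (hS : IsSmoothSubmanifold S) (hG : ContDiff ℝ ∞ G)
    (hB : ContDiff ℝ ∞ B) {C : Set (ℝ × W)} (hC : IsCompact C) (hCS : ∀ x ∈ C, x.2 ∈ S)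
    (hpos : ∀ x ∈ C, ∀ v ∈ tangentSpaceOf S x.2, v ≠ 0 → G x.1 v v ≠ 0) :
    ∃ f : ℝ × W → W, ContDiff ℝ ∞ f ∧ HasCompactSupport f ∧
      ∀ x ∈ C, IsGradientAt S G B x.1 x.2 (f x) := by
  -- The gradient condition at a point of `C` is affine in `ζ`, and nothing is required off `C`, so
  -- local solutions can be glued by a partition of unity.
  obtain ⟨g, hg⟩ := exists_contMDiffMap_forall_mem_convex_of_local (n := ⊤)
    (I := modelWithCornersSelf ℝ (ℝ × W)) (M := ℝ × W) (F := W)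
    (t := fun x => {ζ | x ∈ C → IsGradientAt S G B x.1 x.2 ζ}) (fun x => by
      intro ζ hζ ζ' hζ' a b _ _ hab hx
      refine ⟨Submodule.add_mem _ (Submodule.smul_mem _ _ (hζ hx).1)
        (Submodule.smul_mem _ _ (hζ' hx).1), fun v hv => ?_⟩
      simp only [map_add, map_smul, add_apply, smul_apply,
        (hζ hx).2 v hv, (hζ' hx).2 v hv]
      rw [← add_smul, hab, one_smul]) (fun x => by
      by_cases hx : x ∈ C
      · obtain ⟨U, hU, ζ, hζ, h⟩ := exists_local_gradient hS hG hB (hCS x hx) (hpos x hx)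
        exact ⟨U, hU, ζ, hζ.contMDiffOn, fun y hy hyC => h y hy (hCS y hyC)⟩
      · exact ⟨Cᶜ, hC.isClosed.isOpen_compl.mem_nhds hx, 0, contMDiffOn_const,
          fun y hy hyC => absurd hyC hy⟩)
  obtain ⟨r, hr0, hr⟩ := hC.isBounded.subset_closedBall_lt 0 0
  let b : ContDiffBump (0 : ℝ × W) := ⟨r, r + 1, hr0, by linarith⟩
  refine ⟨fun x => b x • g x, b.contDiff.smul g.contMDiff.contDiff,
    b.hasCompactSupport.smul_right, fun x hx => ?_⟩
  simp only [b.one_of_mem_closedBall (hr hx), one_smul]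
  exact hg x hx

/-- Integral curves of a vector field tangent to a submanifold do not leave it immediately. -/
theorem eventually_mem_of_tangent (hS : IsSmoothSubmanifold S) {f : ℝ × W → W}
    (hf : ContDiff ℝ 1 f) {γ : ℝ → W} {a b : ℝ} (hab : a < b) (ha : γ a ∈ S)
    (hcont : ContinuousOn γ (Set.Icc a b))
    (hγ : ∀ s ∈ Set.Ico a b, HasDerivWithinAt γ (f (s, γ s)) (Set.Ici s) s)
    (htan : ∀ᶠ x in 𝓝 (a, γ a), x.1 ∈ Set.Ico a b → x.2 ∈ S → f x ∈ tangentSpaceOf S x.2) :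
    ∀ᶠ s in 𝓝[>] a, γ s ∈ S := by
  obtain ⟨Φ, L, hps, h⟩ := hS.exists_isStraightening ha
  obtain ⟨L', hL'⟩ := L.exists_isCompl
  let Q : W →L[ℝ] W := LinearMap.toContinuousLinearMap 
    (L'.subtype ∘ₗ L'.projectionOnto L hL'.symm)
  have hQ : ∀ z, Q z = 0 ↔ z ∈ L := by
    intro z
    simp [Q]
  have hQQ : ∀ z, z - Q z ∈ L := by
    intro z
    rw [← hQ, map_sub, sub_eq_zero]
    exact congrArg Subtype.val (L'.projectionOnto_apply_left hL'.symm _).symm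
  set z₀ := Φ (γ a) with hz₀
  have hz₀t : z₀ ∈ Φ.target := Φ.map_source hps
  -- `k` is the component of the field transverse to `L` in the chart. It vanishes on `L` by
  -- tangency, so its Lipschitz bound gives `‖k (s, z)‖ ≤ K ‖Q z‖`, and Gronwall forces `Q (Φ (γ s))
  -- = 0`.
  let k : ℝ × W → W := fun x => Q (fderiv ℝ Φ (Φ.symm x.2) (f (x.1, Φ.symm x.2)))
  have hk : ContDiffAt ℝ 1 k (a, z₀) := by
    have h1 : ContDiffAt ℝ 1 (fun x : ℝ × W => Φ.symm x.2) (a, z₀) :=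
      ((h.contDiffAt_symm hz₀t).of_le (by simp)).comp (a, z₀) contDiffAt_snd
    have h2 : ContDiffAt ℝ 1 (fderiv ℝ Φ) (Φ.symm z₀) := by
      rw [hz₀, Φ.left_inv hps]
      exact (h.contDiffAt hps).fderiv_right (n := ∞) (WithTop.coe_le_coe.2 le_top)
    exact Q.contDiff.contDiffAt.comp _ ((h2.comp (a, z₀) h1).clm_apply
      (hf.contDiffAt.comp (a, z₀) (contDiffAt_fst.prodMk h1)))
  obtain ⟨K, t, ht, hKt⟩ := hk.exists_lipschitzOnWith
  have hsymm : Tendsto (fun x : ℝ × W => (x.1, Φ.symm x.2)) (𝓝 (a, z₀)) (𝓝 (a, γ a)) := by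
    have h1 : Tendsto (fun x : ℝ × W => Φ.symm x.2) (𝓝 (a, z₀)) (𝓝 (γ a)) := by
      have := (Φ.continuousAt_symm hz₀t).tendsto
      rw [hz₀, Φ.left_inv hps] at this
      exact this.comp (continuous_snd.tendsto _)
    exact (continuous_fst.tendsto' (a, z₀) a rfl).prodMk_nhds h1
  have hk0 : ∀ᶠ x in 𝓝 (a, z₀), x.1 ∈ Set.Ico a b → x.2 ∈ L → k x = 0 := by
    filter_upwards [hsymm.eventually htan,
      (continuous_snd.tendsto (a, z₀)).eventually (Φ.open_target.mem_nhds hz₀t)] with x hx hxt h1 h2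
    have hxS : Φ.symm x.2 ∈ S := (h.symm_mem_iff hxt).2 h2
    have := hx h1 hxS
    rw [h.mem_tangentSpaceOf_iff (Φ.map_target hxt) hxS] at this
    exact (hQ _).2 this
  have hγa : Tendsto γ (𝓝[≥] a) (𝓝 (γ a)) := by
    rw [← nhdsWithin_Icc_eq_nhdsGE hab]
    exact hcont a ⟨le_rfl, hab.le⟩
  have hΦγ : Tendsto (fun s => (s, Φ (γ s))) (𝓝[≥] a) (𝓝 (a, z₀)) :=
    (tendsto_id.mono_left nhdsWithin_le_nhds).prodMk_nhds
      ((Φ.continuousAt hps).tendsto.comp hγa)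
  have hproj : Tendsto (fun x : ℝ × W => (x.1, x.2 - Q x.2)) (𝓝 (a, z₀)) (𝓝 (a, z₀)) := by
    have hz : z₀ - Q z₀ = z₀ := by rw [(hQ z₀).2 ((h.mem_iff hps).1 ha), sub_zero]
    have : Continuous (fun x : ℝ × W => (x.1, x.2 - Q x.2)) := by fun_prop
    exact this.tendsto' _ _ (by simp [hz])
  have hev : ∀ᶠ s in 𝓝[≥] a, s < b ∧ γ s ∈ Φ.source ∧ (s, Φ (γ s)) ∈ t ∧
      (s, Φ (γ s) - Q (Φ (γ s))) ∈ t ∧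
      (s ∈ Set.Ico a b → k (s, Φ (γ s) - Q (Φ (γ s))) = 0) := by
    filter_upwards [mem_nhdsWithin_of_mem_nhds (Iio_mem_nhds hab),
      hγa.eventually (Φ.open_source.mem_nhds hps), hΦγ.eventually ht,
      (hproj.comp hΦγ).eventually ht, (hproj.comp hΦγ).eventually hk0] with s h1 h2 h3 h4 h5
    exact ⟨h1, h2, h3, h4, fun h6 => h5 h6 (hQQ _)⟩
  obtain ⟨c, hac, hc⟩ := (mem_nhdsGE_iff_exists_Icc_subset).1 hev
  have hac' : a < c := hac
  have hcb : c < b := (hc ⟨hac'.le, le_rfl⟩).1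
  have hzero : ∀ s ∈ Set.Icc a c, Q (Φ (γ s)) = 0 := by
    refine eq_zero_of_abs_deriv_le_mul_abs_self_of_eq_zero_right (K := K)
      (f' := fun s => k (s, Φ (γ s))) ?_ ?_ ?_ ?_
    · exact Q.continuous.comp_continuousOn (Φ.continuousOn.comp
        (hcont.mono (Set.Icc_subset_Icc_right hcb.le)) fun s hs => (hc hs).2.1)
    · intro s hs
      have hss := (hc (Set.Ico_subset_Icc_self hs)).2.1
      have h1 := (h.hasFDerivAt hss).comp_hasDerivWithinAt s (hγ s ⟨hs.1, hs.2.trans hcb⟩)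
      have h2 := Q.hasFDerivAt.comp_hasDerivWithinAt s h1
      simpa [k, Φ.left_inv hss] using! h2
    · exact (hQ _).2 ((h.mem_iff hps).1 ha)
    · intro s hs
      obtain ⟨h1, h2, h3, h4, h5⟩ := hc (Set.Ico_subset_Icc_self hs)
      have := hKt.dist_le_mul _ h3 _ h4
      rw [dist_eq_norm, h5 ⟨hs.1, h1⟩, sub_zero, dist_eq_norm] at this
      simpa [Prod.norm_def] using this
  filter_upwards [Ioc_mem_nhdsGT hac'] with s hs
  have hs' : s ∈ Set.Icc a c := ⟨hs.1.le, hs.2⟩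
  exact (h.mem_iff (hc hs').2.1).2 ((hQ _).1 (hzero s hs'))

end Fields

/-! ### Compactly supported time-dependent vector fields -/

section CompactSupport

/-- The minimum of `F` on the compact set `K \ U` is positive. With `F` the distance of the moment
from a given value, a property of a level set spreads to all nearby levels. -/
theorem IsCompact.exists_pos_forall_le {X : Type*} [TopologicalSpace X] {K U : Set X}
    (hK : IsCompact K) (hU : IsOpen U) {F : X → ℝ} (hF : ContinuousOn F K)
    (h : ∀ x ∈ K, x ∉ U → 0 < F x) : ∃ δ > 0, ∀ x ∈ K, F x ≤ δ → x ∈ U := by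
  rcases (K \ U).eq_empty_or_nonempty with he | hne
  · exact ⟨1, one_pos, fun x hx _ => Set.sdiff_eq_empty.1 he hx⟩
  · obtain ⟨x₀, hx₀, hmin⟩ := (hK.diff hU).exists_isMinOn hne (hF.mono Set.sdiff_subset)
    refine ⟨F x₀ / 2, half_pos (h _ hx₀.1 hx₀.2), fun x hx hxF => ?_⟩
    by_contra hxU
    have h1 : F x₀ ≤ F x := hmin ⟨hx, hxU⟩
    have h2 := h _ hx₀.1 hx₀.2
    linarith

theorem HasDerivWithinAt.Ici_of_Icc {W : Type*} [NormedAddCommGroup W] [NormedSpace ℝ W]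
    {γ : ℝ → W} {v : W} {a b s : ℝ} (h : HasDerivWithinAt γ v (Set.Icc a b) s)
    (hs : s ∈ Set.Ico a b) : HasDerivWithinAt γ v (Set.Ici s) s :=
  h.mono_of_mem_nhdsWithin (Icc_mem_nhdsGE_of_mem hs)

variable {W : Type*} [NormedAddCommGroup W] [NormedSpace ℝ W]

/-- `γ` is a solution on `[0,1]` of the differential equation given by `f`. -/
def IsUnitSolution (f : ℝ × W → W) (γ : ℝ → W) : Prop :=
  ∀ s ∈ Set.Icc (0 : ℝ) 1, HasDerivWithinAt γ (f (s, γ s)) (Set.Icc 0 1) s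

theorem IsUnitSolution.continuousOn {f : ℝ × W → W} {γ : ℝ → W} (h : IsUnitSolution f γ) :
    ContinuousOn γ (Set.Icc 0 1) := fun s hs => (h s hs).continuousWithinAt

theorem exists_lipschitz_of_hasCompactSupport {f : ℝ × W → W} (hf : ContDiff ℝ ∞ f)
    (hc : HasCompactSupport f) : ∃ K : NNReal, ∀ s, LipschitzWith K fun x => f (s, x) := by
  obtain ⟨K, hK⟩ := hf.lipschitzWith_of_hasCompactSupport hc (by simp)
  refine ⟨K, fun s => ?_⟩
  have := hK.comp (LipschitzWith.prodMk_left s)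
  simpa using! this

theorem IsUnitSolution.eqOn {f : ℝ × W → W} (hf : ContDiff ℝ ∞ f) (hc : HasCompactSupport f)
    {γ η : ℝ → W} (hγ : IsUnitSolution f γ) (hη : IsUnitSolution f η) (h0 : γ 0 = η 0) :
    Set.EqOn γ η (Set.Icc 0 1) := by
  obtain ⟨K, hK⟩ := exists_lipschitz_of_hasCompactSupport hf hc
  exact ODE_solution_unique (v := fun s x => f (s, x)) hK
    hγ.continuousOn (fun t ht => (hγ t (Set.Ico_subset_Icc_self ht)).Ici_of_Icc ht)
    hη.continuousOn (fun t ht => (hη t (Set.Ico_subset_Icc_self ht)).Ici_of_Icc ht) h0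

theorem exists_isUnitSolution [CompleteSpace W] {f : ℝ × W → W} (hf : ContDiff ℝ ∞ f)
    (hc : HasCompactSupport f) (x : W) : ∃ γ, γ 0 = x ∧ IsUnitSolution f γ := by
  obtain ⟨K, hK⟩ := exists_lipschitz_of_hasCompactSupport hf hc
  obtain ⟨C, hC⟩ := hc.exists_bound_of_continuous hf.continuous
  -- The field is globally Lipschitz and bounded by `C`, so a solution stays in the ball of radius
  -- `C` for unit time.
  have hp : IsPicardLindelof (fun s x => f (s, x)) (tmin := 0) (tmax := 1)
      ⟨0, le_rfl, zero_le_one⟩ x C.toNNReal 0 C.toNNReal K :=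
    { lipschitzOnWith := fun t _ => (hK t).lipschitzOnWith
      continuousOn := fun y _ => (hf.continuous.comp (by fun_prop)).continuousOn
      norm_le := fun t _ y _ => (hC _).trans (Real.le_coe_toNNReal C)
      mul_max_le := by simp }
  exact hp.exists_eq_forall_mem_Icc_hasDerivWithinAt₀

end CompactSupport

/-! ### The Moser flow on a stratified set -/

theorem contDiff_interpolation (V : Type*) [NormedAddCommGroup V] [NormedSpace ℝ V] (a₀ e : ℝ)
    (A B : V) : ContDiff ℝ ∞ fun s : ℝ => (1 - (a₀ + e * s)) • A + (a₀ + e * s) • B := by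
  fun_prop

/-- A closed subset `⋃ σ, S σ` of a vector space `W`, stratified by smooth submanifolds, with two
bilinear forms that define Kähler metrics on the strata for the complex structure `J`, linear
vector fields `J (N k)` whose Hamiltonians separate the strata and confine them to bounded sets, and
local linear retractions `π σ` onto the strata. -/
structure MoserData (W : Type*) [NormedAddCommGroup W] [NormedSpace ℝ W] (ι : Type*) (r : ℕ) where
  S : ι → Set W
  g₀ : W →L[ℝ] W →L[ℝ] ℝ
  g₁ : W →L[ℝ] W →L[ℝ] ℝ
  J : W →L[ℝ] W
  N : Fin r → W →L[ℝ] W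
  π : ι → W →L[ℝ] W
  symm₀ : ∀ v w, g₀ v w = g₀ w v
  symm₁ : ∀ v w, g₁ v w = g₁ w v
  J₀ : ∀ v w, g₀ (J v) w = -g₀ v (J w)
  J₁ : ∀ v w, g₁ (J v) w = -g₁ v (J w)
  N₀ : ∀ k v w, g₀ (N k v) w = g₀ v (N k w)
  N₁ : ∀ k v w, g₁ (N k v) w = g₁ v (N k w)
  π₀ : ∀ σ v w, g₀ (π σ v) w = g₀ v (π σ w)
  π₁ : ∀ σ v w, g₁ (π σ v) w = g₁ v (π σ w)
  smooth : ∀ σ, IsSmoothSubmanifold (S σ)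
  locallyClosed : ∀ σ, IsLocallyClosed (S σ)
  closed : IsClosed (⋃ σ, S σ)
  J_mem : ∀ σ, ∀ p ∈ S σ, ∀ v ∈ tangentSpaceOf (S σ) p, J v ∈ tangentSpaceOf (S σ) p
  N_mem : ∀ σ, ∀ p ∈ S σ, ∀ k, N k p ∈ tangentSpaceOf (S σ) p
  coercive : ∀ p ∈ ⋃ σ, S σ, ∃ c > 0, ∀ᶠ q in 𝓝 p, ∀ τ, q ∈ S τ → ∀ v ∈ tangentSpaceOf (S τ) q,
    ∀ a ∈ Set.Icc (0 : ℝ) 1, c * ‖v‖ ^ 2 ≤ (1 - a) * g₀ v v + a * g₁ v v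
  bounded : ∀ C, ∃ R, ∀ a ∈ Set.Icc (0 : ℝ) 1, ∀ q ∈ ⋃ σ, S σ,
    (∀ k, |(1 - a) * g₀ (N k q) q + a * g₁ (N k q) q| ≤ C) → ‖q‖ ≤ R
  separated : ∀ σ τ, ∀ p ∈ S σ, ∀ q ∈ S τ, ∀ a ∈ Set.Icc (0 : ℝ) 1, ∀ b ∈ Set.Icc (0 : ℝ) 1,
    (∀ k, (1 - a) * g₀ (N k p) p + a * g₁ (N k p) p = (1 - b) * g₀ (N k q) q + b * g₁ (N k q) q) →
    σ = τ
  π_self : ∀ σ, ∀ p ∈ S σ, π σ p = p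
  π_maps : ∀ σ, ∀ p ∈ S σ, ∀ᶠ q in 𝓝[⋃ τ, S τ] p, π σ q ∈ S σ
  whitney : ∀ σ τ, ∀ p ∈ S σ, ∀ w ∈ tangentSpaceOf (S σ) p, ∀ ε > 0,
    ∀ᶠ q in 𝓝[S τ] p, ∃ u ∈ tangentSpaceOf (S τ) q, ‖u - w‖ < ε

namespace MoserData

variable {W : Type*} [NormedAddCommGroup W] [NormedSpace ℝ W]
  {ι : Type*} {r : ℕ} (D : MoserData W ι r)

/-- The interpolation of the two metrics. -/
def form (a : ℝ) : W →L[ℝ] W →L[ℝ] ℝ := (1 - a) • D.g₀ + a • D.g₁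

theorem form_apply (a : ℝ) (v w : W) : D.form a v w = (1 - a) * D.g₀ v w + a * D.g₁ v w := rfl

theorem form_symm (a : ℝ) (v w : W) : D.form a v w = D.form a w v := by
  simp only [form_apply, D.symm₀ v w, D.symm₁ v w]

theorem form_π (a : ℝ) (σ : ι) (v w : W) : D.form a (D.π σ v) w = D.form a v (D.π σ w) := by
  simp only [form_apply, D.π₀, D.π₁]

theorem form_J (a : ℝ) (v w : W) : D.form a (D.J v) w = -D.form a v (D.J w) := by
  simp only [form_apply, D.J₀, D.J₁]
  ring

theorem contDiff_form (a₀ e : ℝ) : ContDiff ℝ ∞ fun s : ℝ => D.form (a₀ + e * s) := by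
  exact contDiff_interpolation (W →L[ℝ] W →L[ℝ] ℝ) a₀ e D.g₀ D.g₁

/-- The covector field which defines the Moser vector field. -/
def covec (e : ℝ) : W →L[ℝ] W →L[ℝ] ℝ := (-(e / 2)) • (D.g₁ - D.g₀)

theorem covec_apply (e : ℝ) (v w : W) :
    D.covec e v w = -(e / 2) * (D.g₁ v w - D.g₀ v w) := rfl

/-- The moment map. -/
def moment (a : ℝ) (v : W) : Fin r → ℝ := fun k => D.form a (D.N k v) v

theorem stratum_eq {σ τ : ι} {p q : W} (hp : p ∈ D.S σ) (hq : q ∈ D.S τ) {a b : ℝ}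
    (ha : a ∈ Set.Icc (0 : ℝ) 1) (hb : b ∈ Set.Icc (0 : ℝ) 1)
    (h : D.moment a p = D.moment b q) : σ = τ :=
  D.separated σ τ p hp q hq a ha b hb fun k => congrFun h k

theorem subset_iUnion (σ : ι) : D.S σ ⊆ ⋃ σ, D.S σ := Set.subset_iUnion D.S σ

theorem form_pos {σ : ι} {p : W} (hp : p ∈ D.S σ) {v : W} (hv : v ∈ tangentSpaceOf (D.S σ) p)
    (hv0 : v ≠ 0) {a : ℝ} (ha : a ∈ Set.Icc (0 : ℝ) 1) : D.form a v v ≠ 0 := by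
  obtain ⟨c, hc, h⟩ := D.coercive p (D.subset_iUnion σ hp)
  have := h.self_of_nhds σ hp v hv a ha
  have h2 : 0 < c * ‖v‖ ^ 2 := by positivity
  rw [form_apply]
  exact (h2.trans_le this).ne'

/-- The Moser vector field at time `s` on the stratum `σ`. -/
def IsMoserAt (a₀ e : ℝ) (σ : ι) (s : ℝ) (x ζ : W) : Prop :=
  IsGradientAt (D.S σ) (fun s => D.form (a₀ + e * s)) (fun x => D.covec e x) s x ζ

/-- A trajectory of the Moser vector field in the stratum `σ`. -/
def IsTraj (a₀ e : ℝ) (σ : ι) (γ : ℝ → W) : Prop :=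
  ∀ s ∈ Set.Icc (0 : ℝ) 1, γ s ∈ D.S σ ∧
    ∃ ζ, D.IsMoserAt a₀ e σ s (γ s) ζ ∧ HasDerivWithinAt γ ζ (Set.Icc 0 1) s

variable {D} {a₀ e : ℝ} {σ : ι}

/-- As `N k` is selfadjoint for both forms, the derivative of `g_a(N x, x)` is `e (g₁ - g₀)(N x, x)
+ 2 g_a(ζ, N x)`. This vanishes by the equation of `ζ`, tested on the tangent vector `N x`. -/
theorem hasDerivWithinAt_moment {γ : ℝ → W} {s : ℝ} {ζ : W} {A : Set ℝ} (hs : γ s ∈ D.S σ)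
    (hζ : D.IsMoserAt a₀ e σ s (γ s) ζ) (hγ : HasDerivWithinAt γ ζ A s) :
    HasDerivWithinAt (fun s => D.moment (a₀ + e * s) (γ s)) 0 A s := by
  rw [hasDerivWithinAt_pi]
  intro k
  have ha : HasDerivWithinAt (fun s : ℝ => a₀ + e * s) e A s := by
    simpa using ((hasDerivWithinAt_id s A).const_mul e).const_add a₀
  have hN : HasDerivWithinAt (fun s => D.N k (γ s)) (D.N k ζ) A s :=
    (D.N k).hasFDerivAt.comp_hasDerivWithinAt s hγ
  have h0 : HasDerivWithinAt (fun s => D.g₀ (D.N k (γ s)) (γ s))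
      (D.g₀ (D.N k ζ) (γ s) + D.g₀ (D.N k (γ s)) ζ) A s :=
    (D.g₀.hasFDerivAt.comp_hasDerivWithinAt s hN).clm_apply hγ
  have h1 : HasDerivWithinAt (fun s => D.g₁ (D.N k (γ s)) (γ s))
      (D.g₁ (D.N k ζ) (γ s) + D.g₁ (D.N k (γ s)) ζ) A s :=
    (D.g₁.hasFDerivAt.comp_hasDerivWithinAt s hN).clm_apply hγ
  have h2 := ((ha.const_sub 1).mul h0).add (ha.mul h1)
  refine h2.congr_deriv ?_
  have key := hζ.2 _ (D.N_mem σ _ hs k)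
  simp only [form_apply, covec_apply] at key
  have e0 : D.g₀ (D.N k ζ) (γ s) = D.g₀ ζ (D.N k (γ s)) := D.N₀ _ _ _
  have e1 : D.g₁ (D.N k ζ) (γ s) = D.g₁ ζ (D.N k (γ s)) := D.N₁ _ _ _
  rw [e0, e1, D.symm₀ (D.N k (γ s)), D.symm₁ (D.N k (γ s)), D.symm₀ (D.N k (γ s)),
    D.symm₁ (D.N k (γ s))]
  simp only [Pi.zero_apply]
  linear_combination 2 * key

theorem moment_eq_of_hasDerivWithinAt {γ : ℝ → W} {b c : ℝ}
    (h : ∀ s ∈ Set.Icc b c, γ s ∈ D.S σ ∧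
      ∃ ζ, D.IsMoserAt a₀ e σ s (γ s) ζ ∧ HasDerivWithinAt γ ζ (Set.Icc b c) s)
    {s : ℝ} (hs : s ∈ Set.Icc b c) :
    D.moment (a₀ + e * s) (γ s) = D.moment (a₀ + e * b) (γ b) := by
  have key := (convex_Icc b c).norm_image_sub_le_of_norm_hasDerivWithin_le (C := 0)
    (f := fun s => D.moment (a₀ + e * s) (γ s)) (f' := fun _ => 0)
    (fun s hs => by
      obtain ⟨h1, ζ, h2, h3⟩ := h s hs
      exact hasDerivWithinAt_moment h1 h2 h3) (by simp)
    (x := b) (y := s) ⟨le_rfl, hs.1.trans hs.2⟩ hs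
  rw [zero_mul, norm_le_zero_iff, sub_eq_zero] at key
  exact key

theorem IsTraj.moment_eq {γ : ℝ → W} (h : D.IsTraj a₀ e σ γ) {s : ℝ}
    (hs : s ∈ Set.Icc (0 : ℝ) 1) : D.moment (a₀ + e * s) (γ s) = D.moment a₀ (γ 0) := by
  simpa using moment_eq_of_hasDerivWithinAt h hs

theorem IsMoserAt.unique (ha : ∀ s ∈ Set.Icc (0 : ℝ) 1, a₀ + e * s ∈ Set.Icc (0 : ℝ) 1)
    {s : ℝ} (hs : s ∈ Set.Icc (0 : ℝ) 1) {q ζ ζ' : W}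
    (hq : q ∈ D.S σ) (h : D.IsMoserAt a₀ e σ s q ζ) (h' : D.IsMoserAt a₀ e σ s q ζ') : ζ = ζ' :=
  IsGradientAt.unique h h' fun _ hv hv0 => D.form_pos hq hv hv0 (ha s hs)

/-- The covector is linear in `e`, so time reversal only changes the parameters. With general `a₀`
and `e`, the inverse of a flow is a flow of the same kind. -/
theorem IsTraj.reverse {γ : ℝ → W} (hγ : D.IsTraj a₀ e σ γ) :
    D.IsTraj (a₀ + e) (-e) σ (fun s => γ (1 - s)) := by
  intro s hs
  have hs' : 1 - s ∈ Set.Icc (0 : ℝ) 1 := ⟨by linarith [hs.2], by linarith [hs.1]⟩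
  obtain ⟨h1, ζ, ⟨h2, h2'⟩, h3⟩ := hγ (1 - s) hs'
  refine ⟨h1, -ζ, ⟨Submodule.neg_mem _ h2, fun v hv => ?_⟩, ?_⟩
  · have := h2' v hv
    simp only [covec_apply] at this ⊢
    have hr : a₀ + e + -e * s = a₀ + e * (1 - s) := by ring
    simp only [hr, map_neg, neg_apply, this]
    ring
  · have hm : Set.MapsTo (fun s : ℝ => 1 - s) (Set.Icc 0 1) (Set.Icc 0 1) := fun x hx =>
      ⟨by linarith [hx.2], by linarith [hx.1]⟩
    have hd : HasDerivWithinAt (fun s : ℝ => 1 - s) (-1) (Set.Icc 0 1) s := by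
      simpa using (hasDerivWithinAt_id s _).const_sub 1
    simpa using! h3.scomp s hd hm

/-- The equation of the Moser field involves only the two forms and the tangent spaces. Applied to
elements of the compact torus, this makes the flow equivariant. -/
theorem IsTraj.map {γ : ℝ → W} (hγ : D.IsTraj a₀ e σ γ) (R : W ≃L[ℝ] W)
    (h₀ : ∀ v w, D.g₀ (R v) (R w) = D.g₀ v w) (h₁ : ∀ v w, D.g₁ (R v) (R w) = D.g₁ v w)
    (hS : ∀ p, R p ∈ D.S σ ↔ p ∈ D.S σ) : D.IsTraj a₀ e σ (fun s => R (γ s)) := by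
  intro s hs
  obtain ⟨h1, ζ, ⟨h2, h2'⟩, h3⟩ := hγ s hs
  refine ⟨(hS _).2 h1, R ζ, ⟨?_, fun v hv => ?_⟩,
    R.hasFDerivAt.comp_hasDerivWithinAt s h3⟩
  · exact (R.hasFDerivAt (x := γ s)).hasFDerivWithinAt.mapsTo_tangentSpaceOf
      (eventually_mem_nhdsWithin.mono fun q hq => (hS q).2 hq) h2
  · have hv' := (R.symm.hasFDerivAt (x := R (γ s))).hasFDerivWithinAt.mapsTo_tangentSpaceOf
      (S' := D.S σ) (eventually_mem_nhdsWithin.mono fun q hq => (hS _).1 (by simpa using hq)) hv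
    have := h2' (R.symm v) (by simpa using hv')
    have hv2 : v = R (R.symm v) := by simp
    rw [hv2]
    simp only [form_apply, covec_apply, h₀, h₁] at this ⊢
    exact this

/-- A compactly supported smooth vector field which agrees with the Moser vector field
near the compact set of points of the stratum with a given moment. -/
structure IsAdapted (D : MoserData W ι r) (a₀ e : ℝ) (σ : ι) (m : Fin r → ℝ) (f : ℝ × W → W)
    (δ : ℝ) : Prop where
  pos : 0 < δ
  contDiff : ContDiff ℝ ∞ f
  hasCompactSupport : HasCompactSupport f
  isMoserAt : ∀ s ∈ Set.Icc (0 : ℝ) 1, ∀ q ∈ D.S σ, ‖D.moment (a₀ + e * s) q - m‖ ≤ δ →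
    D.IsMoserAt a₀ e σ s q (f (s, q))
  isClosed : IsClosed {x : ℝ × W | x.1 ∈ Set.Icc (0 : ℝ) 1 ∧ x.2 ∈ D.S σ ∧
    ‖D.moment (a₀ + e * x.1) x.2 - m‖ ≤ δ}

theorem continuous_moment_path (D : MoserData W ι r) (a₀ e : ℝ) :
    Continuous fun x : ℝ × W => D.moment (a₀ + e * x.1) x.2 := by
  unfold moment
  simp only [form_apply]
  fun_prop

theorem IsTraj.isUnitSolution (ha : ∀ s ∈ Set.Icc (0 : ℝ) 1, a₀ + e * s ∈ Set.Icc (0 : ℝ) 1)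
    {m : Fin r → ℝ} {f : ℝ × W → W} {δ : ℝ} (hf : D.IsAdapted a₀ e σ m f δ) {γ : ℝ → W}
    (hγ : D.IsTraj a₀ e σ γ) (h0 : ‖D.moment a₀ (γ 0) - m‖ ≤ δ) : IsUnitSolution f γ := by
  intro s hs
  obtain ⟨h1, ζ, h2, h3⟩ := hγ s hs
  have := hf.isMoserAt s hs _ h1 (by rwa [hγ.moment_eq hs])
  rwa [h2.unique ha hs h1 this] at h3

variable [FiniteDimensional ℝ W]

theorem isCompact_moment_le (D : MoserData W ι r) {a₀ e : ℝ}
    (ha : ∀ s ∈ Set.Icc (0 : ℝ) 1, a₀ + e * s ∈ Set.Icc (0 : ℝ) 1)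
    {Z : Set W} (hZ : IsClosed Z) (hZS : Z ⊆ ⋃ σ, D.S σ) (m : Fin r → ℝ) (δ : ℝ) :
    IsCompact {x : ℝ × W | x.1 ∈ Set.Icc (0 : ℝ) 1 ∧ x.2 ∈ Z ∧
      ‖D.moment (a₀ + e * x.1) x.2 - m‖ ≤ δ} := by
  obtain ⟨R, hR⟩ := D.bounded (δ + ‖m‖)
  refine ((isCompact_Icc (a := (0 : ℝ)) (b := 1)).prod
    (isCompact_closedBall (0 : W) R)).of_isClosed_subset ?_ ?_
  · exact (isClosed_Icc.preimage continuous_fst).inter ((hZ.preimage continuous_snd).inter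
      (isClosed_le ((D.continuous_moment_path a₀ e).sub continuous_const).norm continuous_const))
  · rintro x ⟨h1, h2, h3⟩
    refine ⟨h1, ?_⟩
    rw [mem_closedBall_zero_iff]
    refine hR _ (ha _ h1) _ (hZS h2) fun k => ?_
    have h4 : ‖D.moment (a₀ + e * x.1) x.2‖ ≤ δ + ‖m‖ := by
      have := norm_add_le (D.moment (a₀ + e * x.1) x.2 - m) m
      rw [sub_add_cancel] at this
      linarith
    exact (norm_le_pi_norm (D.moment (a₀ + e * x.1) x.2) k).trans h4

/-- In the closure of the stratum, the points whose moment is that of `p` lie in the stratum itself,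
because the moment separates strata. By compactness, points with nearby moments also lie in an open
set in which the stratum is relatively closed. The part of the stratum with nearby moments is
therefore compact, and the Moser field on it extends to a compactly supported one. -/
theorem exists_isAdapted (D : MoserData W ι r) {a₀ e : ℝ}
    (ha : ∀ s ∈ Set.Icc (0 : ℝ) 1, a₀ + e * s ∈ Set.Icc (0 : ℝ) 1)
    {σ : ι} {p : W} (hp : p ∈ D.S σ) :
    ∃ f δ, D.IsAdapted a₀ e σ (D.moment a₀ p) f δ := by
  set m := D.moment a₀ p
  have ha0 : a₀ ∈ Set.Icc (0 : ℝ) 1 := by simpa using ha 0 ⟨le_rfl, zero_le_one⟩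
  have hcl : closure (D.S σ) ⊆ ⋃ σ, D.S σ := closure_minimal (D.subset_iUnion σ) D.closed
  obtain ⟨O, Z, hO, hZ, hOZ⟩ := D.locallyClosed σ
  have hclO : ∀ q ∈ closure (D.S σ), q ∈ O → q ∈ D.S σ := by
    intro q hq hqO
    rw [hOZ]
    refine ⟨hqO, closure_minimal ?_ hZ hq⟩
    rw [hOZ]
    exact Set.inter_subset_right
  obtain ⟨δ, hδ, hδO⟩ := (D.isCompact_moment_le ha isClosed_closure hcl m 1).exists_pos_forall_le
    (hO.preimage continuous_snd) (F := fun x => ‖D.moment (a₀ + e * x.1) x.2 - m‖)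
    ((D.continuous_moment_path a₀ e).sub continuous_const).norm.continuousOn (by
      rintro x ⟨h1, h2, -⟩ h4
      by_contra hcon
      have h5 : D.moment (a₀ + e * x.1) x.2 = m := by
        rw [← sub_eq_zero, ← norm_le_zero_iff]
        exact not_lt.1 hcon
      obtain ⟨τ, hτ⟩ := Set.mem_iUnion.1 (hcl h2)
      have : τ = σ := D.stratum_eq hτ hp (ha _ h1) ha0 h5
      subst this
      rw [hOZ] at hτ
      exact h4 hτ.1)
  have hC := D.isCompact_moment_le ha isClosed_closure hcl m (min δ 1)
  have hCe : {x : ℝ × W | x.1 ∈ Set.Icc (0 : ℝ) 1 ∧ x.2 ∈ D.S σ ∧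
      ‖D.moment (a₀ + e * x.1) x.2 - m‖ ≤ min δ 1} =
      {x : ℝ × W | x.1 ∈ Set.Icc (0 : ℝ) 1 ∧ x.2 ∈ closure (D.S σ) ∧
      ‖D.moment (a₀ + e * x.1) x.2 - m‖ ≤ min δ 1} := by
    ext x
    refine ⟨fun h => ⟨h.1, subset_closure h.2.1, h.2.2⟩, fun h => ⟨h.1, ?_, h.2.2⟩⟩
    exact hclO _ h.2.1 (hδO x ⟨h.1, h.2.1, h.2.2.trans (min_le_right _ _)⟩
      (h.2.2.trans (min_le_left _ _)))
  rw [← hCe] at hC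
  obtain ⟨f, hf, hfc, hfg⟩ := exists_global_gradient (D.smooth σ) (D.contDiff_form a₀ e)
    (B := fun x => D.covec e x) (D.covec e).contDiff hC (fun x hx => hx.2.1)
    (fun x hx v hv hv0 => D.form_pos hx.2.1 hv hv0 (ha _ hx.1))
  exact ⟨f, min δ 1, lt_min hδ one_pos, hf, hfc, fun s hs q hq hm => hfg (s, q) ⟨hs, hq, hm⟩,
    hC.isClosed⟩

/-- Continuous induction on the times at which the curve is in the stratum with its initial moment.
This set is closed by `IsAdapted.isClosed`. From such a time on, the strict bound `h0` keeps `f`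
equal to the Moser field for a while; tangency keeps the curve in the stratum, and then the moment
is conserved. -/
theorem IsAdapted.isTraj {m : Fin r → ℝ} {f : ℝ × W → W} {δ : ℝ} (hf : D.IsAdapted a₀ e σ m f δ)
    {γ : ℝ → W} (hγ : IsUnitSolution f γ) (hp : γ 0 ∈ D.S σ)
    (h0 : ‖D.moment a₀ (γ 0) - m‖ < δ) : D.IsTraj a₀ e σ γ := by
  set m' := D.moment a₀ (γ 0)
  let A : Set ℝ := {s | s ∈ Set.Icc (0 : ℝ) 1 ∧ γ s ∈ D.S σ ∧ D.moment (a₀ + e * s) (γ s) = m'}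
  have hgc : ContinuousOn (fun s => (s, γ s)) (Set.Icc 0 1) :=
    continuousOn_id.prodMk hγ.continuousOn
  have hA : IsClosed (A ∩ Set.Icc 0 1) := by
    have hcl : IsClosed ({x : ℝ × W | x.1 ∈ Set.Icc (0 : ℝ) 1 ∧ x.2 ∈ D.S σ ∧
        ‖D.moment (a₀ + e * x.1) x.2 - m‖ ≤ δ} ∩
        {x : ℝ × W | D.moment (a₀ + e * x.1) x.2 = m'}) :=
      hf.isClosed.inter (isClosed_eq (D.continuous_moment_path a₀ e) continuous_const)
    have := hgc.preimage_isClosed_of_isClosed isClosed_Icc hcl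
    convert! this using 1
    ext s
    constructor
    · rintro ⟨⟨h1, h2, h3⟩, -⟩
      exact ⟨h1, ⟨h1, h2, by change ‖D.moment (a₀ + e * s) (γ s) - m‖ ≤ δ; rw [h3]; exact h0.le⟩,
        h3⟩
    · rintro ⟨h1, ⟨-, h2, -⟩, h3⟩
      exact ⟨⟨h1, h2, h3⟩, h1⟩
  have hsub : Set.Icc (0 : ℝ) 1 ⊆ A := by
    refine hA.Icc_subset_of_forall_mem_nhdsWithin ⟨⟨le_rfl, zero_le_one⟩, hp, by simp [m']⟩ ?_
    rintro s ⟨⟨hs01, hsS, hsm⟩, hs⟩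
    have hder : ∀ t ∈ Set.Icc s 1, HasDerivWithinAt γ (f (t, γ t)) (Set.Icc s 1) t := fun t ht =>
      (hγ t ⟨hs.1.trans ht.1, ht.2⟩).mono (Set.Icc_subset_Icc_left hs.1)
    have htan : ∀ᶠ x in 𝓝 (s, γ s), ‖D.moment (a₀ + e * x.1) x.2 - m‖ < δ := by
      have hc : Continuous fun x : ℝ × W => ‖D.moment (a₀ + e * x.1) x.2 - m‖ :=
        ((D.continuous_moment_path a₀ e).sub continuous_const).norm
      exact hc.continuousAt.eventually (gt_mem_nhds (by simpa [hsm] using h0))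
    have hev := eventually_mem_of_tangent (D.smooth σ) (hf.contDiff.of_le (by simp)) hs.2 hsS
      (fun t ht => (hder t ht).continuousWithinAt)
      (fun t ht => (hder t (Set.Ico_subset_Icc_self ht)).Ici_of_Icc ht) (by
        filter_upwards [htan] with x hx h1 h2
        exact (hf.isMoserAt x.1 ⟨hs.1.trans h1.1, h1.2.le⟩ x.2 h2 hx.le).1)
    have hcon : Tendsto (fun t => (t, γ t)) (𝓝[>] s) (𝓝 (s, γ s)) := by
      have h1 := (hder s ⟨le_rfl, hs.2.le⟩).continuousWithinAt.tendsto
      rw [nhdsWithin_Icc_eq_nhdsGE hs.2] at h1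
      exact ((tendsto_id.mono_left nhdsWithin_le_nhds).prodMk_nhds
        (h1.mono_left (nhdsWithin_mono _ Set.Ioi_subset_Ici_self)))
    obtain ⟨u, hu, huS⟩ := (mem_nhdsGT_iff_exists_Ioc_subset).1
      (hev.and ((hcon.eventually htan).and (Ioc_mem_nhdsGT hs.2)))
    filter_upwards [Ioc_mem_nhdsGT hu] with t ht
    have hall : ∀ x ∈ Set.Icc s t, γ x ∈ D.S σ ∧ ‖D.moment (a₀ + e * x) (γ x) - m‖ ≤ δ ∧ x ≤ 1 := by
      intro x hx
      rcases hx.1.eq_or_lt with rfl | hlt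
      · exact ⟨hsS, by rw [hsm]; exact h0.le, hs.2.le⟩
      · have := huS ⟨hlt, hx.2.trans ht.2⟩
        exact ⟨this.1, this.2.1.le, this.2.2.2⟩
    have ht' : t ∈ Set.Icc s t := ⟨ht.1.le, le_rfl⟩
    refine ⟨⟨hs.1.trans ht.1.le, (hall t ht').2.2⟩, (hall t ht').1, ?_⟩
    rw [← hsm]
    refine moment_eq_of_hasDerivWithinAt (σ := σ) (b := s) (c := t) (fun x hx => ?_) ht'
    obtain ⟨h1, h2, h3⟩ := hall x hx
    exact ⟨h1, _, hf.isMoserAt x ⟨hs.1.trans hx.1, h3⟩ _ h1 h2,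
      (hder x ⟨hx.1, h3⟩).mono (Set.Icc_subset_Icc_right (hall t ht').2.2)⟩
  intro s hs
  obtain ⟨-, h1, h2⟩ := hsub hs
  exact ⟨h1, _, hf.isMoserAt s hs _ h1 (by rw [h2]; exact h0.le), hγ s hs⟩

theorem IsTraj.eqOn (ha : ∀ s ∈ Set.Icc (0 : ℝ) 1, a₀ + e * s ∈ Set.Icc (0 : ℝ) 1)
    {τ : ι} {γ η : ℝ → W} (hγ : D.IsTraj a₀ e σ γ) (hη : D.IsTraj a₀ e τ η) (h0 : γ 0 = η 0) :
    Set.EqOn γ η (Set.Icc 0 1) := by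
  have h0' : (0 : ℝ) ∈ Set.Icc (0 : ℝ) 1 := ⟨le_rfl, zero_le_one⟩
  have ha0 : a₀ ∈ Set.Icc (0 : ℝ) 1 := by simpa using ha 0 h0'
  have hst : σ = τ := D.stratum_eq (hγ 0 h0').1 (hη 0 h0').1 ha0 ha0 (by rw [h0])
  subst hst
  obtain ⟨f, δ, hf⟩ := D.exists_isAdapted ha (hγ 0 h0').1
  refine (hγ.isUnitSolution ha hf ?_).eqOn hf.contDiff hf.hasCompactSupport
    (hη.isUnitSolution ha hf ?_) h0
  · simpa using hf.pos.le
  · simpa [h0] using hf.pos.le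

theorem exists_isTraj (D : MoserData W ι r)
    (ha : ∀ s ∈ Set.Icc (0 : ℝ) 1, a₀ + e * s ∈ Set.Icc (0 : ℝ) 1)
    {p : W} (hp : p ∈ D.S σ) : ∃ γ, γ 0 = p ∧ D.IsTraj a₀ e σ γ := by
  obtain ⟨f, δ, hf⟩ := D.exists_isAdapted ha hp
  obtain ⟨γ, rfl, hγ⟩ := exists_isUnitSolution hf.contDiff hf.hasCompactSupport p
  exact ⟨γ, rfl, hf.isTraj hγ hp (by simpa using hf.pos)⟩

end MoserData

/-! ### The time-one map -/

namespace MoserData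

variable {W : Type*} [NormedAddCommGroup W] [NormedSpace ℝ W]
  {ι : Type*} {r : ℕ} {D : MoserData W ι r} {a₀ e : ℝ} {σ : ι}

open Classical in
/-- The time-one map of the Moser vector field. -/
def flow (D : MoserData W ι r) (a₀ e : ℝ) (p : W) : W :=
  if h : ∃ γ : ℝ → W, γ 0 = p ∧ ∃ σ, D.IsTraj a₀ e σ γ then h.choose 1 else p

theorem IsTraj.flow_eq [FiniteDimensional ℝ W]
    (ha : ∀ s ∈ Set.Icc (0 : ℝ) 1, a₀ + e * s ∈ Set.Icc (0 : ℝ) 1)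
    {γ : ℝ → W} (hγ : D.IsTraj a₀ e σ γ) : D.flow a₀ e (γ 0) = γ 1 := by
  have h : ∃ η : ℝ → W, η 0 = γ 0 ∧ ∃ σ, D.IsTraj a₀ e σ η := ⟨γ, rfl, σ, hγ⟩
  rw [flow, dif_pos h]
  obtain ⟨h1, τ, h2⟩ := h.choose_spec
  exact h2.eqOn ha hγ h1 ⟨zero_le_one, le_rfl⟩

theorem flow_mem [FiniteDimensional ℝ W]
    (ha : ∀ s ∈ Set.Icc (0 : ℝ) 1, a₀ + e * s ∈ Set.Icc (0 : ℝ) 1)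
    {p : W} (hp : p ∈ D.S σ) : D.flow a₀ e p ∈ D.S σ := by
  obtain ⟨γ, rfl, hγ⟩ := D.exists_isTraj ha hp
  rw [hγ.flow_eq ha]
  exact (hγ 1 ⟨zero_le_one, le_rfl⟩).1

theorem moment_flow [FiniteDimensional ℝ W]
    (ha : ∀ s ∈ Set.Icc (0 : ℝ) 1, a₀ + e * s ∈ Set.Icc (0 : ℝ) 1)
    {p : W} (hp : p ∈ D.S σ) : D.moment (a₀ + e) (D.flow a₀ e p) = D.moment a₀ p := by
  obtain ⟨γ, rfl, hγ⟩ := D.exists_isTraj ha hp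
  rw [hγ.flow_eq ha]
  simpa using hγ.moment_eq (s := 1) ⟨zero_le_one, le_rfl⟩

theorem flow_reverse [FiniteDimensional ℝ W]
    (ha : ∀ s ∈ Set.Icc (0 : ℝ) 1, a₀ + e * s ∈ Set.Icc (0 : ℝ) 1)
    (hb : ∀ s ∈ Set.Icc (0 : ℝ) 1, a₀ + e + -e * s ∈ Set.Icc (0 : ℝ) 1)
    {p : W} (hp : p ∈ D.S σ) : D.flow (a₀ + e) (-e) (D.flow a₀ e p) = p := by
  obtain ⟨γ, rfl, hγ⟩ := D.exists_isTraj ha hp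
  rw [hγ.flow_eq ha]
  simpa using hγ.reverse.flow_eq hb

theorem flow_map [FiniteDimensional ℝ W]
    (ha : ∀ s ∈ Set.Icc (0 : ℝ) 1, a₀ + e * s ∈ Set.Icc (0 : ℝ) 1)
    (R : W ≃L[ℝ] W)
    (h₀ : ∀ v w, D.g₀ (R v) (R w) = D.g₀ v w) (h₁ : ∀ v w, D.g₁ (R v) (R w) = D.g₁ v w)
    (hS : ∀ p, R p ∈ D.S σ ↔ p ∈ D.S σ) {p : W} (hp : p ∈ D.S σ) :
    D.flow a₀ e (R p) = R (D.flow a₀ e p) := by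
  obtain ⟨γ, rfl, hγ⟩ := D.exists_isTraj ha hp
  rw [hγ.flow_eq ha]
  exact (hγ.map R h₀ h₁ hS).flow_eq ha

/-! #### Smoothness along the strata -/

/-- The solutions of an adapted field depend smoothly on an ambient initial point, and those that
start on the stratum near `p` are Moser trajectories. The flow on the stratum is thus locally the
restriction of a map smooth at `p` in `W`. -/
theorem exists_smooth_trajectories [FiniteDimensional ℝ W] (D : MoserData W ι r)
    (ha : ∀ s ∈ Set.Icc (0 : ℝ) 1, a₀ + e * s ∈ Set.Icc (0 : ℝ) 1)
    {p : W} (hp : p ∈ D.S σ) :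
    ∃ (f : ℝ × W → W) (Ψ : W → C(unitInterval, W)), ContDiff ℝ ∞ f ∧ ContDiffAt ℝ ∞ Ψ p ∧
      (∀ᶠ x in 𝓝 p, extendUnit (Ψ x) 0 = x ∧ IsUnitSolution f (extendUnit (Ψ x))) ∧
      ∀ᶠ x in 𝓝[D.S σ] p, D.IsTraj a₀ e σ (extendUnit (Ψ x)) := by
  obtain ⟨f, δ, hf⟩ := D.exists_isAdapted ha hp
  obtain ⟨γ, h0, hγ⟩ := exists_isUnitSolution hf.contDiff hf.hasCompactSupport p
  let γ₀ : C(unitInterval, W) := ⟨fun s => γ s, hγ.continuousOn.comp_continuous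
    continuous_subtype_val fun s => s.2⟩
  have he : Set.EqOn (extendUnit γ₀) γ (Set.Icc 0 1) := fun s hs => extendUnit_of_mem γ₀ hs
  have hz : (0 : ℝ) ∈ Set.Icc (0 : ℝ) 1 := ⟨le_rfl, zero_le_one⟩
  obtain ⟨Ψ, hΨ, -, hΨs⟩ := exists_contDiffAt_solution hf.contDiff γ₀ p
    (by rw [he hz, h0]) (fun s hs => by
      rw [he hs]
      exact (hγ s hs).congr he (he hs))
  refine ⟨f, Ψ, hf.contDiff, hΨ, hΨs, ?_⟩
  have hc : Continuous fun x : W => ‖D.moment a₀ x - D.moment a₀ p‖ := by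
    have := (D.continuous_moment_path a₀ 0).comp (Continuous.prodMk_right (0 : ℝ))
    have h2 : Continuous fun x => D.moment a₀ x := by simpa [Function.comp_def] using this
    exact (h2.sub continuous_const).norm
  filter_upwards [mem_nhdsWithin_of_mem_nhds hΨs, self_mem_nhdsWithin,
    mem_nhdsWithin_of_mem_nhds (hc.continuousAt.eventually
      (gt_mem_nhds (by simpa using hf.pos)))] with x hx hxS hxm
  refine hf.isTraj hx.2 ?_ ?_
  · rwa [hx.1]
  · rwa [hx.1]

theorem contDiffOn_flow [FiniteDimensional ℝ W] (D : MoserData W ι r)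
    (ha : ∀ s ∈ Set.Icc (0 : ℝ) 1, a₀ + e * s ∈ Set.Icc (0 : ℝ) 1) (σ : ι) :
    ContDiffOn ℝ ∞ (D.flow a₀ e) (D.S σ) := by
  intro p hp
  obtain ⟨f, Ψ, hf, hΨ, h1, h2⟩ := D.exists_smooth_trajectories ha hp
  have hev : D.flow a₀ e =ᶠ[𝓝[D.S σ] p] fun x => Ψ x 1 := by
    filter_upwards [mem_nhdsWithin_of_mem_nhds h1, h2] with x hx hxt
    have := hxt.flow_eq ha
    rw [hx.1] at this
    rw [this]
    exact extendUnit_coe (Ψ x) 1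
  refine ContDiffWithinAt.congr_of_eventuallyEq ?_ hev (hev.self_of_nhdsWithin hp)
  exact ((ContinuousMap.evalCLM ℝ (1 : unitInterval)).contDiff.contDiffAt.comp p
    hΨ).contDiffWithinAt

theorem IsTraj.isMoserAt_of_isUnitSolution {γ : ℝ → W} (hγ : D.IsTraj a₀ e σ γ) {f : ℝ × W → W}
    (hf : IsUnitSolution f γ) {s : ℝ} (hs : s ∈ Set.Icc (0 : ℝ) 1) :
    D.IsMoserAt a₀ e σ s (γ s) (f (s, γ s)) := by
  obtain ⟨-, ζ, h2, h3⟩ := hγ s hs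
  have := (uniqueDiffOn_Icc zero_lt_one s hs).eq_deriv _ h3 (hf s hs)
  rwa [this] at h2

theorem exists_hasFDerivAt_bilinear {V₁ V₂ V₃ Y : Type*} [NormedAddCommGroup V₁] [NormedSpace ℝ V₁]
    [NormedAddCommGroup V₂] [NormedSpace ℝ V₂] [NormedAddCommGroup V₃] [NormedSpace ℝ V₃]
    [NormedAddCommGroup Y] [NormedSpace ℝ Y] (B : V₁ →L[ℝ] V₂ →L[ℝ] V₃) {P : Y → V₁} {Q : Y → V₂}
    {P' : Y →L[ℝ] V₁} {Q' : Y →L[ℝ] V₂} {y : Y} (hP : HasFDerivAt P P' y)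
    (hQ : HasFDerivAt Q Q' y) :
    ∃ A : Y →L[ℝ] V₃, HasFDerivAt (fun y => B (P y) (Q y)) A y ∧
      ∀ l, A l = B (P' l) (Q y) + B (P y) (Q' l) :=
  ⟨_, B.hasFDerivAt_of_bilinear hP hQ, fun l => by
    simp [ContinuousLinearMap.precompR, ContinuousLinearMap.precompL, add_comm]⟩

/-- The infinitesimal form of Moser's identity, for a family of points in a stratum which depends
smoothly on a parameter. -/
theorem moser_identity {Y : Type*} [NormedAddCommGroup Y] [NormedSpace ℝ Y] {F : Y → W} {y₀ : Y}
    {f : ℝ × W → W} {s : ℝ} (hf : ContDiff ℝ ∞ f) (hF : ContDiffAt ℝ ∞ F y₀)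
    (hS : ∀ᶠ y in 𝓝 y₀, F y ∈ D.S σ ∧ D.IsMoserAt a₀ e σ s (F y) (f (s, F y))) (l l' : Y) :
    e * (D.g₁ (fderiv ℝ F y₀ l) (D.J (fderiv ℝ F y₀ l'))
        - D.g₀ (fderiv ℝ F y₀ l) (D.J (fderiv ℝ F y₀ l')))
      + D.form (a₀ + e * s) (fderiv ℝ f (s, F y₀) (0, fderiv ℝ F y₀ l))
        (D.J (fderiv ℝ F y₀ l'))
      + D.form (a₀ + e * s) (fderiv ℝ F y₀ l)
        (D.J (fderiv ℝ f (s, F y₀) (0, fderiv ℝ F y₀ l'))) = 0 := by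
  have hF1 : HasFDerivAt F (fderiv ℝ F y₀) y₀ := (hF.differentiableAt (by simp)).hasFDerivAt
  have hF2 : HasFDerivAt (fderiv ℝ F) (fderiv ℝ (fderiv ℝ F) y₀) y₀ :=
    ((hF.fderiv_right (m := 1) (WithTop.coe_le_coe.2 le_top)).differentiableAt
      one_ne_zero).hasFDerivAt
  have hsymm : IsSymmSndFDerivAt ℝ F y₀ := hF.isSymmSndFDerivAt (by
    simp only [minSmoothness_of_isRCLikeNormedField]; exact WithTop.coe_le_coe.2 le_top)
  have hdiff : ∀ᶠ y in 𝓝 y₀, DifferentiableAt ℝ F y := by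
    have : ContDiffAt ℝ 1 F y₀ := hF.of_le (by simp)
    exact (this.eventually (by simp)).mono fun y hy => hy.differentiableAt one_ne_zero
  have hfF : HasFDerivAt (fun y => f (s, F y))
      (fderiv ℝ f (s, F y₀) ∘L (ContinuousLinearMap.inr ℝ ℝ W ∘L fderiv ℝ F y₀)) y₀ := by
    have h1 : HasFDerivAt (fun y => (s, F y)) (ContinuousLinearMap.inr ℝ ℝ W ∘L fderiv ℝ F y₀) y₀ :=
      (hasFDerivAt_prodMk_right s (F y₀)).comp y₀ hF1
    exact ((hf.differentiable (by simp)) (s, F y₀)).hasFDerivAt.comp y₀ h1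
  -- The equation of the Moser field, tested on the tangent vector `J (dF l')`, is differentiated in
  -- the direction `l`. Second derivatives of `F` are symmetric, so they cancel on antisymmetrizing
  -- in `l` and `l'`; this is the exterior derivative computed by hand.
  have key : ∀ l l', D.form (a₀ + e * s) (fderiv ℝ f (s, F y₀) (0, fderiv ℝ F y₀ l))
        (D.J (fderiv ℝ F y₀ l'))
      + D.form (a₀ + e * s) (f (s, F y₀)) (D.J (fderiv ℝ (fderiv ℝ F) y₀ l l'))
      = D.covec e (fderiv ℝ F y₀ l) (D.J (fderiv ℝ F y₀ l'))
      + D.covec e (F y₀) (D.J (fderiv ℝ (fderiv ℝ F) y₀ l l')) := by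
    intro l l'
    have hJ : HasFDerivAt (fun y => D.J (fderiv ℝ F y l'))
        (D.J ∘L (fderiv ℝ (fderiv ℝ F) y₀).flip l') y₀ := by
      have h1 : HasFDerivAt (fun y => fderiv ℝ F y l') ((fderiv ℝ (fderiv ℝ F) y₀).flip l') y₀ := by
        simpa using hF2.clm_apply (hasFDerivAt_const l' y₀)
      exact D.J.hasFDerivAt.comp y₀ h1
    obtain ⟨A, hL, hA⟩ := exists_hasFDerivAt_bilinear (D.form (a₀ + e * s)) hfF hJ
    obtain ⟨B, hR, hB⟩ := exists_hasFDerivAt_bilinear (D.covec e) hF1 hJ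
    have heq : (fun y => D.form (a₀ + e * s) (f (s, F y)) (D.J (fderiv ℝ F y l'))) =ᶠ[𝓝 y₀]
        fun y => D.covec e (F y) (D.J (fderiv ℝ F y l')) := by
      filter_upwards [hS.eventually_nhds, hdiff] with y hy hyd
      refine hy.self_of_nhds.2.2 _ (D.J_mem σ _ hy.self_of_nhds.1 _ ?_)
      refine hyd.hasFDerivAt.hasFDerivWithinAt.mapsTo_tangentSpaceOf (S := Set.univ) ?_ ?_
      · rw [nhdsWithin_univ]
        exact hy.mono fun z hz => hz.1
      · exact Submodule.subset_span (by rw [tangentConeAt_univ]; trivial)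
    have := congrArg (fun A => A l) (hL.unique (hR.congr_of_eventuallyEq heq))
    simp only [hA, hB] at this
    exact this
  have h1 := key l l'
  have h2 := key l' l
  rw [hsymm l' l] at h2
  have h3 : D.form (a₀ + e * s) (fderiv ℝ F y₀ l)
        (D.J (fderiv ℝ f (s, F y₀) (0, fderiv ℝ F y₀ l'))) =
      -D.form (a₀ + e * s) (fderiv ℝ f (s, F y₀) (0, fderiv ℝ F y₀ l'))
        (D.J (fderiv ℝ F y₀ l)) := by
    rw [D.form_symm, D.form_J]
  have h4 : D.g₀ (fderiv ℝ F y₀ l') (D.J (fderiv ℝ F y₀ l)) =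
      -D.g₀ (fderiv ℝ F y₀ l) (D.J (fderiv ℝ F y₀ l')) := by
    rw [D.symm₀, D.J₀]
  have h5 : D.g₁ (fderiv ℝ F y₀ l') (D.J (fderiv ℝ F y₀ l)) =
      -D.g₁ (fderiv ℝ F y₀ l) (D.J (fderiv ℝ F y₀ l')) := by
    rw [D.symm₁, D.J₁]
  simp only [covec_apply, h4, h5] at h1 h2
  linear_combination h1 - h2 + h3

/-- A chart parametrizes the stratum by a linear space `L`, and differentiating the trajectories in
the parameter gives solutions `X l` of the variational equation. By `moser_identity`, the value of
the interpolated symplectic form on `X l` and `X l'` is constant in time; its values at `0` and `1`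
are compared. -/
theorem exists_fderiv_flow [FiniteDimensional ℝ W] (D : MoserData W ι r)
    (ha : ∀ s ∈ Set.Icc (0 : ℝ) 1, a₀ + e * s ∈ Set.Icc (0 : ℝ) 1) {p : W} (hp : p ∈ D.S σ) :
    ∃ A : W →L[ℝ] W, HasFDerivWithinAt (D.flow a₀ e) A (D.S σ) p ∧
      ∀ v ∈ tangentSpaceOf (D.S σ) p, ∀ w ∈ tangentSpaceOf (D.S σ) p,
        D.form (a₀ + e) (A v) (D.J (A w)) = D.form a₀ v (D.J w) := by
  obtain ⟨f, Ψ, hf, hΨ, hΨs, hΨt⟩ := D.exists_smooth_trajectories ha hp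
  let ev : unitInterval → C(unitInterval, W) →L[ℝ] W := fun s => ContinuousMap.evalCLM ℝ s
  have hΨd : HasFDerivAt Ψ (fderiv ℝ Ψ p) p := (hΨ.differentiableAt (by simp)).hasFDerivAt
  refine ⟨ev 1 ∘L fderiv ℝ Ψ p, ?_, ?_⟩
  · have hev : D.flow a₀ e =ᶠ[𝓝[D.S σ] p] fun x => Ψ x 1 := by
      filter_upwards [mem_nhdsWithin_of_mem_nhds hΨs, hΨt] with x hx hxt
      have := hxt.flow_eq ha
      rw [hx.1] at this
      rw [this]
      exact extendUnit_coe (Ψ x) 1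
    have h1 : HasFDerivAt (fun x => Ψ x 1) (ev 1 ∘L fderiv ℝ Ψ p) p :=
      (ev 1).hasFDerivAt.comp p hΨd
    exact h1.hasFDerivWithinAt.congr_of_eventuallyEq hev (hev.self_of_nhdsWithin hp)
  obtain ⟨Φ, L, hps, h⟩ := (D.smooth σ).exists_isStraightening hp
  have hpt := Φ.map_source hps
  let y₀ : L := ⟨Φ p, (h.mem_iff hps).1 hp⟩
  let u : L → W := fun y => Φ.symm y
  have hu0 : u y₀ = p := Φ.left_inv hps
  have hu : ContDiffAt ℝ ∞ u y₀ :=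
    (h.contDiffAt_symm (z := (y₀ : W)) hpt).comp y₀ L.subtypeL.contDiff.contDiffAt
  have hud : HasFDerivAt u (fderiv ℝ u y₀) y₀ := (hu.differentiableAt (by simp)).hasFDerivAt
  have hud' : HasFDerivAt u (fderiv ℝ Φ.symm (Φ p) ∘L L.subtypeL) y₀ :=
    (h.hasFDerivAt_symm (z := (y₀ : W)) hpt).comp y₀ L.subtypeL.hasFDerivAt
  have huS : ∀ᶠ y in 𝓝 y₀, u y ∈ D.S σ := by
    have h1 : Tendsto (fun y : L => (y : W)) (𝓝 y₀) (𝓝 (Φ p)) :=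
      continuous_subtype_val.tendsto y₀
    have : ∀ᶠ y : L in 𝓝 y₀, (y : W) ∈ Φ.target := h1.eventually (Φ.open_target.mem_nhds hpt)
    exact this.mono fun y hy => (h.symm_mem_iff hy).2 y.2
  have huc : Tendsto u (𝓝 y₀) (𝓝[D.S σ] p) := by
    refine tendsto_nhdsWithin_iff.2 ⟨?_, huS⟩
    have := hu.continuousAt.tendsto
    rwa [hu0] at this
  let c : L → C(unitInterval, W) := fun y => Ψ (u y)
  have hΨ' : ContDiffAt ℝ ∞ Ψ (u y₀) := by rwa [hu0]
  have hc : ContDiffAt ℝ ∞ c y₀ := hΨ'.comp y₀ hu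
  have hct : ∀ᶠ y in 𝓝 y₀, D.IsTraj a₀ e σ (extendUnit (c y)) := huc.eventually hΨt
  have hcs : ∀ᶠ y in 𝓝 y₀, extendUnit (c y) 0 = u y ∧ IsUnitSolution f (extendUnit (c y)) :=
    (huc.mono_right nhdsWithin_le_nhds).eventually hΨs
  have hvar := hasDerivWithinAt_fderiv_solution hf (hc.differentiableAt (by simp))
    hud.differentiableAt hcs
  set X : L → ℝ → W := fun l => extendUnit (fderiv ℝ c y₀ l)
  have hconst : ∀ l l', D.form (a₀ + e) (X l 1) (D.J (X l' 1)) =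
      D.form a₀ (X l 0) (D.J (X l' 0)) := by
    intro l l'
    have hder : ∀ s ∈ Set.Icc (0 : ℝ) 1, HasDerivWithinAt
        (fun s => D.form (a₀ + e * s) (X l s) (D.J (X l' s))) 0 (Set.Icc 0 1) s := by
      intro s hs
      have hFs : ContDiffAt ℝ ∞ (fun y => ev ⟨s, hs⟩ (c y)) y₀ :=
        (ev ⟨s, hs⟩).contDiff.contDiffAt.comp y₀ hc
      have hFd : ∀ l, fderiv ℝ (fun y => ev ⟨s, hs⟩ (c y)) y₀ l = X l s := by
        intro l
        have : HasFDerivAt (fun y => ev ⟨s, hs⟩ (c y)) (ev ⟨s, hs⟩ ∘L fderiv ℝ c y₀) y₀ :=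
          (ev ⟨s, hs⟩).hasFDerivAt.comp y₀ (hc.differentiableAt (by simp)).hasFDerivAt
        rw [this.fderiv]
        exact (extendUnit_of_mem _ hs).symm
      have hF0 : ev ⟨s, hs⟩ (c y₀) = extendUnit (c y₀) s := (extendUnit_of_mem _ hs).symm
      have key := moser_identity (D := D) (σ := σ) (a₀ := a₀) (e := e) (s := s) hf hFs (by
        filter_upwards [hct, hcs] with y hy hys
        have hyF : ev ⟨s, hs⟩ (c y) = extendUnit (c y) s := (extendUnit_of_mem _ hs).symm
        rw [hyF]
        exact ⟨(hy s hs).1, hy.isMoserAt_of_isUnitSolution hys.2 hs⟩) l l'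
      simp only [hFd, hF0] at key
      have hXl : HasDerivWithinAt (X l)
          (fderiv ℝ f (s, extendUnit (c y₀) s) (0, X l s)) (Set.Icc 0 1) s := (hvar l).2 s hs
      have hXl' : HasDerivWithinAt (X l')
          (fderiv ℝ f (s, extendUnit (c y₀) s) (0, X l' s)) (Set.Icc 0 1) s := (hvar l').2 s hs
      have hJX : HasDerivWithinAt (fun s => D.J (X l' s)) _ (Set.Icc 0 1) s :=
        D.J.hasFDerivAt.comp_hasDerivWithinAt s hXl'
      have hea : HasDerivWithinAt (fun s : ℝ => a₀ + e * s) e (Set.Icc 0 1) s := by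
        simpa using ((hasDerivWithinAt_id s (Set.Icc 0 1)).const_mul e).const_add a₀
      have h0 : HasDerivWithinAt (fun s => D.g₀ (X l s) (D.J (X l' s))) _ (Set.Icc 0 1) s :=
        (D.g₀.hasFDerivAt.comp_hasDerivWithinAt s hXl).clm_apply hJX
      have h1 : HasDerivWithinAt (fun s => D.g₁ (X l s) (D.J (X l' s))) _ (Set.Icc 0 1) s :=
        (D.g₁.hasFDerivAt.comp_hasDerivWithinAt s hXl).clm_apply hJX
      refine (((hea.const_sub 1).mul h0).add (hea.mul h1)).congr_deriv ?_
      simp only [form_apply] at key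
      simp only [Function.comp_apply]
      linear_combination key
    have key := (convex_Icc (0 : ℝ) 1).norm_image_sub_le_of_norm_hasDerivWithin_le (C := 0)
      hder (by simp) (x := 0) (y := 1) ⟨le_rfl, zero_le_one⟩ ⟨zero_le_one, le_rfl⟩
    rw [zero_mul, norm_le_zero_iff, sub_eq_zero] at key
    simpa using key
  have hX0 : ∀ v ∈ tangentSpaceOf (D.S σ) p, ∃ l, X l 0 = v ∧ X l 1 = ev 1 (fderiv ℝ Ψ p v) := by
    intro v hv
    let l : L := ⟨fderiv ℝ Φ p v, (h.mem_tangentSpaceOf_iff hps hp v).1 hv⟩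
    have hl : fderiv ℝ u y₀ l = v := by
      rw [hud'.fderiv]
      exact h.fderiv_symm_fderiv hps v
    refine ⟨l, (hvar l).1.trans hl, ?_⟩
    have hΨd' : HasFDerivAt Ψ (fderiv ℝ Ψ p) (u y₀) := by rwa [hu0]
    have hcd : fderiv ℝ c y₀ l = fderiv ℝ Ψ p v := by
      have h9 : HasFDerivAt c (fderiv ℝ Ψ p ∘L fderiv ℝ u y₀) y₀ := hΨd'.comp y₀ hud
      rw [h9.fderiv, ContinuousLinearMap.comp_apply, hl]
    change extendUnit (fderiv ℝ c y₀ l) 1 = _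
    rw [hcd]
    exact extendUnit_coe _ 1
  intro v hv w hw
  obtain ⟨l, h0, h1⟩ := hX0 v hv
  obtain ⟨l', h0', h1'⟩ := hX0 w hw
  have := hconst l l'
  rwa [h0, h1, h0', h1'] at this

/-! #### Continuity -/

theorem π_tangent {p v : W} (hp : p ∈ D.S σ) (hv : v ∈ tangentSpaceOf (D.S σ) p) :
    D.π σ v = v := by
  have h1 : HasFDerivWithinAt (D.π σ) (D.π σ) (D.S σ) p := (D.π σ).hasFDerivAt.hasFDerivWithinAt
  have h2 : HasFDerivWithinAt (D.π σ) (ContinuousLinearMap.id ℝ W) (D.S σ) p :=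
    (hasFDerivWithinAt_id p _).congr (fun q hq => D.π_self σ q hq) (D.π_self σ p hp)
  exact h1.eq_on_tangentSpaceOf h2 hv

theorem norm_form_apply_le (D : MoserData W ι r) {a : ℝ} (ha : a ∈ Set.Icc (0 : ℝ) 1) (v w : W) :
    |D.form a v w| ≤ (‖D.g₀‖ + ‖D.g₁‖) * ‖v‖ * ‖w‖ := by
  have h0 := D.g₀.le_opNorm₂ v w
  have h1 := D.g₁.le_opNorm₂ v w
  rw [Real.norm_eq_abs] at h0 h1
  rw [form_apply]
  calc |(1 - a) * D.g₀ v w + a * D.g₁ v w| ≤ |1 - a| * |D.g₀ v w| + |a| * |D.g₁ v w| := by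
        rw [← abs_mul, ← abs_mul]; exact abs_add_le _ _
    _ ≤ 1 * |D.g₀ v w| + 1 * |D.g₁ v w| := by
        gcongr
        · rw [abs_le]; constructor <;> linarith [ha.1, ha.2]
        · rw [abs_le]; constructor <;> linarith [ha.1, ha.2]
    _ ≤ _ := by linarith

/-- The Moser vector `ζ` at `x` in `S τ` is compared with the one at `y = π σ x` in `S σ`. Whitney's
condition supplies `u` tangent to `S τ` and close to the latter. The difference `v = ζ - u` is
tangent to `S τ`, so coercivity controls it by `g_a(v, v)`, which the two defining equations make
small. -/
theorem eventually_moser_close [FiniteDimensional ℝ W] [Finite ι]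
    {m : Fin r → ℝ} {f : ℝ × W → W} {δ : ℝ}
    (ha : ∀ s ∈ Set.Icc (0 : ℝ) 1, a₀ + e * s ∈ Set.Icc (0 : ℝ) 1)
    (hf : D.IsAdapted a₀ e σ m f δ) {s₀ : ℝ} (hs₀ : s₀ ∈ Set.Icc (0 : ℝ) 1) {x₀ : W}
    (hx₀ : x₀ ∈ D.S σ) (hm : D.moment (a₀ + e * s₀) x₀ = m) {ε : ℝ} (hε : 0 < ε) :
    ∀ᶠ x in 𝓝 (s₀, x₀), x.1 ∈ Set.Icc (0 : ℝ) 1 → ∀ τ, x.2 ∈ D.S τ →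
      ‖x.2 - D.π σ x.2‖ < ε ∧ ∀ ζ, D.IsMoserAt a₀ e τ x.1 x.2 ζ →
        ‖D.π σ ζ - f (x.1, D.π σ x.2)‖ < ε := by
  obtain ⟨c, hc, hcoer⟩ := D.coercive x₀ (D.subset_iUnion σ hx₀)
  set M := ‖D.g₀‖ + ‖D.g₁‖ with hM
  set B := ‖D.covec e‖
  set P := ‖D.π σ‖
  have hM0 : 0 ≤ M := by positivity
  have hB0 : 0 ≤ B := norm_nonneg (D.covec e)
  have hP0 : 0 ≤ P := norm_nonneg (D.π σ)
  -- `κ` bounds the errors in `x - y`, `f (x.1, y) - η` and `u - η`; the expression in it is the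
  -- final estimate.
  obtain ⟨κ, hκ, hκ1, hκ2⟩ : ∃ κ > 0, κ ≤ ε ∧ P * (κ * ((B + 2 * M) / c) + 2 * κ) < ε := by
    have hcont : Tendsto (fun κ : ℝ => P * (κ * ((B + 2 * M) / c) + 2 * κ)) (𝓝[>] 0) (𝓝 0) := by
      have : Continuous (fun κ : ℝ => P * (κ * ((B + 2 * M) / c) + 2 * κ)) := by fun_prop
      exact (this.tendsto' 0 0 (by simp)).mono_left nhdsWithin_le_nhds
    obtain ⟨κ, h1, h2⟩ := ((hcont.eventually (gt_mem_nhds hε)).and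
      (eventually_mem_set.2 (Ioc_mem_nhdsGT hε))).exists
    exact ⟨κ, h2.1, h2.2, h1⟩
  set η := f (s₀, x₀) with hη
  have hηM : D.IsMoserAt a₀ e σ s₀ x₀ η := hf.isMoserAt s₀ hs₀ x₀ hx₀ (by
    rw [hm, sub_self, norm_zero]; exact hf.pos.le)
  have hsnd : Tendsto (fun x : ℝ × W => x.2) (𝓝 (s₀, x₀)) (𝓝 x₀) := continuous_snd.tendsto _
  have hπ0 : D.π σ x₀ = x₀ := D.π_self σ x₀ hx₀
  have hcy : Continuous fun x : ℝ × W => (x.1, D.π σ x.2) := by fun_prop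
  have hty : Tendsto (fun x : ℝ × W => (x.1, D.π σ x.2)) (𝓝 (s₀, x₀)) (𝓝 (s₀, x₀)) :=
    hcy.tendsto' _ _ (by simp [hπ0])
  have e1 : ∀ᶠ x in 𝓝 (s₀, x₀), ‖D.moment (a₀ + e * x.1) (D.π σ x.2) - m‖ < δ := by
    have h1 : Continuous fun x : ℝ × W => ‖D.moment (a₀ + e * x.1) x.2 - m‖ :=
      ((D.continuous_moment_path a₀ e).sub continuous_const).norm
    exact hty.eventually (h1.continuousAt.eventually (gt_mem_nhds (by simpa [hm] using hf.pos)))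
  have e2 : ∀ᶠ x in 𝓝 (s₀, x₀), ‖f (x.1, D.π σ x.2) - η‖ < κ := by
    have h1 : Continuous fun x : ℝ × W => ‖f x - η‖ :=
      (hf.contDiff.continuous.sub continuous_const).norm
    exact hty.eventually (h1.continuousAt.eventually (gt_mem_nhds (by simpa [hη] using hκ)))
  have e3 : ∀ᶠ x in 𝓝 (s₀, x₀), ‖x.2 - D.π σ x.2‖ < κ := by
    have h1 : Continuous fun x : ℝ × W => ‖x.2 - D.π σ x.2‖ := by fun_prop
    exact h1.continuousAt.eventually (gt_mem_nhds (by simpa [hπ0] using hκ))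
  have e4 : ∀ᶠ x in 𝓝 (s₀, x₀), ∀ τ, x.2 ∈ D.S τ → ∃ u ∈ tangentSpaceOf (D.S τ) x.2,
      ‖u - η‖ < κ := by
    rw [eventually_all]
    intro τ
    exact hsnd.eventually (eventually_nhdsWithin_iff.1 (D.whitney σ τ x₀ hx₀ η hηM.1 κ hκ))
  have e5 : ∀ᶠ x in 𝓝 (s₀, x₀), x.2 ∈ ⋃ τ, D.S τ →
      ∀ᶠ q in 𝓝[⋃ τ, D.S τ] x.2, D.π σ q ∈ D.S σ := by
    have := eventually_eventually_nhdsWithin.2 (D.π_maps σ x₀ hx₀)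
    exact hsnd.eventually (eventually_nhdsWithin_iff.1 this)
  filter_upwards [e1, e2, e3, e4, e5, hsnd.eventually hcoer] with x h1 h2 h3 h4 h5 h6 hx τ hxτ
  refine ⟨h3.trans_le hκ1, fun ζ hζ => ?_⟩
  have hxZ := D.subset_iUnion τ hxτ
  have h5' := h5 hxZ
  have hy : D.π σ x.2 ∈ D.S σ := h5'.self_of_nhdsWithin hxZ
  set y := D.π σ x.2
  have hfM := hf.isMoserAt x.1 hx y hy h1.le
  have hπf : D.π σ (f (x.1, y)) = f (x.1, y) := π_tangent hy hfM.1
  obtain ⟨u, huT, hu⟩ := h4 τ hxτ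
  obtain ⟨v, hv⟩ : ∃ v, v = ζ - u := ⟨_, rfl⟩
  have hvT : v ∈ tangentSpaceOf (D.S τ) x.2 := by
    rw [hv]; exact Submodule.sub_mem _ hζ.1 huT
  have hπv : D.π σ v ∈ tangentSpaceOf (D.S σ) y :=
    ((D.π σ).hasFDerivAt (x := x.2)).hasFDerivWithinAt.mapsTo_tangentSpaceOf
      (nhdsWithin_mono _ (D.subset_iUnion τ) h5') hvT
  -- The Moser equation at `y` also holds for `v`, which need not be tangent to `S σ`: both `y` and
  -- `f (x.1, y)` are fixed by `π σ`, selfadjointness moves `π σ` onto `v`, and `π σ v` is tangent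
  -- at `y`.
  have hmid : D.covec e y v = D.form (a₀ + e * x.1) (f (x.1, y)) v := by
    have k1 : D.form (a₀ + e * x.1) (f (x.1, y)) v =
        D.form (a₀ + e * x.1) (f (x.1, y)) (D.π σ v) := by
      conv_lhs => rw [← hπf]
      rw [form_π]
    have k2 : D.covec e y v = D.covec e y (D.π σ v) := by
      have : D.π σ y = y := D.π_self σ y hy
      conv_lhs => rw [← this]
      rw [covec_apply, covec_apply, D.π₀, D.π₁]
    rw [k1, k2]
    exact (hfM.2 _ hπv).symm
  have hvv : D.form (a₀ + e * x.1) v v = D.covec e (x.2 - y) v +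
      D.form (a₀ + e * x.1) (f (x.1, y) - u) v := by
    have k1 : D.form (a₀ + e * x.1) ζ v = D.covec e x.2 v := hζ.2 v hvT
    have k2 : D.form (a₀ + e * x.1) v v =
        D.form (a₀ + e * x.1) ζ v - D.form (a₀ + e * x.1) u v := by
      rw [← sub_apply, ← map_sub, ← hv]
    rw [k2, k1, map_sub, map_sub, sub_apply, sub_apply, hmid]
    ring
  have hfu : ‖f (x.1, y) - u‖ ≤ 2 * κ := by
    have := norm_sub_le_norm_sub_add_norm_sub (f (x.1, y)) η u
    rw [norm_sub_rev η u] at this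
    linarith
  have hvb : c * ‖v‖ ^ 2 ≤ (κ * (B + 2 * M)) * ‖v‖ := by
    have k1 := h6 τ hxτ v hvT _ (ha x.1 hx)
    rw [← form_apply, hvv] at k1
    have k2 : D.covec e (x.2 - y) v ≤ B * κ * ‖v‖ := by
      refine (le_abs_self _).trans (((D.covec e).le_opNorm₂ _ _).trans ?_)
      gcongr
    have k3 : D.form (a₀ + e * x.1) (f (x.1, y) - u) v ≤ M * (2 * κ) * ‖v‖ := by
      refine (le_abs_self _).trans ((D.norm_form_apply_le (ha x.1 hx) _ _).trans ?_)
      gcongr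
    nlinarith
  have hvn : ‖v‖ ≤ κ * ((B + 2 * M) / c) := by
    rw [mul_div_assoc', le_div_iff₀ hc]
    rcases (norm_nonneg v).eq_or_lt with h0 | h0
    · rw [← h0, zero_mul]; positivity
    · refine le_of_mul_le_mul_right ?_ h0
      nlinarith
  have hfin : ‖ζ - f (x.1, y)‖ ≤ κ * ((B + 2 * M) / c) + 2 * κ := by
    have k1 : ζ - f (x.1, y) = v - (f (x.1, y) - u) := by rw [hv]; abel
    rw [k1]
    exact (norm_sub_le _ _).trans (add_le_add hvn hfu)
  calc ‖D.π σ ζ - f (x.1, y)‖ = ‖D.π σ (ζ - f (x.1, y))‖ := by rw [map_sub, hπf]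
    _ ≤ P * ‖ζ - f (x.1, y)‖ := (D.π σ).le_opNorm _
    _ ≤ P * (κ * ((B + 2 * M) / c) + 2 * κ) := by gcongr
    _ < ε := hκ2

/-- Linearity in a common bound for the initial and running errors, so that `ε` can be chosen in
advance. -/
theorem gronwallBound_self_mul (K ε x : ℝ) :
    gronwallBound ε K ε x = ε * gronwallBound 1 K 1 x := by
  unfold gronwallBound
  split_ifs <;> ring

/-- A trajectory `c` from a point near `p` may lie in another stratum, but by conservation of the
moment it stays close to a compact level set in the stratum of `p`. There `π σ ∘ c` is an
approximate solution for the adapted field, and `c` is close to `π σ ∘ c`. -/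
theorem continuousOn_flow [FiniteDimensional ℝ W] [Finite ι] (D : MoserData W ι r)
    (ha : ∀ s ∈ Set.Icc (0 : ℝ) 1, a₀ + e * s ∈ Set.Icc (0 : ℝ) 1) :
    ContinuousOn (D.flow a₀ e) (⋃ σ, D.S σ) := by
  intro p hpZ
  obtain ⟨σ, hp⟩ := Set.mem_iUnion.1 hpZ
  have hz : (0 : ℝ) ∈ Set.Icc (0 : ℝ) 1 := ⟨le_rfl, zero_le_one⟩
  have h1' : (1 : ℝ) ∈ Set.Icc (0 : ℝ) 1 := ⟨zero_le_one, le_rfl⟩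
  have ha0 : a₀ ∈ Set.Icc (0 : ℝ) 1 := by simpa using ha 0 hz
  obtain ⟨f, δ, hf⟩ := D.exists_isAdapted ha hp
  set m := D.moment a₀ p with hm
  obtain ⟨γ, h0, hγ⟩ := D.exists_isTraj ha hp
  have hγf : IsUnitSolution f γ := hγ.isUnitSolution ha hf (by
    rw [h0, ← hm, sub_self, norm_zero]; exact hf.pos.le)
  obtain ⟨K, hK⟩ := exists_lipschitz_of_hasCompactSupport hf.contDiff hf.hasCompactSupport
  have hflow : D.flow a₀ e p = γ 1 := by rw [← h0]; exact hγ.flow_eq ha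
  rw [ContinuousWithinAt, Metric.tendsto_nhds, hflow]
  intro η hη
  obtain ⟨ε, hε, hεη⟩ : ∃ ε > 0, ε + ε * gronwallBound 1 K 1 1 < η := by
    have : Continuous fun ε : ℝ => ε + ε * gronwallBound 1 K 1 1 := by fun_prop
    have ht : Tendsto (fun ε : ℝ => ε + ε * gronwallBound 1 K 1 1) (𝓝[>] 0) (𝓝 0) :=
      (this.tendsto' 0 0 (by simp)).mono_left nhdsWithin_le_nhds
    obtain ⟨ε, h1, h2⟩ := ((ht.eventually (gt_mem_nhds hη)).and self_mem_nhdsWithin).exists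
    exact ⟨ε, h2, h1⟩
  let Good : ℝ × W → Prop := fun x => x.1 ∈ Set.Icc (0 : ℝ) 1 → ∀ τ, x.2 ∈ D.S τ →
      ‖x.2 - D.π σ x.2‖ < ε ∧ ∀ ζ, D.IsMoserAt a₀ e τ x.1 x.2 ζ →
        ‖D.π σ ζ - f (x.1, D.π σ x.2)‖ < ε
  -- Points of exact moment `m` lie in `S σ`, where the local comparison holds; compactness gives
  -- one tolerance `δ'` for all times and all points of nearby moment.
  obtain ⟨δ', hδ', hgood⟩ := (D.isCompact_moment_le ha D.closed subset_rfl m 1).exists_pos_forall_le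
    (isOpen_interior (s := {x | Good x})) (F := fun x => ‖D.moment (a₀ + e * x.1) x.2 - m‖)
    ((D.continuous_moment_path a₀ e).sub continuous_const).norm.continuousOn (by
      rintro x ⟨k1, k2, -⟩ k4
      by_contra hcon
      have k5 : D.moment (a₀ + e * x.1) x.2 = m := by
        rw [← sub_eq_zero, ← norm_le_zero_iff]
        exact not_lt.1 hcon
      obtain ⟨τ, hτ⟩ := Set.mem_iUnion.1 k2
      have : τ = σ := D.stratum_eq hτ hp (ha _ k1) ha0 k5
      subst this
      exact k4 (mem_interior_iff_mem_nhds.2 (eventually_moser_close ha hf k1 hτ k5 hε)))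
  have hcm : Continuous fun x : W => ‖D.moment a₀ x - m‖ := by
    have := (D.continuous_moment_path a₀ 0).comp (Continuous.prodMk_right (0 : ℝ))
    have h2 : Continuous fun x => D.moment a₀ x := by simpa [Function.comp_def] using this
    exact (h2.sub continuous_const).norm
  have hpδ : ‖D.moment a₀ p - m‖ < min δ' 1 := by
    rw [← hm, sub_self, norm_zero]
    exact lt_min hδ' zero_lt_one
  have hpε : ‖D.π σ p - p‖ < ε := by rwa [D.π_self σ p hp, sub_self, norm_zero]
  have hcπ : Continuous fun x : W => ‖D.π σ x - p‖ := by fun_prop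
  filter_upwards [self_mem_nhdsWithin, mem_nhdsWithin_of_mem_nhds (hcm.continuousAt.eventually
      (gt_mem_nhds hpδ)),
    mem_nhdsWithin_of_mem_nhds (hcπ.continuousAt.eventually (gt_mem_nhds hpε))] with q hqZ hqm hqp
  obtain ⟨τ, hq⟩ := Set.mem_iUnion.1 hqZ
  obtain ⟨c, rfl, hc⟩ := D.exists_isTraj ha hq
  rw [hc.flow_eq ha]
  have hcg : ∀ s ∈ Set.Icc (0 : ℝ) 1, Good (s, c s) := by
    intro s hs
    have k1 : ‖D.moment (a₀ + e * s) (c s) - m‖ < min δ' 1 := by rwa [hc.moment_eq hs]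
    have k2 : ((s, c s) : ℝ × W) ∈ interior {x | Good x} := hgood (s, c s)
      ⟨hs, D.subset_iUnion τ (hc s hs).1, k1.le.trans (min_le_right _ _)⟩
      (k1.le.trans (min_le_left _ _))
    exact interior_subset k2
  choose! ζ hζ using fun s hs => (hc s hs).2
  have hπc : ∀ s ∈ Set.Icc (0 : ℝ) 1,
      HasDerivWithinAt (fun s => D.π σ (c s)) (D.π σ (ζ s)) (Set.Icc 0 1) s := fun s hs =>
    (D.π σ).hasFDerivAt.comp_hasDerivWithinAt s (hζ s hs).2
  have hgr := dist_le_of_approx_trajectories_ODE (v := fun s x => f (s, x)) (K := K) (δ := ε)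
    (εf := ε) (εg := 0) (f := fun s => D.π σ (c s)) (g := γ) (a := 0) (b := 1)
    (f' := fun s => D.π σ (ζ s)) (g' := fun s => f (s, γ s)) hK
    (fun s hs => (hπc s hs).continuousWithinAt)
    (fun s hs => (hπc s (Set.Ico_subset_Icc_self hs)).Ici_of_Icc hs)
    (fun s hs => by
      have hs' := Set.Ico_subset_Icc_self hs
      rw [dist_eq_norm]
      exact ((hcg s hs' hs' τ (hc s hs').1).2 _ (hζ s hs').1).le)
    hγf.continuousOn
    (fun s hs => (hγf s (Set.Ico_subset_Icc_self hs)).Ici_of_Icc hs)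
    (fun s hs => by simp)
    (by rw [h0, dist_eq_norm]; exact hqp.le) 1 h1'
  rw [add_zero, sub_zero, gronwallBound_self_mul] at hgr
  have hfin := (hcg 1 h1' h1' τ (hc 1 h1').1).1
  have htri := dist_triangle (c 1) (D.π σ (c 1)) (γ 1)
  have hgr' : dist (D.π σ (c 1)) (γ 1) ≤ ε * gronwallBound 1 K 1 1 := hgr
  have hfin' : dist (c 1) (D.π σ (c 1)) < ε := by rwa [dist_eq_norm]
  linarith

end MoserData

/-! ### Characters of the torus -/

namespace AlgTorus

variable {r : ℕ}

theorem character_mul (m : Fin r → ℤ) (h h' : AlgTorus r) :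
    character m (h * h') = character m h * character m h' := by
  simp [character, mul_zpow, Finset.prod_mul_distrib]

theorem character_one (m : Fin r → ℤ) : character m (1 : AlgTorus r) = 1 := by
  simp [character]

theorem character_add (m n : Fin r → ℤ) (h : AlgTorus r) :
    character (m + n) h = character m h * character n h := by
  simp [character, zpow_add, Finset.prod_mul_distrib]

theorem character_zero (h : AlgTorus r) : character 0 h = 1 := by
  simp [character]

theorem character_of_exp {h : AlgTorus r} {ζ : Fin r → ℂ} (m : Fin r → ℤ)
    (hζ : ∀ j, (h j : ℂ) = Complex.exp (ζ j)) :
    character m h = Complex.exp (∑ j, (m j : ℂ) * ζ j) := by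
  simp only [character, Complex.exp_sum, Units.coe_prod, Units.val_zpow_eq_zpow_val, hζ,
    Complex.exp_int_mul]

theorem character_incl_exp (m : Fin r → ℤ) (ξ : Fin r → ℝ) :
    character m (CompactTorus.exp ξ).incl =
      Complex.exp (Complex.I * ((∑ j, (m j : ℝ) * ξ j : ℝ) : ℂ)) := by
  rw [character_of_exp (ζ := fun j => Complex.I * ξ j)]
  · congr 1
    push_cast
    rw [Finset.mul_sum]
    exact Finset.sum_congr rfl fun j _ => by ring
  · intro j
    simp [CompactTorus.incl, CompactTorus.exp, mul_comm]

theorem incl_mul (t t' : CompactTorus r) : (t * t').incl = t.incl * t'.incl := by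
  ext j; simp [CompactTorus.incl]

theorem incl_one : (1 : CompactTorus r).incl = 1 := by
  ext j; simp [CompactTorus.incl]

theorem conj_character_incl (m : Fin r → ℤ) (t : CompactTorus r) :
    (starRingEnd ℂ) (character m t.incl) = character m (t⁻¹).incl := by
  simp [character, CompactTorus.incl, ← Circle.coe_inv_eq_conj]

/-- The restriction of a character to the compact torus. -/
def characterHom (m : Fin r → ℤ) : CompactTorus r →* ℂ where
  toFun t := character m t.incl
  map_one' := by rw [incl_one, character_one]
  map_mul' t t' := by rw [incl_mul, character_mul]

theorem characterHom_injective :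
    Function.Injective (characterHom : (Fin r → ℤ) → CompactTorus r →* ℂ) := by
  intro m n h
  by_contra hne
  obtain ⟨j, hj⟩ := Function.ne_iff.1 hne
  have hj' : ((m j : ℝ) - n j) ≠ 0 := sub_ne_zero.2 (by exact_mod_cast hj)
  -- At this element the two characters differ by the factor `exp(iπ) = -1`.
  have h1 := DFunLike.congr_fun h (CompactTorus.exp (Pi.single j (Real.pi / (m j - n j))))
  change character m _ = character n _ at h1
  rw [character_incl_exp, character_incl_exp] at h1
  have hs : ∀ k : Fin r → ℤ, ∑ l, (k l : ℝ) * (Pi.single j (Real.pi / (m j - n j)) : Fin r → ℝ) l =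
      k j * (Real.pi / (m j - n j)) := by
    intro k
    rw [Finset.sum_eq_single j] <;> simp +contextual
  rw [hs, hs, Complex.exp_eq_exp_iff_exp_sub_eq_one, ← mul_sub, ← Complex.ofReal_sub, ← sub_mul,
    mul_div_cancel₀ _ hj', mul_comm, Complex.exp_pi_mul_I] at h1
  norm_num at h1

theorem linearIndependent_character_incl :
    LinearIndependent ℂ (fun (m : Fin r → ℤ) (t : CompactTorus r) => character m t.incl) := by
  have h := linearIndependent_monoidHom (CompactTorus r) ℂ
  exact h.comp (characterHom : (Fin r → ℤ) → CompactTorus r →* ℂ) characterHom_injective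

theorem linearIndependent_character :
    LinearIndependent ℂ (character : (Fin r → ℤ) → AlgTorus r → ℂ) :=
  LinearIndependent.of_comp (LinearMap.funLeft ℂ ℂ CompactTorus.incl)
    linearIndependent_character_incl

/-- Linear independence of the characters of the compact torus, with vector coefficients. -/
theorem eq_zero_of_sum_character {E : Type*} [AddCommGroup E] [Module ℂ E]
    {M : Finset (Fin r → ℤ)} {v : (Fin r → ℤ) → E}
    (h : ∀ t : CompactTorus r, ∑ m ∈ M, character m t.incl • v m = 0) {m : Fin r → ℤ}
    (hm : m ∈ M) : v m = 0 := by
  rw [← Module.forall_dual_apply_eq_zero_iff ℂ]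
  intro ℓ
  refine linearIndependent_iff'.1 linearIndependent_character_incl M (fun m => ℓ (v m)) ?_ m hm
  ext t
  have := congrArg ℓ (h t)
  simpa [mul_comm] using this

end AlgTorus

/-! ### Weight spaces of unitary modules -/

namespace UnitaryTorusModule

open AlgTorus

variable {r : ℕ} {E : Type*} [NormedAddCommGroup E] [InnerProductSpace ℂ E]
  [FiniteDimensional ℂ E] (ρ : UnitaryTorusModule r E)

/-- The coefficients of the character `m` in the matrix entries form the operator `P m`. That these
operators are orthogonal projections is deduced later from the independence of characters. -/
theorem exists_weight_decomposition : ∃ (M : Finset (Fin r → ℤ)) (P : (Fin r → ℤ) → E →L[ℂ] E),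
    (∀ m ∉ M, P m = 0) ∧ ∀ h v, ρ.rep h v = ∑ m ∈ M, character m h • P m v := by
  classical
  let b := Module.finBasis ℂ E
  have hc : ∀ k l, ∃ c : (Fin r → ℤ) →₀ ℂ,
      ∀ h, b.coord l (ρ.rep h (b k)) = ∑ m ∈ c.support, c m * character m h := by
    intro k l
    obtain ⟨c, hc⟩ := Finsupp.mem_span_range_iff_exists_finsupp.1 (ρ.algebraic (b k) (b.coord l))
    refine ⟨c, fun h => ?_⟩
    rw [← congrFun hc h, Finsupp.sum, Finset.sum_apply]
    rfl
  choose c hc using hc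
  let M := Finset.univ.biUnion fun k => Finset.univ.biUnion fun l => (c k l).support
  have hM : ∀ k l, (c k l).support ⊆ M := fun k l m hm => by
    simp only [M, Finset.mem_biUnion, Finset.mem_univ, true_and]
    exact ⟨k, l, hm⟩
  let P : (Fin r → ℤ) → E →ₗ[ℂ] E := fun m => b.constr ℂ fun k => ∑ l, c k l m • b l
  refine ⟨M, fun m => LinearMap.toContinuousLinearMap (P m), fun m hm => ?_, fun h v => ?_⟩
  · have : P m = 0 := by
      refine b.ext fun k => ?_
      simp only [P, Module.Basis.constr_basis, LinearMap.zero_apply]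
      refine Finset.sum_eq_zero fun l _ => ?_
      rw [Finsupp.notMem_support_iff.1 fun h => hm (hM k l h), zero_smul]
    change LinearMap.toContinuousLinearMap (P m) = 0
    rw [this, map_zero]
  · have : ρ.rep h = ∑ m ∈ M, character m h • P m := by
      refine b.ext fun k => b.ext_elem fun l => ?_
      rw [← b.coord_apply, hc k l h, Finset.sum_subset (hM k l) fun m _ hm => by
        rw [Finsupp.notMem_support_iff.1 hm, zero_mul]]
      simp [P, Finsupp.single_apply, mul_comm, Finset.sum_apply']
    rw [this]
    simp

/-- The finite set of (possible) weights of a unitary module. -/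
def wts : Finset (Fin r → ℤ) := ρ.exists_weight_decomposition.choose

/-- The projection onto the weight space of weight `m`. -/
def proj (m : Fin r → ℤ) : E →L[ℂ] E := ρ.exists_weight_decomposition.choose_spec.choose m

theorem proj_of_notMem {m : Fin r → ℤ} (hm : m ∉ ρ.wts) : ρ.proj m = 0 :=
  ρ.exists_weight_decomposition.choose_spec.choose_spec.1 m hm

theorem rep_eq (h : AlgTorus r) (v : E) :
    ρ.rep h v = ∑ m ∈ ρ.wts, character m h • ρ.proj m v :=
  ρ.exists_weight_decomposition.choose_spec.choose_spec.2 h v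

theorem sum_proj (v : E) : ∑ m ∈ ρ.wts, ρ.proj m v = v := by
  have := ρ.rep_eq 1 v
  simpa [character_one] using this.symm

/-- Both sides are the coefficient of the character `m` in `ρ(t) ρ(h) v = ρ(t h) v`, as functions of
`t` in the compact torus. -/
theorem proj_rep (m : Fin r → ℤ) (h : AlgTorus r) (v : E) :
    ρ.proj m (ρ.rep h v) = character m h • ρ.proj m v := by
  by_cases hm : m ∈ ρ.wts
  · have := eq_zero_of_sum_character (M := ρ.wts)
      (v := fun m => ρ.proj m (ρ.rep h v) - character m h • ρ.proj m v) (fun t => by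
        have h1 : ρ.rep t.incl (ρ.rep h v) = ρ.rep (t.incl * h) v := by
          rw [map_mul]; rfl
        rw [ρ.rep_eq t.incl, ρ.rep_eq (t.incl * h)] at h1
        simp only [smul_sub, Finset.sum_sub_distrib, h1, smul_smul, character_mul, sub_self]) hm
    exact sub_eq_zero.1 this
  · rw [ρ.proj_of_notMem hm]; simp

theorem proj_proj (m n : Fin r → ℤ) (v : E) :
    ρ.proj m (ρ.proj n v) = if m = n then ρ.proj n v else 0 := by
  by_cases hn : n ∈ ρ.wts
  · have := eq_zero_of_sum_character (M := ρ.wts)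
      (v := fun n => ρ.proj m (ρ.proj n v) - if m = n then ρ.proj n v else 0) (fun t => by
        have h1 := ρ.proj_rep m t.incl v
        rw [ρ.rep_eq t.incl, map_sum] at h1
        simp only [map_smul] at h1
        simp only [smul_sub, Finset.sum_sub_distrib, h1, smul_ite, smul_zero,
          Finset.sum_ite_eq, sub_eq_zero]
        split_ifs with hm
        · rfl
        · rw [ρ.proj_of_notMem hm]; simp) hn
    exact sub_eq_zero.1 this
  · rw [ρ.proj_of_notMem hn]; simp

/-- Coefficients of characters are compared in `⟨ρ(t⁻¹) v, w⟩ = ⟨v, ρ(t) w⟩`; conjugation turns the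
character at `t⁻¹` into the character at `t`. -/
theorem inner_proj_left (m : Fin r → ℤ) (v w : E) :
    inner ℂ (ρ.proj m v) w = inner ℂ v (ρ.proj m w) := by
  by_cases hm : m ∈ ρ.wts
  · have := eq_zero_of_sum_character (M := ρ.wts) (E := ℂ)
      (v := fun m => inner ℂ (ρ.proj m v) w - inner ℂ v (ρ.proj m w)) (fun t => by
        have h1 := ρ.unitary (t⁻¹) v (ρ.rep t.incl w)
        have h2 : ρ.rep (t⁻¹).incl (ρ.rep t.incl w) = w := by
          rw [← Module.End.mul_apply, ← map_mul, ← incl_mul, inv_mul_cancel, incl_one, map_one]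
          rfl
        rw [h2, ρ.rep_eq (t⁻¹).incl, ρ.rep_eq t.incl, sum_inner, inner_sum] at h1
        simp only [inner_smul_left, inner_smul_right, conj_character_incl, inv_inv] at h1
        simp only [smul_eq_mul, mul_sub, Finset.sum_sub_distrib, h1, sub_self]) hm
    exact sub_eq_zero.1 this
  · rw [ρ.proj_of_notMem hm]; simp

theorem inner_proj_self (m : Fin r → ℤ) (v : E) :
    inner ℂ (ρ.proj m v) v = ((‖ρ.proj m v‖ ^ 2 : ℝ) : ℂ) := by
  have : ρ.proj m v = ρ.proj m (ρ.proj m v) := by rw [proj_proj, if_pos rfl]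
  conv_lhs => rw [this, inner_proj_left]
  rw [inner_self_eq_norm_sq_to_K]
  norm_cast

theorem sum_norm_proj_sq (v : E) : ∑ m ∈ ρ.wts, ‖ρ.proj m v‖ ^ 2 = ‖v‖ ^ 2 := by
  have h : inner ℂ v v = ∑ m ∈ ρ.wts, inner ℂ (ρ.proj m v) v := by
    rw [← sum_inner, sum_proj]
  simp only [inner_proj_self] at h
  have h1 := congrArg Complex.re h
  rw [← Complex.ofReal_sum, Complex.ofReal_re] at h1
  rw [← h1]
  exact inner_self_eq_norm_sq (𝕜 := ℂ) v

theorem hasDerivAt_rep_exp (ξ : Fin r → ℝ) (v : E) :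
    HasDerivAt (fun s : ℝ => ρ.rep (CompactTorus.exp (s • ξ)).incl v)
      (∑ m ∈ ρ.wts, (Complex.I * ((∑ j, (m j : ℝ) * ξ j : ℝ) : ℂ)) • ρ.proj m v) 0 := by
  have h1 : (fun s : ℝ => ρ.rep (CompactTorus.exp (s • ξ)).incl v) = fun s : ℝ => ∑ m ∈ ρ.wts,
      Complex.exp (s * (Complex.I * ((∑ j, (m j : ℝ) * ξ j : ℝ) : ℂ))) • ρ.proj m v := by
    ext s
    rw [rep_eq]
    refine Finset.sum_congr rfl fun m _ => ?_
    rw [character_incl_exp]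
    congr 2
    push_cast
    simp only [Finset.mul_sum, Pi.smul_apply, smul_eq_mul, Complex.ofReal_mul]
    exact Finset.sum_congr rfl fun j _ => by ring
  rw [h1]
  refine HasDerivAt.fun_sum fun m _ => ?_
  refine HasDerivAt.smul_const ?_ _
  have h2 : HasDerivAt (fun s : ℝ => (s : ℂ) * (Complex.I * ((∑ j, (m j : ℝ) * ξ j : ℝ) : ℂ)))
      (Complex.I * ((∑ j, (m j : ℝ) * ξ j : ℝ) : ℂ)) 0 := by
    simpa using (Complex.ofRealCLM.hasDerivAt (x := (0 : ℝ))).mul_const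
      (Complex.I * ((∑ j, (m j : ℝ) * ξ j : ℝ) : ℂ))
  simpa using h2.cexp

theorem fundVF_eq (ξ : Fin r → ℝ) (v : E) : ρ.fundVF ξ v =
    ∑ m ∈ ρ.wts, (Complex.I * ((∑ j, (m j : ℝ) * ξ j : ℝ) : ℂ)) • ρ.proj m v :=
  (ρ.hasDerivAt_rep_exp ξ v).deriv

/-- The selfadjoint operator through which `ξ ∈ Lie(T)` acts, up to the factor `i`. -/
def weightOp (ξ : Fin r → ℝ) : E →L[ℂ] E :=
  ∑ m ∈ ρ.wts, ((∑ j, (m j : ℝ) * ξ j : ℝ) : ℂ) • ρ.proj m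

theorem weightOp_apply (ξ : Fin r → ℝ) (v : E) : ρ.weightOp ξ v =
    ∑ m ∈ ρ.wts, ((∑ j, (m j : ℝ) * ξ j : ℝ) : ℂ) • ρ.proj m v := by
  simp [weightOp]

theorem fundVF_eq_smul (ξ : Fin r → ℝ) (v : E) : ρ.fundVF ξ v = Complex.I • ρ.weightOp ξ v := by
  rw [fundVF_eq, weightOp_apply, Finset.smul_sum]
  simp only [smul_smul]

theorem inner_weightOp_left (ξ : Fin r → ℝ) (v w : E) :
    inner ℂ (ρ.weightOp ξ v) w = inner ℂ v (ρ.weightOp ξ w) := by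
  simp only [weightOp_apply, sum_inner, inner_sum, inner_smul_left, inner_smul_right,
    inner_proj_left, Complex.conj_ofReal]

theorem inner_weightOp_self (ξ : Fin r → ℝ) (v : E) :
    inner ℂ (ρ.weightOp ξ v) v =
      ((∑ m ∈ ρ.wts, (∑ j, (m j : ℝ) * ξ j) * ‖ρ.proj m v‖ ^ 2 : ℝ) : ℂ) := by
  simp only [weightOp_apply, sum_inner, inner_smul_left, inner_proj_self, Complex.conj_ofReal]
  push_cast
  rfl

theorem momentMap_pairing (v : E) (ξ : Fin r → ℝ) : ∑ j, ρ.momentMap v j * ξ j =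
    (inner ℂ (ρ.weightOp ξ v) v).re / 2 := by
  have h : ∀ ξ, symplForm (ρ.fundVF ξ v) v = (inner ℂ (ρ.weightOp ξ v) v).re := by
    intro ξ
    rw [symplForm, fundVF_eq_smul, inner_smul_left]
    simp
  simp only [momentMap, h, inner_weightOp_self, Complex.ofReal_re]
  have h2 : ∀ (m : Fin r → ℤ) (j : Fin r),
      ∑ k, (m k : ℝ) * (Pi.single j 1 : Fin r → ℝ) k = m j := by
    intro m j
    rw [Finset.sum_eq_single j] <;> simp +contextual
  simp only [h2, Finset.sum_mul, Finset.sum_div]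
  rw [Finset.sum_comm]
  refine Finset.sum_congr rfl fun m _ => Finset.sum_congr rfl fun j _ => by ring

/-- The moment map is the sum of the weights, with the squared norms of the components as
coefficients. -/
theorem momentMap_eq (v : E) :
    ρ.momentMap v = ∑ m ∈ ρ.wts, (‖ρ.proj m v‖ ^ 2 / 2) • fun j => (m j : ℝ) := by
  ext j
  have h1 := ρ.momentMap_pairing v (Pi.single j 1)
  rw [Finset.sum_eq_single j (by simp +contextual) (by simp),
    inner_weightOp_self, Complex.ofReal_re, Pi.single_eq_same, mul_one] at h1
  rw [h1, Finset.sum_apply, Finset.sum_div]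
  refine Finset.sum_congr rfl fun m _ => ?_
  rw [Finset.sum_eq_single j (by simp +contextual) (by simp)]
  simp
  ring

end UnitaryTorusModule

/-! ### Cones -/

/-- An element of the span becomes an element of `F` after adding a suitable `y ∈ F`; the defining
property of a face then applies. -/
theorem PointedCone.IsFaceOf.mem_of_mem_span {M : Type*} [AddCommGroup M] [Module ℝ M]
    {F C : PointedCone ℝ M} (hF : F.IsFaceOf C) {x : M} (hx : x ∈ C)
    (hs : x ∈ Submodule.span ℝ (F : Set M)) : x ∈ F := by
  have h : ∃ y ∈ F, x + y ∈ F := by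
    clear hx
    induction hs using Submodule.span_induction with
    | mem x hx => exact ⟨0, zero_mem _, by simpa using hx⟩
    | zero => exact ⟨0, zero_mem _, by simp⟩
    | add a b _ _ ha hb =>
      obtain ⟨y, hy, h1⟩ := ha
      obtain ⟨z, hz, h2⟩ := hb
      exact ⟨y + z, add_mem hy hz, by rw [add_add_add_comm]; exact add_mem h1 h2⟩
    | smul t a _ ha =>
      obtain ⟨y, hy, h1⟩ := ha
      rcases le_total 0 t with ht | ht
      · exact ⟨t • y, F.smul_mem ht hy, by rw [← smul_add]; exact F.smul_mem ht h1⟩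
      · refine ⟨(-t) • (a + y), F.smul_mem (neg_nonneg.2 ht) h1, ?_⟩
        have : t • a + (-t) • (a + y) = (-t) • y := by module
        rw [this]
        exact F.smul_mem (neg_nonneg.2 ht) hy
  obtain ⟨y, hy, h1⟩ := h
  exact hF.mem_of_add_mem_left hx (hF.le hy) h1

/-- A linear functional that vanishes on a subspace and is positive on a finite set of vectors, no
convex combination of which lies in the subspace. -/
theorem exists_functional_pos {ι M : Type*} [NormedAddCommGroup M] [NormedSpace ℝ M]
    [FiniteDimensional ℝ M] (s : Finset ι) {u : ι → M} (hu : Function.Injective u)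
    (L : Submodule ℝ M)
    (h : ∀ c : ι → ℝ, (∀ k ∈ s, 0 ≤ c k) → ∑ k ∈ s, c k • u k ∈ L → ∀ k ∈ s, c k = 0) :
    ∃ f : M →ₗ[ℝ] ℝ, (∀ l ∈ L, f l = 0) ∧ ∀ k ∈ s, 0 < f (u k) := by
  classical
  obtain ⟨f, a, b, h1, h2, h3⟩ := geometric_hahn_banach_compact_closed
    (convex_convexHull ℝ ((s.image u : Finset M) : Set M))
    ((s.image u).finite_toSet.isCompact_convexHull ℝ) L.convex L.closed_of_finiteDimensional (by
      rw [Set.disjoint_left]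
      intro x hx hxL
      rw [Finset.mem_convexHull'] at hx
      obtain ⟨w, hw0, hw1, rfl⟩ := hx
      rw [Finset.sum_image (fun _ _ _ _ h => hu h)] at hw1 hxL
      have := h (fun k => w (u k)) (fun k hk => hw0 _ (Finset.mem_image_of_mem _ hk)) hxL
      rw [Finset.sum_eq_zero this] at hw1
      exact zero_ne_one hw1)
  -- The separating functional is bounded below by `b` on the subspace `L`, so it vanishes there.
  -- Hence `b < 0`, and `-f` is the required functional.
  have hL : ∀ l ∈ L, f l = 0 := by
    intro l hl
    by_contra hne
    have := h3 _ (L.smul_mem (b / f l) hl)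
    rw [map_smul, smul_eq_mul, div_mul_cancel₀ _ hne] at this
    exact lt_irrefl _ this
  have hb : b < 0 := by simpa using h3 0 L.zero_mem
  refine ⟨-f.toLinearMap, fun l hl => by simp [hL l hl], fun k hk => ?_⟩
  have := h1 (u k) (subset_convexHull ℝ _ (Finset.mem_coe.2 (Finset.mem_image_of_mem u hk)))
  simp only [LinearMap.neg_apply, ContinuousLinearMap.coe_coe, neg_pos]
  linarith

theorem LinearMap.eq_sum_pi_single {r : ℕ} (f : (Fin r → ℝ) →ₗ[ℝ] ℝ) (x : Fin r → ℝ) :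
    f x = ∑ j, x j * f (Pi.single j 1) := by
  conv_lhs => rw [← Finset.univ_sum_single x, map_sum]
  refine Finset.sum_congr rfl fun j _ => ?_
  rw [← smul_eq_mul, ← map_smul, ← Pi.single_smul, smul_eq_mul, mul_one]

/-! ### Embeddings of affine varieties -/

namespace AffineVariety

variable {X : Type*} (V : AffineVariety X)

/-- The map `j : X → W` is a closed embedding into a vector space. -/
def IsEmbedding {W : Type*} [AddCommGroup W] [Module ℂ W] (j : X → W) : Prop :=
  Algebra.adjoin ℂ {f : X → ℂ | ∃ ℓ : W →ₗ[ℂ] ℂ, f = fun x => ℓ (j x)} = V.coord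

variable {V}

namespace IsEmbedding

section

variable {W W' : Type*} [AddCommGroup W] [Module ℂ W] [AddCommGroup W'] [Module ℂ W'] {j : X → W}
  {j' : X → W'}

theorem comp_mem (hj : V.IsEmbedding j) (ℓ : W →ₗ[ℂ] ℂ) : (fun x => ℓ (j x)) ∈ V.coord := by
  rw [← hj]
  exact Algebra.subset_adjoin ⟨ℓ, rfl⟩

theorem prodMk (hj : V.IsEmbedding j) (hj' : V.IsEmbedding j') :
    V.IsEmbedding fun x => (j x, j' x) := by
  refine le_antisymm (Algebra.adjoin_le ?_) ?_
  · rintro _ ⟨ℓ, rfl⟩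
    have h : (fun x => ℓ (j x, j' x)) =
        (fun x => (ℓ ∘ₗ LinearMap.inl ℂ W W') (j x)) +
          fun x => (ℓ ∘ₗ LinearMap.inr ℂ W W') (j' x) := by
      ext x
      simp [← map_add]
    rw [h]
    exact add_mem (hj.comp_mem _) (hj'.comp_mem _)
  · rw [← hj]
    refine Algebra.adjoin_mono ?_
    rintro _ ⟨ℓ, rfl⟩
    exact ⟨ℓ ∘ₗ LinearMap.fst ℂ W W', rfl⟩

theorem injective (hj : V.IsEmbedding j) : Function.Injective j := by
  intro x y hxy
  have h : ∀ f ∈ V.coord, f x = f y := by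
    rw [← hj]
    intro f hf
    induction hf using Algebra.adjoin_induction with
    | mem f hf => obtain ⟨ℓ, rfl⟩ := hf; simp [hxy]
    | algebraMap c => rfl
    | add f g _ _ hf hg => simp [hf, hg]
    | mul f g _ _ hf hg => simp [hf, hg]
  let χ : V.coord →ₐ[ℂ] ℂ := (Pi.evalAlgHom ℂ (fun _ : X => ℂ) x).comp V.coord.val
  exact (V.points χ).unique (fun _ => rfl) fun f => h f f.2

end

section

variable {W W' : Type*} [NormedAddCommGroup W] [NormedSpace ℂ W] [FiniteDimensional ℂ W]
  [NormedAddCommGroup W'] [NormedSpace ℂ W'] [FiniteDimensional ℂ W'] {j : X → W} {j' : X → W'}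

theorem exists_contDiff (hj : V.IsEmbedding j) {f : X → ℂ} (hf : f ∈ V.coord) :
    ∃ g : W → ℂ, ContDiff ℂ ∞ g ∧ ∀ x, f x = g (j x) := by
  rw [← hj] at hf
  induction hf using Algebra.adjoin_induction with
  | mem f hf =>
    obtain ⟨ℓ, rfl⟩ := hf
    exact ⟨ℓ, (LinearMap.toContinuousLinearMap ℓ).contDiff, fun x => rfl⟩
  | algebraMap c => exact ⟨fun _ => c, contDiff_const, fun x => rfl⟩
  | add f g _ _ hf hg =>
    obtain ⟨f', hf, hf'⟩ := hf
    obtain ⟨g', hg, hg'⟩ := hg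
    exact ⟨_, hf.add hg, fun x => by simp [hf', hg']⟩
  | mul f g _ _ hf hg =>
    obtain ⟨f', hf, hf'⟩ := hf
    obtain ⟨g', hg, hg'⟩ := hg
    exact ⟨_, hf.mul hg, fun x => by simp [hf', hg']⟩

/-- Two embeddings differ by a smooth map of the ambient spaces. -/
theorem exists_contDiff_map (hj : V.IsEmbedding j) (hj' : V.IsEmbedding j') :
    ∃ F : W → W', ContDiff ℂ ∞ F ∧ ∀ x, F (j x) = j' x := by
  let b := Module.finBasis ℂ W'
  choose g hg hgj using fun k => hj.exists_contDiff (hj'.comp_mem (b.coord k))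
  refine ⟨fun w => ∑ k, g k w • b k, ContDiff.sum fun k _ => (hg k).smul contDiff_const,
    fun x => ?_⟩
  simp only [← hgj]
  exact b.sum_repr (j' x)

theorem analytic_eq (hj : V.IsEmbedding j) :
    V.analytic = TopologicalSpace.induced j inferInstance := by
  refine le_antisymm ?_ ?_
  · rw [← continuous_iff_le_induced]
    let := V.analytic
    let b := Module.finBasis ℂ W
    have h : j = fun x => ∑ k, b.coord k (j x) • b k := by
      ext x; exact (b.sum_repr (j x)).symm
    rw [h]
    refine continuous_finsetSum _ fun k _ => Continuous.smul ?_ continuous_const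
    have h1 : Continuous fun (x : X) (f : V.coord) => (f : X → ℂ) x := continuous_induced_dom
    exact (continuous_apply (⟨_, hj.comp_mem (b.coord k)⟩ : V.coord)).comp h1
  · rw [analytic, ← continuous_iff_le_induced]
    let := TopologicalSpace.induced j inferInstance
    have hjc : Continuous j := continuous_induced_dom
    refine continuous_pi fun f => ?_
    obtain ⟨g, hg, hgj⟩ := hj.exists_contDiff f.2
    simp only [hgj]
    exact hg.continuous.comp hjc

/-- If `j x` tends to `w` along a filter, so does every regular function to some limit. The limits
define a homomorphism `ℂ[X] → ℂ`, that is, a point of `X`, and its image is `w`. -/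
theorem isClosed_range (hj : V.IsEmbedding j) : IsClosed (Set.range j) := by
  refine isClosed_of_closure_subset fun w hw => ?_
  let 𝓕 : Filter X := comap j (𝓝 w)
  have hne : 𝓕.NeBot := by
    rw [comap_neBot_iff]
    intro t ht
    obtain ⟨_, h1, x, rfl⟩ := mem_closure_iff_nhds.1 hw t ht
    exact ⟨x, h1⟩
  have hlim : ∀ f : V.coord, ∃ c, Tendsto (f : X → ℂ) 𝓕 (𝓝 c) := by
    intro f
    obtain ⟨g, hg, hgj⟩ := hj.exists_contDiff f.2
    refine ⟨g w, ?_⟩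
    have : (f : X → ℂ) = g ∘ j := funext hgj
    rw [this]
    exact (hg.continuous.tendsto w).comp tendsto_comap
  choose c hc using hlim
  let χ : V.coord →ₐ[ℂ] ℂ :=
    { toFun := c
      map_one' := tendsto_nhds_unique (hc 1) tendsto_const_nhds
      map_mul' := fun f g => tendsto_nhds_unique (hc (f * g)) ((hc f).mul (hc g))
      map_zero' := tendsto_nhds_unique (hc 0) tendsto_const_nhds
      map_add' := fun f g => tendsto_nhds_unique (hc (f + g)) ((hc f).add (hc g))
      commutes' := fun a => tendsto_nhds_unique (hc (algebraMap ℂ V.coord a)) tendsto_const_nhds }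
  obtain ⟨x, hx, -⟩ := V.points χ
  refine ⟨x, ?_⟩
  rw [← sub_eq_zero, ← Module.forall_dual_apply_eq_zero_iff ℂ]
  intro ℓ
  rw [map_sub, sub_eq_zero]
  refine (hx ⟨_, hj.comp_mem ℓ⟩).symm.trans ?_
  exact tendsto_nhds_unique (hc ⟨_, hj.comp_mem ℓ⟩)
    (((LinearMap.toContinuousLinearMap ℓ).continuous.tendsto w).comp tendsto_comap)

end

end IsEmbedding

end AffineVariety

/-! ### Weights of affine varieties -/

open AlgTorus

/-- The element of `Lie(T)*` defined by a weight. -/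
def realWeight {r : ℕ} (m : Fin r → ℤ) : Fin r → ℝ := fun j => m j

theorem realWeight_injective {r : ℕ} :
    Function.Injective (realWeight : (Fin r → ℤ) → Fin r → ℝ) := fun m n h => by
  ext j
  have : (m j : ℝ) = n j := congrFun h j
  exact_mod_cast this

namespace AlgTorus

variable {r : ℕ}

/-- The real one-parameter subgroup of `H` defined by a functional on the weights. -/
def realExp (f : (Fin r → ℝ) →ₗ[ℝ] ℝ) (t : ℝ) : AlgTorus r := fun j =>
  Units.mk0 (Complex.exp ((-(t * f (Pi.single j 1)) : ℝ) : ℂ)) (Complex.exp_ne_zero _)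

theorem character_realExp (f : (Fin r → ℝ) →ₗ[ℝ] ℝ) (t : ℝ) (m : Fin r → ℤ) :
    character m (realExp f t) = ((Real.exp (-(t * f (realWeight m))) : ℝ) : ℂ) := by
  rw [character_of_exp (ζ := fun j => ((-(t * f (Pi.single j 1)) : ℝ) : ℂ)) m fun j => rfl,
    Complex.ofReal_exp, LinearMap.eq_sum_pi_single]
  congr 1
  push_cast
  rw [Finset.mul_sum, ← Finset.sum_neg_distrib]
  exact Finset.sum_congr rfl fun j _ => by simp only [realWeight]; push_cast; ring

end AlgTorus

namespace UnitaryTorusModule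

variable {r : ℕ} {E : Type*} [NormedAddCommGroup E] [InnerProductSpace ℂ E]
  [FiniteDimensional ℂ E] (ρ : UnitaryTorusModule r E)

theorem momentMap_pairing_eq (v : E) (ξ : Fin r → ℝ) : ∑ j, ρ.momentMap v j * ξ j =
    ∑ m ∈ ρ.wts, (∑ j, realWeight m j * ξ j) * (‖ρ.proj m v‖ ^ 2 / 2) := by
  rw [momentMap_pairing, inner_weightOp_self, Complex.ofReal_re, Finset.sum_div]
  exact Finset.sum_congr rfl fun m _ => by rw [mul_div_assoc]; rfl

theorem momentMap_smul (t : ℝ) (v : E) :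
    ρ.momentMap ((t : ℂ) • v) = t ^ 2 • ρ.momentMap v := by
  simp only [momentMap_eq, map_smul, norm_smul, Finset.smul_sum, smul_smul]
  refine Finset.sum_congr rfl fun m _ => ?_
  congr 1
  rw [mul_pow, Complex.norm_real, Real.norm_eq_abs, sq_abs]
  ring

variable {ρ}

/-- The moment map is homogeneous of degree two, so the whole line through `v` would lie in the
compact fibre over `0`. -/
theorem eq_zero_of_momentMap_eq_zero (hμ : IsProperMap ρ.momentMap) {v : E}
    (hv : ρ.momentMap v = 0) : v = 0 := by
  by_contra hne
  obtain ⟨R, hR⟩ := (hμ.isCompact_preimage (isCompact_singleton (x := 0))).isBounded.exists_norm_le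
  have h1 := hR (((|R| + 1) / ‖v‖ : ℝ) • v) (by
    change ρ.momentMap _ = 0
    rw [← Complex.coe_smul, momentMap_smul, hv, smul_zero])
  have hn : 0 < ‖v‖ := norm_pos_iff.2 hne
  rw [norm_smul, Real.norm_of_nonneg (by positivity), div_mul_cancel₀ _ hn.ne'] at h1
  linarith [le_abs_self R]

theorem proj_zero_of_isProperMap (hμ : IsProperMap ρ.momentMap) : ρ.proj 0 = 0 := by
  ext v
  refine eq_zero_of_momentMap_eq_zero hμ ?_
  rw [momentMap_eq]
  refine Finset.sum_eq_zero fun m _ => ?_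
  rw [proj_proj]
  split_ifs with h
  · subst h; ext; simp
  · simp

/-- By separation it suffices that no nontrivial nonnegative combination of the occurring weights
vanishes. Such a combination is the moment of a vector with the prescribed component norms, and this
vector is zero by properness. -/
theorem exists_pos_weights (hμ : IsProperMap ρ.momentMap) :
    ∃ η : Fin r → ℝ, ∀ m, ρ.proj m ≠ 0 → 0 < ∑ j, realWeight m j * η j := by
  classical
  let s := ρ.wts.filter fun m => ρ.proj m ≠ 0
  obtain ⟨f, -, hf⟩ := exists_functional_pos s realWeight_injective ⊥ (by
    intro c hc hsum
    have hv : ∀ m, ρ.proj m ≠ 0 → ∃ v, ‖ρ.proj m v‖ = 1 := by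
      intro m hm
      obtain ⟨v, hv⟩ := DFunLike.ne_iff.1 hm
      have hv' : ‖ρ.proj m v‖ ≠ 0 := norm_ne_zero_iff.2 hv
      refine ⟨((‖ρ.proj m v‖⁻¹ : ℝ) : ℂ) • v, ?_⟩
      rw [map_smul, norm_smul, Complex.norm_real, norm_inv, norm_norm, inv_mul_cancel₀ hv']
    choose! v hv using hv
    -- The square root of `2 * c m` compensates the factor `1 / 2` in the moment map.
    set w := ∑ m ∈ s, ((√(2 * c m) : ℝ) : ℂ) • ρ.proj m (v m) with hw
    have hpw : ∀ m ∈ s, ρ.proj m w = ((√(2 * c m) : ℝ) : ℂ) • ρ.proj m (v m) := by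
      intro m hm
      simp only [hw, map_sum, map_smul, proj_proj, smul_ite, smul_zero]
      rw [Finset.sum_ite_eq, if_pos hm]
    have hpn : ∀ m ∈ s, ‖ρ.proj m w‖ ^ 2 = 2 * c m := by
      intro m hm
      rw [hpw m hm, norm_smul, hv m (Finset.mem_filter.1 hm).2, Complex.norm_real, mul_one,
        Real.norm_eq_abs, sq_abs, Real.sq_sqrt (by linarith [hc m hm])]
    have h0 : w = 0 := by
      refine eq_zero_of_momentMap_eq_zero hμ ?_
      rw [momentMap_eq, ← (Submodule.mem_bot ℝ).1 hsum]
      refine (Finset.sum_subset_zero_on_sdiff (Finset.filter_subset _ _) ?_ ?_).symm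
      · intro m hm
        have : ρ.proj m = 0 := by
          simpa [s, (Finset.mem_sdiff.1 hm).1] using (Finset.mem_sdiff.1 hm).2
        simp [this]
      · intro m hm
        rw [hpn m hm]
        congr 1
        ring
    intro m hm
    have := hpn m hm
    rw [h0, map_zero, norm_zero] at this
    linarith)
  refine ⟨fun j => f (Pi.single j 1), fun m hm => ?_⟩
  rw [← LinearMap.eq_sum_pi_single]
  refine hf m (Finset.mem_filter.2 ⟨?_, hm⟩)
  by_contra h
  exact hm (ρ.proj_of_notMem h)

/-- The orthogonal projection onto the sum of the weight spaces with weights in a cone. -/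
def coneProj (ρ : UnitaryTorusModule r E) (F : PointedCone ℝ (Fin r → ℝ)) : E →L[ℂ] E :=
  open Classical in ∑ m ∈ ρ.wts, if realWeight m ∈ F then ρ.proj m else 0

open Classical in
theorem coneProj_apply (F : PointedCone ℝ (Fin r → ℝ)) (v : E) : ρ.coneProj F v =
    ∑ m ∈ ρ.wts, if realWeight m ∈ F then ρ.proj m v else 0 := by
  simp only [coneProj, sum_apply]
  exact Finset.sum_congr rfl fun m _ => by split_ifs <;> rfl

theorem inner_coneProj_left (F : PointedCone ℝ (Fin r → ℝ)) (v w : E) :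
    inner ℂ (ρ.coneProj F v) w = inner ℂ v (ρ.coneProj F w) := by
  classical
  simp only [coneProj_apply, sum_inner, inner_sum]
  refine Finset.sum_congr rfl fun m _ => ?_
  split_ifs
  · exact ρ.inner_proj_left m v w
  · simp

theorem coneProj_eq_self {F : PointedCone ℝ (Fin r → ℝ)} {v : E}
    (h : ∀ m, ρ.proj m v ≠ 0 → realWeight m ∈ F) : ρ.coneProj F v = v := by
  classical
  rw [coneProj_apply]
  conv_rhs => rw [← ρ.sum_proj v]
  refine Finset.sum_congr rfl fun m _ => ?_
  split_ifs with hm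
  · rfl
  · by_contra hne
    exact hm (h m (Ne.symm hne))

theorem proj_coneProj (F : PointedCone ℝ (Fin r → ℝ)) {m : Fin r → ℤ} {v : E}
    (h : ρ.proj m (ρ.coneProj F v) ≠ 0) : realWeight m ∈ F := by
  classical
  by_contra hm
  refine h ?_
  rw [coneProj_apply, map_sum]
  refine Finset.sum_eq_zero fun n _ => ?_
  split_ifs with hn
  · rw [proj_proj, if_neg]
    rintro rfl
    exact hm hn
  · simp

theorem exists_norm_sq_le {X : Type*} (ρ : UnitaryTorusModule r E) (i : X → E) (η : Fin r → ℝ)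
    (hη : ∀ m x, ρ.proj m (i x) ≠ 0 → 0 < ∑ j, realWeight m j * η j) :
    ∃ c > 0, ∀ x, c * ‖i x‖ ^ 2 ≤ ∑ j, ρ.momentMap (i x) j * η j := by
  classical
  obtain ⟨c, hc, hcm⟩ : ∃ c > 0, ∀ m ∈ ρ.wts, 0 < ∑ j, realWeight m j * η j →
      c ≤ ∑ j, realWeight m j * η j := by
    have h : ∀ s : Finset (Fin r → ℤ), ∃ c > 0, ∀ m ∈ s, 0 < ∑ j, realWeight m j * η j →
        c ≤ ∑ j, realWeight m j * η j := by
      intro s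
      induction s using Finset.induction_on with
      | empty => exact ⟨1, one_pos, by simp⟩
      | insert a s _ ih =>
        obtain ⟨c, hc, h⟩ := ih
        by_cases ha : 0 < ∑ j, realWeight a j * η j
        · refine ⟨min c (∑ j, realWeight a j * η j), lt_min hc ha, fun m hm h0 => ?_⟩
          rcases Finset.mem_insert.1 hm with rfl | hm
          · exact min_le_right _ _
          · exact (min_le_left _ _).trans (h m hm h0)
        · refine ⟨c, hc, fun m hm h0 => ?_⟩
          rcases Finset.mem_insert.1 hm with rfl | hm
          · exact absurd h0 ha
          · exact h m hm h0
    exact h ρ.wts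
  refine ⟨c / 2, half_pos hc, fun x => ?_⟩
  rw [ρ.momentMap_pairing_eq, ← ρ.sum_norm_proj_sq, Finset.mul_sum]
  refine Finset.sum_le_sum fun m hm => ?_
  by_cases h0 : ρ.proj m (i x) = 0
  · simp [h0]
  · have h1 := hcm m hm (hη m x h0)
    have h2 : 0 ≤ ‖ρ.proj m (i x)‖ ^ 2 / 2 := by positivity
    nlinarith

end UnitaryTorusModule

namespace IsClosedEquivariantEmbedding

variable {r : ℕ} {X : Type*} [MulAction (AlgTorus r) X] {V : AffineVariety X}
  {E : Type*} [NormedAddCommGroup E] [InnerProductSpace ℂ E] {ρ : UnitaryTorusModule r E}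
  {E' : Type*} [NormedAddCommGroup E'] [InnerProductSpace ℂ E'] {ρ' : UnitaryTorusModule r E'}
  {i : X → E} {i' : X → E'}

theorem isEmbedding (hi : IsClosedEquivariantEmbedding V ρ i) : V.IsEmbedding i :=
  hi.closedEmbedding

variable [FiniteDimensional ℂ E] [FiniteDimensional ℂ E']

theorem proj_smul (hi : IsClosedEquivariantEmbedding V ρ i) (m : Fin r → ℤ) (h : AlgTorus r)
    (x : X) : ρ.proj m (i (h • x)) = character m h • ρ.proj m (i x) := by
  rw [hi.equivariant, ρ.proj_rep]

theorem realWeight_mem_weights (hi : IsClosedEquivariantEmbedding V ρ i) {m : Fin r → ℤ} {x : X}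
    (h : ρ.proj m (i x) ≠ 0) : realWeight m ∈ V.weights r := by
  obtain ⟨ℓ, hℓ⟩ : ∃ ℓ : E →ₗ[ℂ] ℂ, ℓ (ρ.proj m (i x)) ≠ 0 := by
    by_contra! hcon
    exact h ((Module.forall_dual_apply_eq_zero_iff ℂ _).1 hcon)
  refine ⟨m, rfl, _, hi.isEmbedding.comp_mem (ℓ ∘ₗ (ρ.proj m).toLinearMap), ?_, fun g y => ?_⟩
  · exact fun h0 => hℓ (congrFun h0 x)
  · simp only [LinearMap.comp_apply, ContinuousLinearMap.coe_coe]
    rw [hi.proj_smul, map_smul, smul_eq_mul]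

theorem realWeight_mem_weightCone (hi : IsClosedEquivariantEmbedding V ρ i) {m : Fin r → ℤ} {x : X}
    (h : ρ.proj m (i x) ≠ 0) : realWeight m ∈ V.weightCone r :=
  Submodule.subset_span (hi.realWeight_mem_weights h)

/-- Along an orbit, a linear coordinate is a combination of characters that occur in the embedding,
and weights add under products; linear coordinates generate `ℂ[X]`. -/
theorem orbit_mem_span (hi : IsClosedEquivariantEmbedding V ρ i) {f : X → ℂ} (hf : f ∈ V.coord)
    (x : X) : (fun h : AlgTorus r => f (h • x)) ∈ Submodule.span ℂ
      (character '' (AddSubmonoid.closure {m | ∃ y, ρ.proj m (i y) ≠ 0} : Set (Fin r → ℤ))) := by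
  rw [← hi.closedEmbedding] at hf
  induction hf using Algebra.adjoin_induction with
  | mem f hf =>
    obtain ⟨ℓ, rfl⟩ := hf
    have : (fun h : AlgTorus r => ℓ (i (h • x))) =
        ∑ m ∈ ρ.wts, ℓ (ρ.proj m (i x)) • character m := by
      ext h
      simp [hi.equivariant, ρ.rep_eq h, mul_comm]
    rw [this]
    refine Submodule.sum_mem _ fun m _ => ?_
    by_cases hm : ρ.proj m (i x) = 0
    · simp [hm]
    · exact Submodule.smul_mem _ _
        (Submodule.subset_span ⟨m, AddSubmonoid.subset_closure ⟨x, hm⟩, rfl⟩)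
  | algebraMap c =>
    have : (fun h : AlgTorus r => algebraMap ℂ (X → ℂ) c (h • x)) = c • character 0 := by
      ext h; simp [character_zero]
    rw [this]
    exact Submodule.smul_mem _ _ (Submodule.subset_span ⟨0, zero_mem _, rfl⟩)
  | add f g _ _ hf hg => exact add_mem hf hg
  | mul f g _ _ hf hg =>
    have := Submodule.mul_mem_mul hf hg
    rw [Submodule.span_mul_span] at this
    refine Submodule.span_mono ?_ this
    rintro _ ⟨_, ⟨m, hm, rfl⟩, _, ⟨n, hn, rfl⟩, rfl⟩
    exact ⟨m + n, add_mem hm hn, by ext h; exact character_add m n h⟩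

/-- Every weight of `ℂ[X]` is a sum of weights that occur in the embedding. -/
theorem mem_closure_of_realWeight_mem (hi : IsClosedEquivariantEmbedding V ρ i) {m : Fin r → ℤ}
    (hm : realWeight m ∈ V.weights r) :
    m ∈ AddSubmonoid.closure {m | ∃ y, ρ.proj m (i y) ≠ 0} := by
  obtain ⟨n, hn, f, hf, hf0, hfw⟩ := hm
  obtain rfl : m = n := realWeight_injective hn
  obtain ⟨x, hx⟩ := Function.ne_iff.1 hf0
  by_contra hcon
  -- On the orbit of `x`, the weight function `f` is a nonzero multiple of the character `m`, which
  -- would then lie in the span of other characters.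
  refine linearIndependent_character.notMem_span_image hcon ?_
  have h1 := hi.orbit_mem_span hf x
  have h2 : (fun h : AlgTorus r => f (h • x)) = f x • character m := by
    ext h; simp [hfw, mul_comm]
  rw [h2] at h1
  exact (Submodule.smul_mem_iff _ hx).1 h1

/-- A point is fixed by the face torus when the torus acts trivially on all its weight components,
that is, when their weights lie in the span of the face. Since they also lie in the cone, they lie
in the face. -/
theorem mem_closedPiece_iff (hi : IsClosedEquivariantEmbedding V ρ i) (F : V.Face r) (x : X) :
    x ∈ V.closedPiece F ↔ ∀ m, ρ.proj m (i x) ≠ 0 → realWeight m ∈ F.1 := by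
  constructor
  · intro hx m hm
    refine F.2.mem_of_mem_span (hi.realWeight_mem_weightCone hm) ?_
    by_contra hcon
    obtain ⟨f, hf, hFf⟩ := Submodule.exists_le_ker_of_notMem hcon
    -- `f` vanishes on the face, so its one-parameter group lies in the face torus and fixes `x`.
    -- The derivative at `t = 0` then contradicts `f (realWeight m) ≠ 0`.
    have key : ∀ t : ℝ, Complex.exp (t * (Complex.I * f (realWeight m))) = 1 := by
      intro t
      have h1 := hx (CompactTorus.exp fun j => t * f (Pi.single j 1)).incl
        ⟨fun j => ((t * f (Pi.single j 1) : ℝ) : ℂ), fun l hl => by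
          have : f l = 0 := hFf (Submodule.subset_span hl)
          rw [LinearMap.eq_sum_pi_single] at this
          rw [← Complex.ofReal_zero, ← mul_zero t, ← this, Finset.mul_sum]
          push_cast
          exact Finset.sum_congr rfl fun j _ => by ring, fun j => by
          simp [CompactTorus.incl, CompactTorus.exp, mul_comm]⟩
      have h2 := hi.proj_smul m (CompactTorus.exp fun j => t * f (Pi.single j 1)).incl x
      rw [h1] at h2
      have h3 : character m (CompactTorus.exp fun j => t * f (Pi.single j 1)).incl = 1 := by
        rw [← sub_eq_zero, ← smul_eq_zero_iff_left hm, sub_smul, one_smul, ← h2, sub_self]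
      rw [character_incl_exp] at h3
      rw [← h3, LinearMap.eq_sum_pi_single]
      congr 1
      push_cast
      simp only [Finset.mul_sum]
      exact Finset.sum_congr rfl fun j _ => by simp only [realWeight]; push_cast; ring
    have h1 : HasDerivAt (fun t : ℝ => Complex.exp (t * (Complex.I * f (realWeight m))))
        (Complex.I * f (realWeight m)) 0 := by
      have h2 : HasDerivAt (fun t : ℝ => (t : ℂ) * (Complex.I * f (realWeight m)))
          (Complex.I * f (realWeight m)) 0 := by
        simpa using (Complex.ofRealCLM.hasDerivAt (x := (0 : ℝ))).mul_const
          (Complex.I * (f (realWeight m) : ℂ))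
      simpa using h2.cexp
    simp only [key] at h1
    have h2 := h1.unique (hasDerivAt_const _ _)
    simp at h2
    exact hf h2
  · rintro hx h ⟨ζ, hζ, hh⟩
    refine hi.isEmbedding.injective ?_
    rw [hi.equivariant, ρ.rep_eq]
    conv_rhs => rw [← ρ.sum_proj (i x)]
    refine Finset.sum_congr rfl fun m _ => ?_
    by_cases hm : ρ.proj m (i x) = 0
    · simp [hm]
    · rw [character_of_exp m hh]
      have h1 := hζ _ (hx m hm)
      have h2 : ∑ j, (m j : ℂ) * (Complex.I * ζ j) = 0 := by
        rw [← mul_zero Complex.I, ← h1, Finset.mul_sum]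
        exact Finset.sum_congr rfl fun j _ => by simp only [realWeight]; push_cast; ring
      rw [h2, Complex.exp_zero, one_smul]

theorem momentMap_mem_weightCone (hi : IsClosedEquivariantEmbedding V ρ i) (x : X) :
    ρ.momentMap (i x) ∈ V.weightCone r := by
  rw [ρ.momentMap_eq]
  refine Submodule.sum_mem _ fun m _ => ?_
  by_cases hm : ρ.proj m (i x) = 0
  · simp [hm]
  · exact PointedCone.smul_mem _ (by positivity) (hi.realWeight_mem_weightCone hm)

/-- The moment is a combination, with positive coefficients, of exactly the weights that occur at
`x`. A face contains such a sum only if it contains every term. -/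
theorem momentMap_mem_iff (hi : IsClosedEquivariantEmbedding V ρ i) (F : V.Face r) (x : X) :
    ρ.momentMap (i x) ∈ F.1 ↔ x ∈ V.closedPiece F := by
  rw [hi.mem_closedPiece_iff, ρ.momentMap_eq]
  constructor
  · intro h m hm
    have hmw : m ∈ ρ.wts := by
      by_contra hn
      exact hm (by rw [ρ.proj_of_notMem hn]; rfl)
    classical
    rw [← Finset.add_sum_erase _ _ hmw] at h
    refine F.2.mem_of_smul_add_mem (hi.realWeight_mem_weightCone hm)
      (Submodule.sum_mem _ fun n _ => ?_) (?_ : 0 < ‖ρ.proj m (i x)‖ ^ 2 / 2) h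
    · by_cases hn : ρ.proj n (i x) = 0
      · simp [hn]
      · exact PointedCone.smul_mem _ (by positivity) (hi.realWeight_mem_weightCone hn)
    · have := norm_pos_iff.2 hm
      positivity
  · intro h
    refine Submodule.sum_mem _ fun m _ => ?_
    by_cases hm : ρ.proj m (i x) = 0
    · simp [hm]
    · exact PointedCone.smul_mem _ (by positivity) (h m hm)

theorem smul_mem_closedPiece (hi : IsClosedEquivariantEmbedding V ρ i) (F : V.Face r)
    (h : AlgTorus r) {x : X} (hx : x ∈ V.closedPiece F) : h • x ∈ V.closedPiece F := by
  rw [hi.mem_closedPiece_iff] at hx ⊢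
  intro m hm
  rw [hi.proj_smul] at hm
  exact hx m (right_ne_zero_of_smul hm)

theorem smul_mem_piece_iff (hi : IsClosedEquivariantEmbedding V ρ i) (F : V.Face r)
    (h : AlgTorus r) {x : X} : h • x ∈ V.piece F ↔ x ∈ V.piece F := by
  have key : ∀ G : V.Face r, h • x ∈ V.closedPiece G ↔ x ∈ V.closedPiece G := fun G =>
    ⟨fun hx => by simpa using hi.smul_mem_closedPiece G h⁻¹ hx, hi.smul_mem_closedPiece G h⟩
  simp only [AffineVariety.piece, Set.mem_sdiff, Set.mem_iUnion, key]

/-- A one-parameter subgroup that is positive on all weights that occur in one of two embeddings. -/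
theorem exists_pos (hi : IsClosedEquivariantEmbedding V ρ i)
    (hi' : IsClosedEquivariantEmbedding V ρ' i') (hμ : IsProperMap ρ.momentMap)
    (hμ' : IsProperMap ρ'.momentMap) : ∃ η : Fin r → ℝ,
      (∀ m x, ρ.proj m (i x) ≠ 0 → 0 < ∑ j, realWeight m j * η j) ∧
      ∀ m x, ρ'.proj m (i' x) ≠ 0 → 0 < ∑ j, realWeight m j * η j := by
  obtain ⟨η, hη⟩ := UnitaryTorusModule.exists_pos_weights hμ
  have hη' : ∀ m x, ρ.proj m (i x) ≠ 0 → 0 < ∑ j, realWeight m j * η j := fun m x hm =>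
    hη m fun h => hm (by rw [h]; rfl)
  refine ⟨η, hη', fun m x hm => ?_⟩
  have h0 : m ≠ 0 := by
    rintro rfl
    exact hm (by rw [UnitaryTorusModule.proj_zero_of_isProperMap hμ']; rfl)
  -- Weights of the second embedding are sums of weights of the first, so positivity passes to them
  -- except for the empty sum, which properness of `μ'` excludes.
  have h1 : m = 0 ∨ 0 < ∑ j, realWeight m j * η j := by
    have := hi.mem_closure_of_realWeight_mem (hi'.realWeight_mem_weights hm)
    clear hm h0
    induction this using AddSubmonoid.closure_induction with
    | mem m hm => exact Or.inr (hη' m _ hm.choose_spec)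
    | zero => exact Or.inl rfl
    | add a b _ _ ha hb =>
      have : ∑ j, realWeight (a + b) j * η j =
          ∑ j, realWeight a j * η j + ∑ j, realWeight b j * η j := by
        rw [← Finset.sum_add_distrib]
        exact Finset.sum_congr rfl fun j _ => by simp [realWeight]; ring
      rw [this]
      rcases ha with rfl | ha
      · rcases hb with rfl | hb
        · exact Or.inl (add_zero _)
        · right; simpa [realWeight] using hb
      · rcases hb with rfl | hb
        · right; simpa [realWeight] using ha
        · exact Or.inr (add_pos ha hb)
  exact h1.resolve_left h0

theorem tendsto_realExp (hi : IsClosedEquivariantEmbedding V ρ i) {F : PointedCone ℝ (Fin r → ℝ)}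
    {f : (Fin r → ℝ) →ₗ[ℝ] ℝ} (hF : ∀ l ∈ F, f l = 0) {x : X}
    (hf : ∀ m, ρ.proj m (i x) ≠ 0 → realWeight m ∉ F → 0 < f (realWeight m)) :
    Tendsto (fun t => i (realExp f t • x)) atTop (𝓝 (ρ.coneProj F (i x))) := by
  classical
  simp only [hi.equivariant, ρ.rep_eq, ρ.coneProj_apply]
  refine tendsto_finsetSum _ fun m _ => ?_
  by_cases hm : ρ.proj m (i x) = 0
  · simp [hm]
  simp only [character_realExp]
  split_ifs with hmF
  · simp [hF _ hmF]
  · have h1 : Tendsto (fun t => Real.exp (-(t * f (realWeight m)))) atTop (𝓝 0) :=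
      Real.tendsto_exp_neg_atTop_nhds_zero.comp
        (tendsto_id.atTop_mul_const (hf m hm hmF))
    have h2 : Tendsto (fun t => ((Real.exp (-(t * f (realWeight m))) : ℝ) : ℂ)) atTop (𝓝 0) := by
      have := (Complex.continuous_ofReal.tendsto 0).comp h1
      simpa [Function.comp_def] using this
    simpa using h2.smul_const (ρ.proj m (i x))

/-- A functional that vanishes on the face and is positive on the other weights of `x` gives a
one-parameter subgroup contracting `x` to the projected point. The limit is taken in `E × E'`, where
the image of `X` is closed, so one `y` serves both embeddings. -/
theorem exists_eq_coneProj (hi : IsClosedEquivariantEmbedding V ρ i)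
    (hi' : IsClosedEquivariantEmbedding V ρ' i') (F : V.Face r) (x : X) :
    ∃ y ∈ V.closedPiece F, i y = ρ.coneProj F.1 (i x) ∧ i' y = ρ'.coneProj F.1 (i' x) := by
  classical
  let s := (ρ.wts ∪ ρ'.wts).filter fun m =>
    (ρ.proj m (i x) ≠ 0 ∨ ρ'.proj m (i' x) ≠ 0) ∧ realWeight m ∉ F.1
  have hs : ∀ m ∈ s, realWeight m ∈ V.weightCone r := by
    intro m hm
    rcases (Finset.mem_filter.1 hm).2.1 with h | h
    · exact hi.realWeight_mem_weightCone h
    · exact hi'.realWeight_mem_weightCone h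
  obtain ⟨f, hf0, hf⟩ := exists_functional_pos s realWeight_injective
    (Submodule.span ℝ (F.1 : Set (Fin r → ℝ))) (by
      intro c hc hsum k hk
      have hmem : ∀ t ⊆ s, ∑ k ∈ t, c k • realWeight k ∈ V.weightCone r := fun t ht =>
        Submodule.sum_mem _ fun k hk => PointedCone.smul_mem _ (hc k (ht hk)) (hs k (ht hk))
      have h1 := F.2.mem_of_mem_span (hmem s subset_rfl) hsum
      by_contra hne
      rw [← Finset.add_sum_erase _ _ hk] at h1
      exact (Finset.mem_filter.1 hk).2.2 (F.2.mem_of_smul_add_mem (hs k hk)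
        (hmem _ (Finset.erase_subset _ _)) (lt_of_le_of_ne (hc k hk) (Ne.symm hne)) h1))
  have hF : ∀ l ∈ F.1, f l = 0 := fun l hl => hf0 l (Submodule.subset_span hl)
  have h1 := hi.tendsto_realExp hF (x := x) fun m hm hmF => hf m (Finset.mem_filter.2
    ⟨Finset.mem_union_left _ (by_contra fun h => hm (by rw [ρ.proj_of_notMem h]; rfl)),
      Or.inl hm, hmF⟩)
  have h2 := hi'.tendsto_realExp hF (x := x) fun m hm hmF => hf m (Finset.mem_filter.2
    ⟨Finset.mem_union_right _ (by_contra fun h => hm (by rw [ρ'.proj_of_notMem h]; rfl)),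
      Or.inr hm, hmF⟩)
  obtain ⟨y, hy⟩ := (hi.isEmbedding.prodMk hi'.isEmbedding).isClosed_range.mem_of_tendsto
    (h1.prodMk_nhds h2) (Eventually.of_forall fun t => ⟨_, rfl⟩)
  have hy1 : i y = ρ.coneProj F.1 (i x) := congrArg Prod.fst hy
  refine ⟨y, (hi.mem_closedPiece_iff F y).2 fun m hm => ?_, hy1, congrArg Prod.snd hy⟩
  rw [hy1] at hm
  exact ρ.proj_coneProj F.1 hm

theorem coneProj_eq (hi : IsClosedEquivariantEmbedding V ρ i) {F : V.Face r} {x : X}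
    (hx : x ∈ V.closedPiece F) : ρ.coneProj F.1 (i x) = i x :=
  ρ.coneProj_eq_self ((hi.mem_closedPiece_iff F x).1 hx)

/-- The closed piece that contains a point is determined by the values of the moment maps. -/
theorem moment_interpolation_mem_iff (hi : IsClosedEquivariantEmbedding V ρ i)
    (hi' : IsClosedEquivariantEmbedding V ρ' i') (F : V.Face r) (x : X) {a : ℝ}
    (ha : a ∈ Set.Icc (0 : ℝ) 1) :
    (1 - a) • ρ.momentMap (i x) + a • ρ'.momentMap (i' x) ∈ F.1 ↔ x ∈ V.closedPiece F := by
  constructor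
  · intro h
    rcases ha.2.lt_or_eq with h1 | rfl
    · rw [← hi.momentMap_mem_iff]
      exact F.2.mem_of_smul_add_mem (hi.momentMap_mem_weightCone x)
        (PointedCone.smul_mem _ ha.1 (hi'.momentMap_mem_weightCone x)) (sub_pos.2 h1) h
    · rw [← hi'.momentMap_mem_iff]
      simpa using h
  · intro h
    exact add_mem (PointedCone.smul_mem _ (sub_nonneg.2 ha.2) ((hi.momentMap_mem_iff F x).2 h))
      (PointedCone.smul_mem _ ha.1 ((hi'.momentMap_mem_iff F x).2 h))

/-- The common value lies in the face `F ⊓ G`, so both points lie in its closed piece. A point of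
the open piece of a face lies in no closed piece of a proper subface. -/
theorem face_eq_of_moment_eq (hi : IsClosedEquivariantEmbedding V ρ i)
    (hi' : IsClosedEquivariantEmbedding V ρ' i') {F G : V.Face r} {x y : X}
    (hx : x ∈ V.piece F) (hy : y ∈ V.piece G) {a b : ℝ} (ha : a ∈ Set.Icc (0 : ℝ) 1)
    (hb : b ∈ Set.Icc (0 : ℝ) 1)
    (h : (1 - a) • ρ.momentMap (i x) + a • ρ'.momentMap (i' x) =
      (1 - b) • ρ.momentMap (i y) + b • ρ'.momentMap (i' y)) : F = G := by
  have hxF := (hi.moment_interpolation_mem_iff hi' F x ha).2 hx.1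
  have hyG := (hi.moment_interpolation_mem_iff hi' G y hb).2 hy.1
  let K : V.Face r := ⟨F.1 ⊓ G.1, F.2.inf_left G.2⟩
  have hxK : x ∈ V.closedPiece K := (hi.moment_interpolation_mem_iff hi' K x ha).1
    ⟨hxF, by rw [h]; exact hyG⟩
  have hyK : y ∈ V.closedPiece K := (hi.moment_interpolation_mem_iff hi' K y hb).1
    ⟨by rw [← h]; exact hxF, hyG⟩
  have hKF : K ≤ F := (inf_le_left : F.1 ⊓ G.1 ≤ F.1)
  have hKG : K ≤ G := (inf_le_right : F.1 ⊓ G.1 ≤ G.1)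
  have h1 : K = F := by
    by_contra hne
    exact hx.2 (Set.mem_iUnion₂.2 ⟨K, lt_of_le_of_ne hKF hne, hxK⟩)
  have h2 : K = G := by
    by_contra hne
    exact hy.2 (Set.mem_iUnion₂.2 ⟨K, lt_of_le_of_ne hKG hne, hyK⟩)
  exact h1.symm.trans h2

end IsClosedEquivariantEmbedding

/-! ### Smooth local rings and equations -/

/-- First order Taylor expansion of a polynomial at a point of square zero difference. -/
theorem MvPolynomial.algHom_eq_add_pderiv {k σ B : Type*} [Field k] [Fintype σ] [CommRing B]
    [Algebra k B] (q t : MvPolynomial σ k →ₐ[k] B)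
    (h : ∀ a b, (q (X a) - t (X a)) * (q (X b) - t (X b)) = 0) (f : MvPolynomial σ k) :
    q f = t f + ∑ a, t (pderiv a f) * (q (X a) - t (X a)) := by
  classical
  induction f using MvPolynomial.induction_on with
  | C c =>
    have : (C c : MvPolynomial σ k) = algebraMap k _ c := rfl
    rw [this, AlgHom.commutes, AlgHom.commutes]
    simp
  | add f g hf hg =>
    simp only [map_add, add_mul, Finset.sum_add_distrib]
    rw [hf, hg]
    ring
  | mul_X f b hf =>
    have h1 : ∑ a, t (pderiv a (f * X b)) * (q (X a) - t (X a)) =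
        t (X b) * (∑ a, t (pderiv a f) * (q (X a) - t (X a))) + t f * (q (X b) - t (X b)) := by
      simp only [Derivation.leibniz, pderiv_X, smul_eq_mul, map_add, map_mul, add_mul,
        Finset.sum_add_distrib]
      rw [add_comm, Finset.mul_sum]
      congr 1
      · exact Finset.sum_congr rfl fun a _ => by ring
      · rw [Finset.sum_eq_single b]
        · simp
        · intro a _ hab
          simp [Pi.single_eq_of_ne hab.symm]
        · simp
    have h2 : (∑ a, t (pderiv a f) * (q (X a) - t (X a))) * (q (X b) - t (X b)) = 0 := by
      rw [Finset.sum_mul]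
      exact Finset.sum_eq_zero fun a _ => by rw [mul_assoc, h, mul_zero]
    rw [h1, map_mul, map_mul, hf]
    linear_combination h2

/-- With `I` the kernel of `φ`, the kernel of `P ⧸ m I P → C` has square zero because `I ≤ m`, so
formal smoothness splits this map. Taylor's formula compares `f` in the quotient with its image
under the splitting, which is zero. The first order terms vanish too: the partial derivatives lie in
`m`, and `m` annihilates the kernel. -/
theorem exists_mul_mem_of_isLocalization {k σ A P C : Type*} [Field k] [Fintype σ] [CommRing A]
    [Algebra k A] (φ : MvPolynomial σ k →ₐ[k] A) (hφ : Function.Surjective φ) (p : Ideal A)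
    [p.IsPrime] [CommRing C] [Algebra A C] [Algebra k C] [IsScalarTower k A C]
    [IsLocalization.AtPrime C p] [Algebra.FormallySmooth k C] (m : Ideal (MvPolynomial σ k))
    [m.IsPrime] (hm : ∀ a, a ∈ m ↔ φ a ∈ p) [CommRing P] [Algebra (MvPolynomial σ k) P]
    [Algebra k P] [IsScalarTower k (MvPolynomial σ k) P] [IsLocalization.AtPrime P m]
    (g₀ : P →ₐ[k] C) (hg₀ : ∀ a, g₀ (algebraMap _ P a) = algebraMap A C (φ a))
    {f : MvPolynomial σ k} (hf : φ f = 0) (hd : ∀ a, φ (MvPolynomial.pderiv a f) ∈ p) :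
    ∃ u, φ u ∉ p ∧ u * f ∈ m * RingHom.ker φ := by
  let I : Ideal (MvPolynomial σ k) := RingHom.ker φ
  have hIm : I ≤ m := fun a ha => by
    rw [hm, (RingHom.mem_ker).1 ha]
    exact p.zero_mem
  let J : Ideal P := (m * I).map (algebraMap _ P)
  have hkerle : RingHom.ker g₀ ≤ I.map (algebraMap _ P) := by
    intro x hx
    obtain ⟨⟨a, s⟩, hs⟩ := IsLocalization.surj m.primeCompl x
    dsimp only at hs
    have h1 : algebraMap A C (φ a) = 0 := by
      rw [← hg₀, ← hs, map_mul, (RingHom.mem_ker).1 hx, zero_mul]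
    obtain ⟨v, hv⟩ := (IsLocalization.map_eq_zero_iff p.primeCompl _ _).1 h1
    obtain ⟨w, hw⟩ := hφ v
    have hwm : w ∈ m.primeCompl := fun h => v.2 (by rw [← hw]; exact (hm w).1 h)
    have h2 : w * a ∈ I := by
      change φ (w * a) = 0
      rw [map_mul, hw, hv]
    have h3 := Ideal.mem_map_of_mem (algebraMap _ P) h2
    rw [map_mul, ← hs] at h3
    have hu1 := IsLocalization.map_units P (⟨w, hwm⟩ : m.primeCompl)
    have hu2 := IsLocalization.map_units P s
    rw [mul_comm x, ← mul_assoc] at h3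
    exact (Ideal.unit_mul_mem_iff_mem _ (hu1.mul hu2)).1 h3
  have hJ : ∀ a ∈ J, g₀ a = 0 := by
    have : J ≤ RingHom.ker g₀ := by
      refine Ideal.map_le_iff_le_comap.2 fun a ha => ?_
      change g₀ (algebraMap _ P a) = 0
      have h1 : φ a = 0 := (Ideal.mul_le_right : m * I ≤ I) ha
      rw [hg₀, h1, map_zero]
    exact fun a ha => this ha
  let g : (P ⧸ J) →ₐ[k] C := Ideal.Quotient.liftₐ J g₀ hJ
  have hgq : ∀ a, g (Ideal.Quotient.mk J a) = g₀ a := fun a => rfl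
  have hgs : Function.Surjective g := by
    intro y
    obtain ⟨⟨a, s⟩, hs⟩ := IsLocalization.surj p.primeCompl y
    dsimp only at hs
    obtain ⟨b, rfl⟩ := hφ a
    obtain ⟨v, hv⟩ := hφ s
    have hvm : v ∈ m.primeCompl := fun h => s.2 (by rw [← hv]; exact (hm v).1 h)
    refine ⟨Ideal.Quotient.mk J (IsLocalization.mk' P b (⟨v, hvm⟩ : m.primeCompl)), ?_⟩
    rw [hgq]
    refine (IsLocalization.map_units (C) s).mul_right_cancel ?_
    rw [hs, ← hv, ← hg₀, ← hg₀, ← map_mul]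
    congr 1
    exact IsLocalization.mk'_spec P b (⟨v, hvm⟩ : m.primeCompl)
  have hK : ∀ x, g x = 0 → ∃ y ∈ I.map (algebraMap _ P), Ideal.Quotient.mk J y = x := by
    intro x hx
    obtain ⟨y, rfl⟩ := Ideal.Quotient.mk_surjective x
    exact ⟨y, hkerle hx, rfl⟩
  have hmK : ∀ a ∈ m.map (algebraMap _ P), ∀ x, g x = 0 → Ideal.Quotient.mk J a * x = 0 := by
    intro a ha x hx
    obtain ⟨y, hy, rfl⟩ := hK x hx
    rw [← map_mul, Ideal.Quotient.eq_zero_iff_mem]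
    change a * y ∈ Ideal.map _ (m * I)
    rw [Ideal.map_mul]
    exact Ideal.mul_mem_mul ha hy
  have hKK : ∀ x y, g x = 0 → g y = 0 → x * y = 0 := by
    intro x y hx hy
    obtain ⟨a, ha, rfl⟩ := hK x hx
    exact hmK a (Ideal.map_mono hIm ha) y hy
  have hnil : IsNilpotent (RingHom.ker (g : (P ⧸ J) →+* C)) := by
    refine ⟨2, ?_⟩
    rw [pow_two, Submodule.zero_eq_bot, eq_bot_iff, Ideal.mul_le]
    intro x hx y hy
    exact hKK x y hx hy
  let s : C →ₐ[k] (P ⧸ J) :=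
    Algebra.FormallySmooth.liftOfSurjective (AlgHom.id k _) g hgs hnil
  have hs : ∀ a, g (s a) = a := fun a =>
    Algebra.FormallySmooth.liftOfSurjective_apply (AlgHom.id k _) g hgs hnil a
  let q : MvPolynomial σ k →ₐ[k] (P ⧸ J) :=
    (Ideal.Quotient.mkₐ k J).comp (IsScalarTower.toAlgHom k (MvPolynomial σ k) P)
  have hq : ∀ a, q a = Ideal.Quotient.mk J (algebraMap _ P a) := fun a => rfl
  let t : MvPolynomial σ k →ₐ[k] (P ⧸ J) :=
    (s.comp (IsScalarTower.toAlgHom k A (C))).comp φ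
  have ht : ∀ a, t a = s (algebraMap _ _ (φ a)) := fun a => rfl
  have hqt : ∀ a, g (q a - t a) = 0 := fun a => by
    rw [map_sub, hq, hgq, hg₀, ht, hs, sub_self]
  have hqf : q f = 0 := by
    rw [MvPolynomial.algHom_eq_add_pderiv q t fun a b => hKK _ _ (hqt _) (hqt _), ht, hf, map_zero,
      map_zero, zero_add]
    refine Finset.sum_eq_zero fun a _ => ?_
    have h1 : t (MvPolynomial.pderiv a f) = q (MvPolynomial.pderiv a f) -
        (q (MvPolynomial.pderiv a f) - t (MvPolynomial.pderiv a f)) := by ring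
    rw [h1, sub_mul, hKK _ _ (hqt _) (hqt _), sub_zero, hq]
    exact hmK _ (Ideal.mem_map_of_mem _ ((hm _).2 (hd a))) _ (hqt _)
  rw [hq, Ideal.Quotient.eq_zero_iff_mem] at hqf
  obtain ⟨⟨b, u⟩, hb⟩ := (IsLocalization.mem_map_algebraMap_iff m.primeCompl P).1 hqf
  dsimp only at hb
  refine ⟨u, fun h => u.2 ((hm _).2 h), ?_⟩
  rw [← map_mul] at hb
  have := IsLocalization.injective P m.primeCompl_le_nonZeroDivisors hb
  rw [mul_comm (u : MvPolynomial σ k), this]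
  exact b.2

/-- A function that vanishes to second order at a smooth point of a subvariety, and vanishes on the
subvariety, lies in the product of the ideals of the point and the subvariety, locally. -/
theorem exists_mul_mem_of_pderiv_mem {k σ A : Type*} [Field k] [Fintype σ] [CommRing A]
    [Algebra k A] (φ : MvPolynomial σ k →ₐ[k] A) (hφ : Function.Surjective φ) (p : Ideal A)
    [p.IsPrime] [Algebra.FormallySmooth k (Localization.AtPrime p)] {f : MvPolynomial σ k}
    (hf : φ f = 0) (hd : ∀ a, φ (MvPolynomial.pderiv a f) ∈ p) :
    ∃ u, φ u ∉ p ∧ u * f ∈ p.comap φ * RingHom.ker φ := by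
  have hm : (p.comap φ).IsPrime := Ideal.IsPrime.comap φ
  exact exists_mul_mem_of_isLocalization (P := Localization.AtPrime (p.comap φ))
    (C := Localization.AtPrime p) φ hφ p (p.comap φ) (fun a => Iff.rfl)
    (Localization.localAlgHom (p.comap φ) p φ rfl)
    (fun a => Localization.localRingHom_to_map (p.comap φ) p φ.toRingHom rfl a) hf hd

/-- Local equations for a subvariety at a smooth point: the ideal is generated, locally, by
functions with linearly independent differentials. -/
theorem exists_local_generators {k σ A : Type*} [Field k] [Fintype σ] [CommRing A]
    [Algebra k A] (φ : MvPolynomial σ k →ₐ[k] A) (hφ : Function.Surjective φ) (p : Ideal A)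
    [p.IsPrime] [Algebra.FormallySmooth k (Localization.AtPrime p)] {D : Type*} [AddCommGroup D]
    [Module k D] [FiniteDimensional k D] (d : MvPolynomial σ k →ₗ[k] D)
    (hd : ∀ f, d f = 0 → ∀ a, φ (MvPolynomial.pderiv a f) ∈ p) :
    ∃ (c : ℕ) (g : Fin c → MvPolynomial σ k), (∀ a, φ (g a) = 0) ∧
      LinearIndependent k (fun a => d (g a)) ∧
      ∃ h, φ h ∉ p ∧ ∀ f, φ f = 0 → h * f ∈ Ideal.span (Set.range g) := by
  let m : Ideal (MvPolynomial σ k) := p.comap φ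
  have hm : m.IsPrime := Ideal.IsPrime.comap φ
  let I : Ideal (MvPolynomial σ k) := RingHom.ker φ
  let T : Submodule k D := (I.restrictScalars k).map d
  let b := Module.finBasis k T
  have hb : ∀ a, ∃ g ∈ I, d g = b a := fun a => (b a).2
  choose g hgI hgb using hb
  have hind : LinearIndependent k (fun a => d (g a)) := by
    simp only [hgb]
    exact b.linearIndependent.map' T.subtype (Submodule.ker_subtype T)
  refine ⟨_, g, hgI, hind, ?_⟩
  let N : Ideal (MvPolynomial σ k) := Ideal.span (Set.range g)
  let P := Localization.AtPrime m
  -- Nakayama's lemma: subtracting from `f ∈ I` the combination `w` of the `g a` with the same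
  -- differential leaves an element that is locally in `m * I`.
  have hle : I.map (algebraMap _ P) ≤ N.map (algebraMap _ P) := by
    refine Submodule.le_of_le_smul_of_le_jacobson_bot (I := m.map (algebraMap _ P))
      (Ideal.FG.map (IsNoetherian.noetherian I) _) ?_ ?_
    · rw [Localization.AtPrime.map_eq_maximalIdeal]
      exact IsLocalRing.maximalIdeal_le_jacobson _
    · refine Ideal.map_le_iff_le_comap.2 fun f hf => ?_
      rw [Ideal.mem_comap]
      have hfT : d f ∈ T := ⟨f, hf, rfl⟩
      let w := ∑ a, b.repr ⟨d f, hfT⟩ a • g a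
      have hwN : w ∈ N := Submodule.sum_mem _ fun a _ => by
        rw [MvPolynomial.smul_eq_C_mul]
        exact N.mul_mem_left _ (Ideal.subset_span ⟨a, rfl⟩)
      have hwI : w ∈ I := Submodule.sum_mem _ fun a _ => by
        rw [MvPolynomial.smul_eq_C_mul]
        exact I.mul_mem_left _ (hgI a)
      have hdw : d (f - w) = 0 := by
        simp only [w, map_sub, map_sum, map_smul, hgb]
        have h1 : d f = ((∑ a, b.repr ⟨d f, hfT⟩ a • b a : T) : D) := by rw [b.sum_repr]
        rw [sub_eq_zero]
        exact h1.trans (by push_cast; rfl)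
      obtain ⟨u, hu, huf⟩ := exists_mul_mem_of_pderiv_mem φ hφ p (f := f - w)
        (I.sub_mem hf hwI) (hd _ hdw)
      have h2 := Ideal.mem_map_of_mem (algebraMap _ P) huf
      rw [map_mul, Ideal.map_mul] at h2
      have h3 := (Ideal.unit_mul_mem_iff_mem _
        (IsLocalization.map_units P (⟨u, hu⟩ : m.primeCompl))).1 h2
      have h4 : algebraMap _ P f = algebraMap _ P w + algebraMap _ P (f - w) := by
        rw [← map_add, add_sub_cancel]
      rw [h4]
      exact Submodule.add_mem_sup (Ideal.mem_map_of_mem _ hwN) h3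
  have hloc : ∀ f ∈ I, ∃ h, φ h ∉ p ∧ h * f ∈ N := by
    intro f hf
    obtain ⟨⟨a, u⟩, ha⟩ := (IsLocalization.mem_map_algebraMap_iff m.primeCompl P).1
      (hle (Ideal.mem_map_of_mem _ hf))
    dsimp only at ha
    rw [← map_mul] at ha
    have := IsLocalization.injective P m.primeCompl_le_nonZeroDivisors ha
    exact ⟨u, u.2, by rw [mul_comm, this]; exact a.2⟩
  obtain ⟨s, hs⟩ : I.FG := IsNoetherian.noetherian I
  have hfin : ∀ t : Finset (MvPolynomial σ k), (t : Set (MvPolynomial σ k)) ⊆ (I : Set _) →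
      ∃ h, φ h ∉ p ∧ ∀ f ∈ t, h * f ∈ N := by
    classical
    intro t
    induction t using Finset.induction_on with
    | empty =>
      exact fun _ => ⟨1, by rw [map_one]; exact (Ideal.ne_top_iff_one p).1 (Ideal.IsPrime.ne_top ‹_›), by simp⟩
    | insert a t _ ih =>
      intro ht
      rw [Finset.coe_insert, Set.insert_subset_iff] at ht
      obtain ⟨h, hh, hht⟩ := ih ht.2
      obtain ⟨h', hh', hha⟩ := hloc a ht.1
      refine ⟨h * h', ?_, fun f hf => ?_⟩
      · rw [map_mul]
        exact fun hmem => (Ideal.IsPrime.mem_or_mem ‹p.IsPrime› hmem).elim hh hh'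
      · rcases Finset.mem_insert.1 hf with rfl | hf
        · rw [mul_assoc]; exact N.mul_mem_left _ hha
        · rw [mul_comm h, mul_assoc]; exact N.mul_mem_left _ (hht f hf)
  obtain ⟨h, hh, hhs⟩ := hfin s (by rw [← hs]; exact Submodule.subset_span)
  have hle : I ≤ Submodule.comap (LinearMap.mulLeft (MvPolynomial σ k) h) N := by
    rw [← hs, Ideal.span, Submodule.span_le]
    exact hhs
  exact ⟨h, hh, fun f hf => hle hf⟩

/-! ### Submanifolds defined by local equations -/

section LocalEquations

variable {W : Type*} [NormedAddCommGroup W] [NormedSpace ℝ W] [FiniteDimensional ℝ W]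

/-- A subset that is defined near a point by equations with linearly independent differentials can
be straightened near that point. -/
theorem exists_isStraightening_of_equations {Y : Type*} [NormedAddCommGroup Y] [NormedSpace ℝ Y]
    [FiniteDimensional ℝ Y] {S : Set W} {p : W} {G : W → Y} {A : W →L[ℝ] Y}
    (hG : ContDiff ℝ ∞ G) (hA : HasFDerivAt G A p) (hs : Function.Surjective A)
    (hS : ∀ᶠ q in 𝓝 p, q ∈ S ↔ G q = 0) :
    ∃ Φ : OpenPartialHomeomorph W W, p ∈ Φ.source ∧ IsStraightening S Φ A.ker ∧
      fderiv ℝ Φ p = ContinuousLinearMap.id ℝ W := by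
  obtain ⟨R, hR⟩ := A.exists_rightInverse_of_surjective (LinearMap.range_eq_top.2 hs)
  have hAR : ∀ y, A (R y) = y := fun y => congrArg (fun B => B y) hR
  -- `A ∘ F = G`, so `F` takes the solutions of `G = 0` to the kernel of `A`; its derivative at `p`
  -- is the identity.
  let F : W → W := fun q => q - R (A q) + R (G q)
  have hF : ContDiff ℝ ∞ F := by fun_prop
  have hAF : ∀ q, A (F q) = G q := fun q => by simp [F, hAR]
  have hFd : HasFDerivAt F (ContinuousLinearMap.id ℝ W) p := by
    have h1 : HasFDerivAt F
        (ContinuousLinearMap.id ℝ W - R ∘L A + R ∘L A) p :=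
      ((hasFDerivAt_id p).sub (R.hasFDerivAt.comp p A.hasFDerivAt)).add (R.hasFDerivAt.comp p hA)
    simpa using h1
  have hn : (∞ : WithTop ℕ∞) ≠ 0 := by simp
  have hFe : HasFDerivAt F ((ContinuousLinearEquiv.refl ℝ W : W ≃L[ℝ] W) : W →L[ℝ] W) p := hFd
  let Φ₀ := hF.contDiffAt.toOpenPartialHomeomorph F hFe hn
  have hp₀ : p ∈ Φ₀.source := hF.contDiffAt.mem_toOpenPartialHomeomorph_source hFe hn
  have hcont : Continuous (fderiv ℝ F) := hF.continuous_fderiv hn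
  let O : Set W := fderiv ℝ F ⁻¹' Set.range ((↑) : (W ≃L[ℝ] W) → W →L[ℝ] W)
  have hO : IsOpen O := (ContinuousLinearEquiv.isOpen).preimage hcont
  obtain ⟨N, hNS, hN, hpN⟩ := eventually_nhds_iff.1 hS
  have hpO : p ∈ O := ⟨ContinuousLinearEquiv.refl ℝ W, by rw [hFd.fderiv]; rfl⟩
  let Φ := Φ₀.restrOpen (O ∩ N) (hO.inter hN)
  have hsrc : Φ.source = Φ₀.source ∩ (O ∩ N) := rfl
  have hΦF : (Φ : W → W) = F := rfl
  refine ⟨Φ, ⟨hp₀, hpO, hpN⟩, ⟨?_, ?_, ?_⟩, hFd.fderiv⟩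
  · exact hF.contDiffOn
  · intro z hz
    have hz' := Φ.map_target hz
    obtain ⟨B, hB⟩ := hz'.2.1
    refine (Φ.contDiffAt_symm hz (f₀' := B) ?_ hF.contDiffAt).contDiffWithinAt
    rw [hB]
    exact ((hF.differentiable hn) _).hasFDerivAt
  · ext q
    refine and_congr_right fun hq => ?_
    rw [hNS q hq.2.2]
    change G q = 0 ↔ A (F q) = 0
    rw [hAF]

end LocalEquations

theorem surjective_pi_of_linearIndependent {k V : Type*} [Field k] [AddCommGroup V] [Module k V]
    {c : ℕ} {g : Fin c → V →ₗ[k] k} (hg : LinearIndependent k g) :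
    Function.Surjective (LinearMap.pi g) := by
  rw [← LinearMap.range_eq_top]
  by_contra hne
  obtain ⟨f, hf, hle⟩ := Submodule.exists_le_ker_of_lt_top _ (lt_top_iff_ne_top.2 hne)
  have hfs : ∀ y, f y = ∑ a, y a * f (Pi.single a 1) := fun y => by
    conv_lhs => rw [← Finset.univ_sum_single y, map_sum]
    refine Finset.sum_congr rfl fun a _ => ?_
    rw [← smul_eq_mul, ← map_smul, ← Pi.single_smul, smul_eq_mul, mul_one]
  have h0 : ∀ a, f (Pi.single a 1) = 0 := by
    refine Fintype.linearIndependent_iff.1 hg (fun a => f (Pi.single a 1)) ?_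
    ext v
    have : f (LinearMap.pi g v) = 0 := hle ⟨v, rfl⟩
    rw [hfs] at this
    simpa [mul_comm] using this
  refine hf ?_
  ext y
  simp [h0]

/-! ### Smooth subvarieties as complex submanifolds -/

namespace AffineVariety

variable {X : Type*} {V : AffineVariety X}

theorem exists_mem_coord_of_isOpen {U : Set X} (hU : IsOpen[V.zariski] U) {x : X} (hx : x ∈ U) :
    ∃ f ∈ V.coord, f x ≠ 0 ∧ ∀ y, f y ≠ 0 → y ∈ U := by
  induction hU with
  | basic s hs =>
    obtain ⟨f, hf, rfl⟩ := hs
    exact ⟨f, hf, hx, fun y hy => hy⟩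
  | univ => exact ⟨1, V.coord.one_mem, one_ne_zero, fun _ _ => trivial⟩
  | inter s t _ _ hs ht =>
    obtain ⟨f, hf, hfx, hfs⟩ := hs hx.1
    obtain ⟨g, hg, hgx, hgt⟩ := ht hx.2
    exact ⟨f * g, V.coord.mul_mem hf hg, mul_ne_zero hfx hgx, fun y hy =>
      ⟨hfs y (left_ne_zero_of_mul hy), hgt y (right_ne_zero_of_mul hy)⟩⟩
  | sUnion T _ ih =>
    obtain ⟨t, ht, hxt⟩ := hx
    obtain ⟨f, hf, hfx, hft⟩ := ih t ht hxt
    exact ⟨f, hf, hfx, fun y hy => ⟨t, ht, hft y hy⟩⟩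

/-- Near one of its points, a locally closed subset is cut out by the regular functions that
vanish on it. -/
theorem exists_of_isLocallyClosed {S : Set X} (hS : @IsLocallyClosed X V.zariski S) {x : X}
    (hx : x ∈ S) : ∃ g ∈ V.coord, g x ≠ 0 ∧
      ∀ y, g y ≠ 0 → (∀ f ∈ V.coord, (∀ s ∈ S, f s = 0) → f y = 0) → y ∈ S := by
  let := V.zariski
  obtain ⟨U, C, hU, hC, rfl⟩ := hS
  obtain ⟨g, hg, hgx, hgU⟩ := V.exists_mem_coord_of_isOpen hU hx.1
  refine ⟨g, hg, hgx, fun y hy hf => ⟨hgU y hy, ?_⟩⟩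
  by_contra hyC
  obtain ⟨f, hfc, hfy, hfC⟩ := V.exists_mem_coord_of_isOpen hC.isOpen_compl hyC
  exact hfy (hf f hfc fun s hs => by
    by_contra hne
    exact hfC s hne hs.2)

namespace IsEmbedding

variable {W : Type*} [NormedAddCommGroup W] [NormedSpace ℂ W] {j : X → W}

/-- The value at `w` of a polynomial in the coordinates of a vector space. -/
def evalPoly {n : ℕ} (b : Module.Basis (Fin n) ℂ W) (w : W) : MvPolynomial (Fin n) ℂ →ₐ[ℂ] ℂ :=
  MvPolynomial.aeval fun k => b.coord k w

/-- The differential at `w` of a polynomial in the coordinates of a vector space. -/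
def diffPoly {n : ℕ} (b : Module.Basis (Fin n) ℂ W) (w : W) :
    MvPolynomial (Fin n) ℂ →ₗ[ℂ] W →ₗ[ℂ] ℂ :=
  ∑ k, ((evalPoly b w).toLinearMap ∘ₗ (MvPolynomial.pderiv k).toLinearMap).smulRight (b.coord k)

theorem diffPoly_apply {n : ℕ} (b : Module.Basis (Fin n) ℂ W) (w : W)
    (f : MvPolynomial (Fin n) ℂ) :
    diffPoly b w f = ∑ k, evalPoly b w (MvPolynomial.pderiv k f) • b.coord k := by
  simp [diffPoly]

theorem evalPoly_pderiv {n : ℕ} (b : Module.Basis (Fin n) ℂ W) (w : W)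
    (f : MvPolynomial (Fin n) ℂ) (k : Fin n) :
    evalPoly b w (MvPolynomial.pderiv k f) = diffPoly b w f (b k) := by
  simp [diffPoly_apply, Finsupp.single_apply]

variable [FiniteDimensional ℂ W]

theorem contDiff_evalPoly {n : ℕ} (b : Module.Basis (Fin n) ℂ W) (f : MvPolynomial (Fin n) ℂ) :
    ContDiff ℂ ∞ fun w => evalPoly b w f := by
  induction f using MvPolynomial.induction_on with
  | C c => simpa [evalPoly] using contDiff_const
  | add f g hf hg => simpa using hf.add hg
  | mul_X f k hf =>
    have : ContDiff ℂ ∞ fun w => b.coord k w :=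
      (LinearMap.toContinuousLinearMap (b.coord k)).contDiff
    simpa [evalPoly] using hf.mul this

theorem hasFDerivAt_evalPoly {n : ℕ} (b : Module.Basis (Fin n) ℂ W) (w : W)
    (f : MvPolynomial (Fin n) ℂ) : HasFDerivAt (fun w => evalPoly b w f)
      (LinearMap.toContinuousLinearMap (diffPoly b w f)) w := by
  induction f using MvPolynomial.induction_on with
  | C c =>
    have h1 : diffPoly b w (MvPolynomial.C c) = 0 := by simp [diffPoly_apply]
    have h2 : (fun w : W => evalPoly b w (MvPolynomial.C c)) = fun _ => c := by
      ext w; simp [evalPoly]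
    rw [h1, h2, map_zero]
    exact hasFDerivAt_const c w
  | add f g hf hg =>
    simp only [map_add]
    exact hf.add hg
  | mul_X f k hf =>
    have h1 : HasFDerivAt (fun w => b.coord k w) (LinearMap.toContinuousLinearMap (b.coord k)) w :=
      (LinearMap.toContinuousLinearMap (b.coord k)).hasFDerivAt
    have h2 := hf.mul h1
    have h3 : (fun w => evalPoly b w (f * MvPolynomial.X k)) =
        fun w => evalPoly b w f * b.coord k w := by
      ext w; simp [evalPoly]
    rw [h3]
    have h4 : diffPoly b w (f * MvPolynomial.X k) =
        evalPoly b w f • b.coord k + b.coord k w • diffPoly b w f := by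
      refine b.ext fun l => ?_
      rw [LinearMap.add_apply, LinearMap.smul_apply, LinearMap.smul_apply, ← evalPoly_pderiv,
        ← evalPoly_pderiv, Derivation.leibniz, MvPolynomial.pderiv_X]
      rcases eq_or_ne l k with rfl | hlk
      · simp [evalPoly]
      · simp [evalPoly, Pi.single_eq_of_ne hlk.symm, Finsupp.single_eq_of_ne hlk.symm]
    refine h2.congr_fderiv ?_
    rw [h4, map_add, map_smul, map_smul]

/-- Near a smooth point, the image of `S` is the zero set of polynomials with independent
differentials. The chart has the identity as derivative at the point, so `L`, the kernel of a
complex linear map, is the tangent space there. -/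
theorem exists_isStraightening [NormedSpace ℝ W] [IsScalarTower ℝ ℂ W] (hj : V.IsEmbedding j)
    {S : Set X} (hS : @IsLocallyClosed X V.zariski S) (hsm : V.IsSmoothSubvariety S) {x : X}
    (hx : x ∈ S) : ∃ (Φ : OpenPartialHomeomorph W W) (L : Submodule ℝ W), j x ∈ Φ.source ∧
      IsStraightening (j '' S) Φ L ∧ fderiv ℝ Φ (j x) = ContinuousLinearMap.id ℝ W ∧
      ∀ v ∈ L, Complex.I • v ∈ L := by
  have : FiniteDimensional ℝ W := FiniteDimensional.trans ℝ ℂ W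
  let b := Module.finBasis ℂ W
  let φ₀ : MvPolynomial (Fin _) ℂ →ₐ[ℂ] (X → ℂ) := MvPolynomial.aeval fun k x => b.coord k (j x)
  have hφ₀ : ∀ f x, φ₀ f x = evalPoly b (j x) f := by
    intro f x
    have : (Pi.evalAlgHom ℂ (fun _ : X => ℂ) x).comp φ₀ = evalPoly b (j x) := by
      ext k; simp [φ₀, evalPoly]
    exact DFunLike.congr_fun this f
  have hrange : φ₀.range = V.coord := by
    refine le_antisymm ?_ ?_
    · rw [MvPolynomial.aeval_range]
      refine Algebra.adjoin_le ?_
      rintro _ ⟨k, rfl⟩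
      exact hj.comp_mem (b.coord k)
    · rw [← hj]
      refine Algebra.adjoin_le ?_
      rintro _ ⟨ℓ, rfl⟩
      have : (fun x => ℓ (j x)) = ∑ k, ℓ (b k) • φ₀ (MvPolynomial.X k) := by
        ext x
        conv_lhs => rw [← b.sum_repr (j x), map_sum]
        simp [φ₀, mul_comm]
      rw [this]
      exact Subalgebra.sum_mem _ fun k _ => Subalgebra.smul_mem _ (φ₀.mem_range_self _) _
  let res : (X → ℂ) →ₐ[ℂ] (S → ℂ) :=
    AlgHom.pi fun s : S => Pi.evalAlgHom ℂ (fun _ : X => ℂ) s.1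
  have hres : ∀ f, res (φ₀ f) ∈ V.restrict S := fun f =>
    ⟨φ₀ f, by rw [← hrange]; exact ⟨f, rfl⟩, rfl⟩
  let φ : MvPolynomial (Fin _) ℂ →ₐ[ℂ] V.restrict S := (res.comp φ₀).codRestrict _ hres
  have hφs : Function.Surjective φ := by
    rintro ⟨_, g, hg, rfl⟩
    have hg' : g ∈ φ₀.range := by rw [hrange]; exact hg
    obtain ⟨f, rfl⟩ := hg'
    exact ⟨f, rfl⟩
  have hφv : ∀ f (s : S), (φ f : S → ℂ) s = evalPoly b (j s) f := fun f s => hφ₀ f s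
  have hφ0 : ∀ f, φ f = 0 ↔ ∀ s ∈ S, evalPoly b (j s) f = 0 := by
    intro f
    constructor
    · intro h s hs
      rw [← hφv f ⟨s, hs⟩, h]
      rfl
    · intro h
      ext s
      rw [hφv, h s s.2]
      rfl
  have hφp : ∀ f, φ f ∈ RingHom.ker (V.evalAt ⟨x, hx⟩) ↔ evalPoly b (j x) f = 0 := by
    intro f
    rw [RingHom.mem_ker, ← hφv f ⟨x, hx⟩]
    rfl
  have hfs : Algebra.FormallySmooth ℂ (Localization.AtPrime (RingHom.ker (V.evalAt ⟨x, hx⟩))) :=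
    hsm ⟨x, hx⟩
  obtain ⟨c, g, hg0, hgi, h, hh, hhI⟩ := exists_local_generators φ hφs
    (RingHom.ker (V.evalAt ⟨x, hx⟩)) (diffPoly b (j x)) (fun f hf k => by
      rw [hφp, evalPoly_pderiv, hf]; rfl)
  rw [hφp] at hh
  let G : W → Fin c → ℂ := fun w a => evalPoly b w (g a)
  have hG : ContDiff ℂ ∞ G := contDiff_pi.2 fun a => contDiff_evalPoly b (g a)
  let A : W →L[ℂ] Fin c → ℂ := LinearMap.toContinuousLinearMap
    (LinearMap.pi fun a => diffPoly b (j x) (g a))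
  have hA : HasFDerivAt G A (j x) := hasFDerivAt_pi'.2 fun a => hasFDerivAt_evalPoly b (j x) (g a)
  have hAs : Function.Surjective A := surjective_pi_of_linearIndependent hgi
  obtain ⟨u, hu, hux, huS⟩ := V.exists_of_isLocallyClosed hS hx
  rw [← hrange] at hu
  obtain ⟨u, rfl⟩ := hu
  have hux : φ₀ u x ≠ 0 := hux
  rw [hφ₀] at hux
  have hev : ∀ᶠ q in 𝓝 (j x), q ∈ j '' S ↔ G q = 0 := by
    filter_upwards [(contDiff_evalPoly b h).continuous.continuousAt.eventually_ne hh,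
      (contDiff_evalPoly b u).continuous.continuousAt.eventually_ne hux] with q hqh hqu
    constructor
    · rintro ⟨s, hs, rfl⟩
      ext a
      exact (hφ0 (g a)).1 (hg0 a) s hs
    · intro hq
      have hI : ∀ f, φ f = 0 → evalPoly b q f = 0 := by
        intro f hf
        have h1 : Ideal.span (Set.range g) ≤ RingHom.ker (evalPoly b q) := by
          rw [Ideal.span_le]
          rintro _ ⟨a, rfl⟩
          exact congrFun hq a
        have h2 : evalPoly b q (h * f) = 0 := h1 (hhI f hf)
        rw [map_mul] at h2
        exact (mul_eq_zero.1 h2).resolve_left hqh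
      have hker : ∀ f, φ₀ f = 0 → evalPoly b q f = 0 := fun f hf => hI f ((hφ0 f).2 fun s _ => by
        rw [← hφ₀, hf]; rfl)
      have hlift : ∀ f : V.coord, ∃ F, φ₀ F = f := by
        intro f
        have hf : (f : X → ℂ) ∈ φ₀.range := by rw [hrange]; exact f.2
        exact hf
      choose lift hlift using hlift
      have huniq : ∀ F (f : V.coord), φ₀ F = f → evalPoly b q (lift f) = evalPoly b q F := by
        intro F f hF
        rw [← sub_eq_zero, ← map_sub]
        exact hker _ (by rw [map_sub, hlift, hF, sub_self])
      -- Near the point, a zero `q` of the local generators is a zero of all polynomials that vanish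
      -- on `S`. Evaluation at `q` therefore descends to `ℂ[X]` and gives a point of `X`.
      let χ : V.coord →ₐ[ℂ] ℂ :=
        { toFun := fun f => evalPoly b q (lift f)
          map_one' := by rw [huniq 1 1 (by simp), map_one]
          map_mul' := fun f g => by
            rw [huniq (lift f * lift g) (f * g) (by simp [hlift]), map_mul]
          map_zero' := by rw [huniq 0 0 (by simp), map_zero]
          map_add' := fun f g => by
            rw [huniq (lift f + lift g) (f + g) (by simp [hlift]), map_add]
          commutes' := fun z => by
            rw [huniq (algebraMap _ _ z) (algebraMap _ _ z) (by simp), AlgHom.commutes] }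
      obtain ⟨y, hy, -⟩ := V.points χ
      have hyq : j y = q := by
        refine b.ext_elem fun k => ?_
        have h1 := hy ⟨_, hj.comp_mem (b.coord k)⟩
        have h2 : χ ⟨_, hj.comp_mem (b.coord k)⟩ = evalPoly b q (MvPolynomial.X k) :=
          huniq _ _ (by ext; simp [φ₀])
        rw [h2] at h1
        simpa [evalPoly] using h1.symm
      refine ⟨y, huS y ?_ ?_, hyq⟩
      · change φ₀ u y ≠ 0
        rw [hφ₀, hyq]
        exact hqu
      · intro f hf hfS
        rw [← hrange] at hf
        obtain ⟨F, rfl⟩ := hf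
        change φ₀ F y = 0
        rw [hφ₀, hyq]
        refine hI F ((hφ0 F).2 fun s hs => ?_)
        rw [← hφ₀]
        exact hfS s hs
  obtain ⟨Φ, h1, h2, h3⟩ := exists_isStraightening_of_equations
    (A := A.restrictScalars ℝ) (hG.restrict_scalars ℝ) (hA.restrictScalars ℝ) hAs hev
  refine ⟨Φ, _, h1, h2, h3, fun v hv => ?_⟩
  have : A v = 0 := hv
  change A (Complex.I • v) = 0
  rw [map_smul, this, smul_zero]

theorem isSmoothSubmanifold [NormedSpace ℝ W] [IsScalarTower ℝ ℂ W] (hj : V.IsEmbedding j)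
    {S : Set X} (hS : @IsLocallyClosed X V.zariski S) (hsm : V.IsSmoothSubvariety S) :
    IsSmoothSubmanifold (j '' S) := by
  rintro _ ⟨x, hx, rfl⟩
  obtain ⟨Φ, L, h1, h2, -, -⟩ := hj.exists_isStraightening hS hsm hx
  exact ⟨Φ, L, h1, h2.contDiffOn, h2.contDiffOn_symm, h2.inter_eq⟩

/-- The tangent spaces of smooth subvarieties are complex subspaces. -/
theorem I_smul_mem_tangentSpaceOf [NormedSpace ℝ W] [IsScalarTower ℝ ℂ W] (hj : V.IsEmbedding j)
    {S : Set X} (hS : @IsLocallyClosed X V.zariski S) (hsm : V.IsSmoothSubvariety S) {p : W}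
    (hp : p ∈ j '' S) {v : W} (hv : v ∈ tangentSpaceOf (j '' S) p) :
    Complex.I • v ∈ tangentSpaceOf (j '' S) p := by
  have : FiniteDimensional ℝ W := FiniteDimensional.trans ℝ ℂ W
  obtain ⟨x, hx, rfl⟩ := hp
  obtain ⟨Φ, L, h1, h2, h3, h4⟩ := hj.exists_isStraightening hS hsm hx
  rw [h2.mem_tangentSpaceOf_iff h1 ⟨x, hx, rfl⟩, h3] at hv ⊢
  exact h4 v hv

end IsEmbedding

end AffineVariety

/-! ### Whitney's condition -/

/-- Whitney's condition (A), without reference to limits of tangent spaces: tangent vectors of the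
smaller stratum are limits of tangent vectors of the bigger one. -/
theorem WhitneyA.eventually_exists_tangent {E : Type*} [NormedAddCommGroup E]
    [InnerProductSpace ℂ E] [FiniteDimensional ℂ E] {N' N : Set E} (h : WhitneyA N' N) {p w : E}
    (hp : p ∈ N') (hw : w ∈ tangentSpaceOf N' p) {ε : ℝ} (hε : 0 < ε) :
    ∀ᶠ q in 𝓝[N] p, ∃ u ∈ tangentSpaceOf N q, ‖u - w‖ < ε := by
  let _ : InnerProductSpace ℝ E := InnerProductSpace.complexToReal
  have : FiniteDimensional ℝ E := FiniteDimensional.trans ℝ ℂ E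
  by_contra hcon
  obtain ⟨x, hx, hxu⟩ := exists_seq_forall_of_frequently
    ((not_eventually.1 hcon).and_eventually self_mem_nhdsWithin)
  let P : ℕ → E →L[ℝ] E := fun k => (tangentSpaceOf N (x k)).starProjection
  -- Along a sequence of counterexamples, the tangent projections subconverge. The limit is again an
  -- orthogonal projection, so condition (A) applies to its range and the projections of `w` tend to
  -- `w`.
  obtain ⟨Q, -, θ, hθ, hQ⟩ := (isCompact_closedBall (0 : E →L[ℝ] E) 1).tendsto_subseq
    (x := P) fun k => by
      rw [mem_closedBall_zero_iff]
      exact Submodule.starProjection_norm_le _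
  have hP : ∀ k, IsStarProjection (P k) := fun k => isStarProjection_starProjection
  have hQs : IsStarProjection Q := by
    refine ⟨?_, ?_⟩
    · refine tendsto_nhds_unique (f := fun k => P (θ k) * P (θ k)) (hQ.mul hQ) ?_
      refine hQ.congr fun k => ?_
      exact (hP (θ k)).isIdempotentElem.symm
    · refine tendsto_nhds_unique (f := fun k => star (P (θ k))) hQ.star ?_
      refine hQ.congr fun k => ?_
      exact (hP (θ k)).isSelfAdjoint.symm
  obtain ⟨K, _, rfl⟩ := isStarProjection_iff_eq_starProjection.1 hQs
  have hwK : w ∈ K := h (fun k => x (θ k)) p K (fun k => (hxu _).2) hp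
    ((tendsto_nhdsWithin_iff.1 hx).1.comp hθ.tendsto_atTop) hQ hw
  have hlim : Tendsto (fun k => P (θ k) w) atTop (𝓝 w) := by
    have h1 := ((ContinuousLinearMap.apply ℝ E w).continuous.tendsto K.starProjection).comp hQ
    have h2 : (ContinuousLinearMap.apply ℝ E w) K.starProjection = w :=
      Submodule.starProjection_eq_self_iff.2 hwK
    rwa [h2] at h1
  obtain ⟨k, hk⟩ := (Metric.tendsto_nhds.1 hlim ε hε).exists
  refine (hxu (θ k)).1 ⟨P (θ k) w, Submodule.starProjection_apply_mem _ _, ?_⟩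
  rwa [← dist_eq_norm]

/-! ### The real inner product of a complex inner product space -/

section ReInner

variable {E : Type*} [NormedAddCommGroup E] [InnerProductSpace ℂ E]

/-- The real part of the inner product, as a bounded bilinear form. -/
def reInner (E : Type*) [NormedAddCommGroup E] [InnerProductSpace ℂ E] : E →L[ℝ] E →L[ℝ] ℝ :=
  LinearMap.mkContinuous₂ (LinearMap.mk₂ ℝ (fun v w : E => (inner ℂ v w).re)
    (fun v v' w => by rw [inner_add_left, Complex.add_re])
    (fun c v w => by
      rw [← Complex.coe_smul, inner_smul_left, Complex.conj_ofReal, Complex.re_ofReal_mul]; rfl)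
    (fun v w w' => by rw [inner_add_right, Complex.add_re])
    (fun c v w => by
      rw [← Complex.coe_smul, inner_smul_right, Complex.re_ofReal_mul]; rfl)) 1
    fun v w => by
      rw [one_mul]
      exact (Complex.abs_re_le_norm _).trans (norm_inner_le_norm v w)

theorem reInner_apply (v w : E) : reInner E v w = (inner ℂ v w).re := rfl

theorem reInner_comm (v w : E) : reInner E v w = reInner E w v := by
  rw [reInner_apply, reInner_apply, ← inner_conj_symm, Complex.conj_re]

theorem reInner_self (v : E) : reInner E v v = ‖v‖ ^ 2 := inner_self_eq_norm_sq (𝕜 := ℂ) v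

theorem reInner_I_smul_left (v w : E) :
    reInner E (Complex.I • v) w = -reInner E v (Complex.I • w) := by
  simp [reInner_apply]

theorem symplForm_eq_reInner (v w : E) : symplForm v w = reInner E v (Complex.I • w) := by
  simp [symplForm, reInner_apply]

end ReInner

namespace UnitaryTorusModule

variable {r : ℕ} {E : Type*} [NormedAddCommGroup E] [InnerProductSpace ℂ E]
  (ρ : UnitaryTorusModule r E)

theorem reInner_rep (t : CompactTorus r) (v w : E) :
    reInner E (ρ.rep t.incl v) (ρ.rep t.incl w) = reInner E v w := by
  rw [reInner_apply, reInner_apply, ρ.unitary]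

variable [FiniteDimensional ℂ E]

theorem reInner_weightOp_left (ξ : Fin r → ℝ) (v w : E) :
    reInner E (ρ.weightOp ξ v) w = reInner E v (ρ.weightOp ξ w) := by
  rw [reInner_apply, reInner_apply, inner_weightOp_left]

theorem momentMap_pairing_eq_reInner (v : E) (ξ : Fin r → ℝ) :
    ∑ j, ρ.momentMap v j * ξ j = reInner E (ρ.weightOp ξ v) v / 2 :=
  ρ.momentMap_pairing v ξ

theorem momentMap_apply_eq (v : E) (k : Fin r) :
    ρ.momentMap v k = reInner E (ρ.weightOp (Pi.single k 1) v) v / 2 := by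
  rw [← momentMap_pairing_eq_reInner,
    Finset.sum_eq_single k (by simp +contextual) (by simp), Pi.single_eq_same, mul_one]

theorem symplForm_fundVF (ξ : Fin r → ℝ) (p v : E) :
    symplForm (ρ.fundVF ξ p) v = reInner E (ρ.weightOp ξ p) v := by
  rw [symplForm_eq_reInner, fundVF_eq_smul, reInner_I_smul_left, smul_smul, Complex.I_mul_I,
    neg_one_smul, map_neg, neg_neg]

theorem hasFDerivAt_momentMap_pairing (ξ : Fin r → ℝ) (p : E) :
    HasFDerivAt (fun q => ∑ j, ρ.momentMap q j * ξ j) (reInner E (ρ.weightOp ξ p)) p := by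
  simp only [momentMap_pairing_eq_reInner]
  obtain ⟨A, hA, hAv⟩ := MoserData.exists_hasFDerivAt_bilinear (reInner E)
    (((ρ.weightOp ξ).restrictScalars ℝ).hasFDerivAt (x := p)) (hasFDerivAt_id (𝕜 := ℝ) p)
  have h1 : HasFDerivAt (fun q => reInner E (ρ.weightOp ξ q) q / 2) ((2 : ℝ)⁻¹ • A) p := by
    simp only [div_eq_inv_mul]
    exact hA.const_mul (2 : ℝ)⁻¹
  refine h1.congr_fderiv ?_
  ext v
  rw [smul_apply, hAv]
  simp only [ContinuousLinearMap.coe_restrictScalars', id_eq, ContinuousLinearMap.id_apply]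
  rw [reInner_weightOp_left, reInner_comm v, smul_eq_mul]
  ring

theorem norm_character_incl (m : Fin r → ℤ) (t : CompactTorus r) :
    ‖AlgTorus.character m t.incl‖ = 1 := by
  simp [AlgTorus.character, CompactTorus.incl, Circle.norm_coe]

theorem momentMap_rep (t : CompactTorus r) (v : E) :
    ρ.momentMap (ρ.rep t.incl v) = ρ.momentMap v := by
  simp only [momentMap_eq, proj_rep, norm_smul, norm_character_incl, one_mul]

end UnitaryTorusModule

/-! ### The pieces as Hamiltonian submanifolds -/

theorem HasDerivAt.mem_tangentSpaceOf {W : Type*} [NormedAddCommGroup W] [NormedSpace ℝ W]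
    {S : Set W} {c : ℝ → W} {c' : W} {t : ℝ} (hc : HasDerivAt c c' t) (hS : ∀ s, c s ∈ S) :
    c' ∈ tangentSpaceOf S (c t) :=
  (hc.hasDerivWithinAt (s := Set.univ)).mem_tangentSpaceOf uniqueDiffWithinAt_univ
    (Eventually.of_forall hS)

namespace IsClosedEquivariantEmbedding

variable {r : ℕ} {X : Type*} [MulAction (AlgTorus r) X] {V : AffineVariety X}
  {E : Type*} [NormedAddCommGroup E] [InnerProductSpace ℂ E] [FiniteDimensional ℂ E]
  {ρ : UnitaryTorusModule r E} {i : X → E}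

theorem hasDerivAt_orbit (hi : IsClosedEquivariantEmbedding V ρ i) (ξ : Fin r → ℝ) (x : X) :
    HasDerivAt (fun s : ℝ => i ((CompactTorus.exp (s • ξ)).incl • x)) (ρ.fundVF ξ (i x)) 0 := by
  simp only [hi.equivariant]
  rw [ρ.fundVF_eq]
  exact ρ.hasDerivAt_rep_exp ξ (i x)

theorem exp_zero_smul (x : X) (ξ : Fin r → ℝ) :
    (CompactTorus.exp ((0 : ℝ) • ξ)).incl • x = x := by
  have : (CompactTorus.exp ((0 : ℝ) • ξ)).incl = 1 := by
    ext j; simp [CompactTorus.exp, CompactTorus.incl]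
  rw [this, one_smul]

/-- Tangent spaces are complex, and `ω(v, iv) = -‖v‖²` gives nondegeneracy. Fundamental fields are
velocities of orbits that stay in the piece, so they are tangent. -/
theorem isHamiltonianSubmanifold (hi : IsClosedEquivariantEmbedding V ρ i) {σ : V.Face r}
    (hS : @IsLocallyClosed X V.zariski (V.piece σ)) (hsm : V.IsSmoothSubvariety (V.piece σ)) :
    IsHamiltonianSubmanifold ρ (i '' V.piece σ) where
  submanifold := hi.isEmbedding.isSmoothSubmanifold hS hsm
  nondegenerate p hp v hv hv0 := by
    refine ⟨Complex.I • v, hi.isEmbedding.I_smul_mem_tangentSpaceOf hS hsm hp hv, ?_⟩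
    rw [symplForm_eq_reInner, smul_smul, Complex.I_mul_I, neg_one_smul, map_neg, reInner_self]
    exact neg_ne_zero.2 (pow_ne_zero _ (norm_ne_zero_iff.2 hv0))
  invariant := by
    rintro t _ ⟨x, hx, rfl⟩
    rw [← hi.equivariant]
    exact ⟨_, (hi.smul_mem_piece_iff σ _).2 hx, rfl⟩
  moment_equivariant t p _ := ρ.momentMap_rep t p
  moment := by
    rintro _ ⟨x, hx, rfl⟩ ξ
    refine ⟨?_, _, (ρ.hasFDerivAt_momentMap_pairing ξ (i x)).hasFDerivWithinAt, fun v _ =>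
      ρ.symplForm_fundVF ξ (i x) v⟩
    have := HasDerivAt.mem_tangentSpaceOf (hi.hasDerivAt_orbit ξ x) (S := i '' V.piece σ)
      fun s => ⟨_, (hi.smul_mem_piece_iff σ _).2 hx, rfl⟩
    rwa [exp_zero_smul] at this

end IsClosedEquivariantEmbedding

/-! ### Graphs -/

section Graph

variable {X W W' : Type*} [NormedAddCommGroup W] [NormedSpace ℝ W] [NormedAddCommGroup W']
  [NormedSpace ℝ W'] {i : X → W} {i' : X → W'} {A : Set X}

theorem fst_mem_tangentSpaceOf_image {q : W × W'} {v : W × W'}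
    (hv : v ∈ tangentSpaceOf ((fun x => (i x, i' x)) '' A) q) :
    v.1 ∈ tangentSpaceOf (i '' A) q.1 := by
  refine (hasFDerivAt_fst (𝕜 := ℝ) (p := q)).hasFDerivWithinAt.mapsTo_tangentSpaceOf ?_ hv
  filter_upwards [self_mem_nhdsWithin]
  rintro _ ⟨x, hx, rfl⟩
  exact ⟨x, hx, rfl⟩

theorem snd_eq_fderiv_of_mem_tangentSpaceOf {F : W → W'} (hF : Differentiable ℝ F)
    (hFi : ∀ x, F (i x) = i' x) {q : W × W'} (hq : q ∈ (fun x => (i x, i' x)) '' A) {v : W × W'}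
    (hv : v ∈ tangentSpaceOf ((fun x => (i x, i' x)) '' A) q) :
    v.2 = fderiv ℝ F q.1 v.1 := by
  have h1 : HasFDerivWithinAt (fun q : W × W' => q.2) (ContinuousLinearMap.snd ℝ W W')
      ((fun x => (i x, i' x)) '' A) q := hasFDerivAt_snd.hasFDerivWithinAt
  have h2 : HasFDerivAt (fun q : W × W' => F q.1)
      (fderiv ℝ F q.1 ∘L ContinuousLinearMap.fst ℝ W W') q :=
    (hF q.1).hasFDerivAt.comp q hasFDerivAt_fst
  have key : Set.EqOn (fun q : W × W' => q.2) (fun q => F q.1) ((fun x => (i x, i' x)) '' A) := by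
    rintro _ ⟨x, -, rfl⟩
    exact (hFi x).symm
  exact h1.eq_on_tangentSpaceOf (h2.hasFDerivWithinAt.congr key (key hq)) hv

theorem fst_eq_fderiv_of_mem_tangentSpaceOf {F : W' → W} (hF : Differentiable ℝ F)
    (hFi : ∀ x, F (i' x) = i x) {q : W × W'} (hq : q ∈ (fun x => (i x, i' x)) '' A) {v : W × W'}
    (hv : v ∈ tangentSpaceOf ((fun x => (i x, i' x)) '' A) q) :
    v.1 = fderiv ℝ F q.2 v.2 := by
  have h1 : HasFDerivWithinAt (fun q : W × W' => q.1) (ContinuousLinearMap.fst ℝ W W')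
      ((fun x => (i x, i' x)) '' A) q := hasFDerivAt_fst.hasFDerivWithinAt
  have h2 : HasFDerivAt (fun q : W × W' => F q.2)
      (fderiv ℝ F q.2 ∘L ContinuousLinearMap.snd ℝ W W') q :=
    (hF q.2).hasFDerivAt.comp q hasFDerivAt_snd
  have key : Set.EqOn (fun q : W × W' => q.1) (fun q => F q.2) ((fun x => (i x, i' x)) '' A) := by
    rintro _ ⟨x, -, rfl⟩
    exact (hFi x).symm
  exact h1.eq_on_tangentSpaceOf (h2.hasFDerivWithinAt.congr key (key hq)) hv

theorem graph_mem_tangentSpaceOf {F : W → W'} (hF : Differentiable ℝ F)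
    (hFi : ∀ x, F (i x) = i' x) {p : W} {u : W} (hu : u ∈ tangentSpaceOf (i '' A) p) :
    (u, fderiv ℝ F p u) ∈ tangentSpaceOf ((fun x => (i x, i' x)) '' A) (p, F p) := by
  have h1 : HasFDerivAt (fun q => (q, F q))
      ((ContinuousLinearMap.id ℝ W).prod (fderiv ℝ F p)) p :=
    (hasFDerivAt_id p).prodMk (hF p).hasFDerivAt
  refine h1.hasFDerivWithinAt.mapsTo_tangentSpaceOf ?_ hu
  filter_upwards [self_mem_nhdsWithin]
  rintro _ ⟨x, hx, rfl⟩
  exact ⟨x, hx, by rw [hFi]⟩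

theorem exists_norm_graph_sub_lt {F : W → W'} (hF : ContDiff ℝ ∞ F) (p v : W) {ε : ℝ}
    (hε : 0 < ε) : ∃ δ > 0, ∀ q u : W, ‖q - p‖ < δ → ‖u - v‖ < δ →
      ‖(u, fderiv ℝ F q u) - (v, fderiv ℝ F p v)‖ < ε := by
  have h1 : Continuous (fderiv ℝ F) := hF.continuous_fderiv (by simp)
  have hcont : Continuous fun z : W × W => (z.2, fderiv ℝ F z.1 z.2) :=
    continuous_snd.prodMk ((h1.comp continuous_fst).clm_apply continuous_snd)
  obtain ⟨δ, hδ, h⟩ := Metric.continuous_iff.1 hcont (p, v) ε hε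
  refine ⟨δ, hδ, fun q u hq hu => ?_⟩
  have h2 := h (q, u) (by rw [dist_eq_norm, Prod.mk_sub_mk]; exact max_lt hq hu)
  rwa [dist_eq_norm] at h2

theorem eventually_exists_tangent_graph {F : W → W'} (hF : ContDiff ℝ ∞ F)
    (hFi : ∀ x, F (i x) = i' x) {x₀ : X} {v : W}
    (h : ∀ ε > 0, ∀ᶠ q in 𝓝[i '' A] (i x₀), ∃ u ∈ tangentSpaceOf (i '' A) q, ‖u - v‖ < ε)
    {ε : ℝ} (hε : 0 < ε) :
    ∀ᶠ q in 𝓝[(fun x => (i x, i' x)) '' A] (i x₀, i' x₀),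
      ∃ u ∈ tangentSpaceOf ((fun x => (i x, i' x)) '' A) q,
        ‖u - (v, fderiv ℝ F (i x₀) v)‖ < ε := by
  obtain ⟨δ, hδ, hball⟩ := exists_norm_graph_sub_lt hF (i x₀) v hε
  have h2 : Tendsto Prod.fst (𝓝[(fun x => (i x, i' x)) '' A] (i x₀, i' x₀))
      (𝓝[i '' A] (i x₀)) := by
    refine tendsto_nhdsWithin_iff.2 ⟨continuous_fst.continuousWithinAt, ?_⟩
    filter_upwards [self_mem_nhdsWithin]
    rintro _ ⟨x, hx, rfl⟩
    exact ⟨x, hx, rfl⟩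
  have h3 : ∀ᶠ q in 𝓝[i '' A] (i x₀), ‖q - i x₀‖ < δ := by
    filter_upwards [mem_nhdsWithin_of_mem_nhds (Metric.ball_mem_nhds (i x₀) hδ)] with q hq
    rwa [Metric.mem_ball, dist_eq_norm] at hq
  filter_upwards [h2.eventually ((h δ hδ).and h3), self_mem_nhdsWithin]
  rintro _ ⟨⟨u, hu, huw⟩, hxδ⟩ ⟨x, hx, rfl⟩
  refine ⟨(u, fderiv ℝ F (i x) u), ?_, hball _ _ hxδ huw⟩
  have := graph_mem_tangentSpaceOf (hF.differentiable (by simp)) hFi hu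
  rwa [hFi] at this

end Graph

/-! ### The Moser flow of two embeddings -/

section RealProd

variable {E E' : Type*} [NormedAddCommGroup E] [InnerProductSpace ℂ E] [NormedAddCommGroup E']
  [InnerProductSpace ℂ E']

/-- The product of two complex linear maps, as a real linear map. -/
def realProd (A : E →L[ℂ] E) (B : E' →L[ℂ] E') : (E × E') →L[ℝ] (E × E') :=
  (A.restrictScalars ℝ).prodMap (B.restrictScalars ℝ)

theorem realProd_apply (A : E →L[ℂ] E) (B : E' →L[ℂ] E') (v : E × E') :
    realProd A B v = (A v.1, B v.2) := rfl

end RealProd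

namespace IsClosedEquivariantEmbedding

variable {r : ℕ} {X : Type*} [MulAction (AlgTorus r) X] {V : AffineVariety X}
  {E : Type*} [NormedAddCommGroup E] [InnerProductSpace ℂ E]
  {ρ : UnitaryTorusModule r E}
  {E' : Type*} [NormedAddCommGroup E'] [InnerProductSpace ℂ E']
  {ρ' : UnitaryTorusModule r E'} {i : X → E} {i' : X → E'}

theorem image_piece_eq (hi : IsClosedEquivariantEmbedding V ρ i)
    (hi' : IsClosedEquivariantEmbedding V ρ' i') (F : V.Face r) :
    (fun x => (i x, i' x)) '' V.piece F = ((fun x => (i x, i' x)) '' V.closedPiece F) \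
      ⋃ (G : V.Face r) (_ : G < F), (fun x => (i x, i' x)) '' V.closedPiece G := by
  rw [AffineVariety.piece, Set.image_sdiff (hi.isEmbedding.prodMk hi'.isEmbedding).injective]
  simp only [Set.image_iUnion]

variable [FiniteDimensional ℂ E] [FiniteDimensional ℂ E']

theorem exists_contDiff_real (hi : IsClosedEquivariantEmbedding V ρ i)
    (hi' : IsClosedEquivariantEmbedding V ρ' i') :
    ∃ F : E → E', ContDiff ℝ ∞ F ∧ ∀ x, F (i x) = i' x := by
  obtain ⟨F, hF, hFi⟩ := hi.isEmbedding.exists_contDiff_map hi'.isEmbedding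
  exact ⟨F, hF.restrict_scalars ℝ, hFi⟩

theorem image_closedPiece (hi : IsClosedEquivariantEmbedding V ρ i)
    (hi' : IsClosedEquivariantEmbedding V ρ' i') (F : V.Face r) :
    IsClosed ((fun x => (i x, i' x)) '' V.closedPiece F) := by
  have h : (fun x => (i x, i' x)) '' V.closedPiece F = Set.range (fun x => (i x, i' x)) ∩
      {q | ∀ m, realWeight m ∉ F.1 → ρ.proj m q.1 = 0} := by
    ext q
    constructor
    · rintro ⟨x, hx, rfl⟩
      exact ⟨⟨x, rfl⟩, fun m hm => by_contra fun hne =>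
        hm ((hi.mem_closedPiece_iff F x).1 hx m hne)⟩
    · rintro ⟨⟨x, rfl⟩, h⟩
      exact ⟨x, (hi.mem_closedPiece_iff F x).2 fun m hm => by_contra fun hne => hm (h m hne), rfl⟩
  rw [h]
  refine (hi.isEmbedding.prodMk hi'.isEmbedding).isClosed_range.inter ?_
  simp only [Set.ofPred_forall]
  exact isClosed_iInter fun m => isClosed_iInter fun _ =>
    isClosed_eq ((ρ.proj m).continuous.comp continuous_fst) continuous_const

theorem isClosed_iUnion_image [Finite (V.Face r)] (hi : IsClosedEquivariantEmbedding V ρ i)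
    (hi' : IsClosedEquivariantEmbedding V ρ' i') (F : V.Face r) :
    IsClosed (⋃ (G : V.Face r) (_ : G < F), (fun x => (i x, i' x)) '' V.closedPiece G) :=
  isClosed_iUnion_of_finite fun G => isClosed_iUnion_of_finite fun _ =>
    hi.image_closedPiece hi' G

/-- The image of `X` is a graph over each factor of a smooth ambient map. The two components of a
tangent vector thus bound each other, with a locally uniform constant. -/
theorem eventually_coercive {A : V.Face r → Set X} (hi : IsClosedEquivariantEmbedding V ρ i)
    (hi' : IsClosedEquivariantEmbedding V ρ' i') (p : E × E') :
    ∃ c > 0, ∀ᶠ q in 𝓝 p, ∀ τ, q ∈ (fun x => (i x, i' x)) '' A τ →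
      ∀ v ∈ tangentSpaceOf ((fun x => (i x, i' x)) '' A τ) q, ∀ a ∈ Set.Icc (0 : ℝ) 1,
        c * ‖v‖ ^ 2 ≤ (1 - a) * ‖v.1‖ ^ 2 + a * ‖v.2‖ ^ 2 := by
  obtain ⟨F, hF, hFi⟩ := hi.exists_contDiff_real hi'
  obtain ⟨F', hF', hFi'⟩ := hi'.exists_contDiff_real hi
  have h1 : Continuous fun q : E × E' => ‖fderiv ℝ F q.1‖ :=
    ((hF.continuous_fderiv (by simp)).comp continuous_fst).norm
  have h2 : Continuous fun q : E × E' => ‖fderiv ℝ F' q.2‖ :=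
    ((hF'.continuous_fderiv (by simp)).comp continuous_snd).norm
  set M := max (‖fderiv ℝ F p.1‖ + 1) (‖fderiv ℝ F' p.2‖ + 1) with hM
  have hM1 : 1 ≤ M := le_max_of_le_left (by linarith [norm_nonneg (fderiv ℝ F p.1)])
  have hM0 : 0 < M := by linarith
  have e1 : ‖fderiv ℝ F p.1‖ < M := lt_max_of_lt_left (by linarith)
  have e2 : ‖fderiv ℝ F' p.2‖ < M := lt_max_of_lt_right (by linarith)
  refine ⟨(M ^ 2)⁻¹, by positivity, ?_⟩
  filter_upwards [h1.continuousAt.eventually (gt_mem_nhds e1),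
    h2.continuousAt.eventually (gt_mem_nhds e2)] with q hq1 hq2 τ hq v hv a ha
  have k1 : ‖v.2‖ ≤ M * ‖v.1‖ := by
    rw [snd_eq_fderiv_of_mem_tangentSpaceOf (hF.differentiable (by simp)) hFi hq hv]
    exact ((fderiv ℝ F q.1).le_opNorm _).trans (by gcongr)
  have k2 : ‖v.1‖ ≤ M * ‖v.2‖ := by
    rw [fst_eq_fderiv_of_mem_tangentSpaceOf (hF'.differentiable (by simp)) hFi' hq hv]
    exact ((fderiv ℝ F' q.2).le_opNorm _).trans (by gcongr)
  have k3 : ‖v‖ ≤ M * ‖v.1‖ := by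
    rw [Prod.norm_def]
    exact max_le (le_mul_of_one_le_left (norm_nonneg _) hM1) k1
  have k4 : ‖v‖ ≤ M * ‖v.2‖ := by
    rw [Prod.norm_def]
    exact max_le k2 (le_mul_of_one_le_left (norm_nonneg _) hM1)
  have k5 : ‖v‖ ^ 2 ≤ M ^ 2 * ‖v.1‖ ^ 2 := by rw [← mul_pow]; gcongr
  have k6 : ‖v‖ ^ 2 ≤ M ^ 2 * ‖v.2‖ ^ 2 := by rw [← mul_pow]; gcongr
  rw [inv_mul_le_iff₀ (by positivity)]
  have k7 := mul_le_mul_of_nonneg_left k5 (sub_nonneg.2 ha.2)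
  have k8 := mul_le_mul_of_nonneg_left k6 ha.1
  linarith

/-- Pairing the interpolated moment with a common positive `η` bounds a weighted sum of `‖i x‖ ^ 2`
and `‖i' x‖ ^ 2`. One of the weights `1 - a` and `a` is at least `1 / 2`, which bounds one norm; the
smooth map between the embeddings bounds the other. -/
theorem exists_norm_le (hi : IsClosedEquivariantEmbedding V ρ i)
    (hi' : IsClosedEquivariantEmbedding V ρ' i') (hμ : IsProperMap ρ.momentMap)
    (hμ' : IsProperMap ρ'.momentMap) (C : ℝ) : ∃ R, ∀ a ∈ Set.Icc (0 : ℝ) 1, ∀ x,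
      (∀ k, |(1 - a) * (2 * ρ.momentMap (i x) k) + a * (2 * ρ'.momentMap (i' x) k)| ≤ C) →
        ‖(i x, i' x)‖ ≤ R := by
  obtain ⟨η, h1, h2⟩ := hi.exists_pos hi' hμ hμ'
  obtain ⟨c, hc, hcb⟩ := ρ.exists_norm_sq_le i η h1
  obtain ⟨c', hc', hcb'⟩ := ρ'.exists_norm_sq_le i' η h2
  obtain ⟨F, hF, hFi⟩ := hi.exists_contDiff_real hi'
  obtain ⟨F', hF', hFi'⟩ := hi'.exists_contDiff_real hi
  have : FiniteDimensional ℝ E := FiniteDimensional.trans ℝ ℂ E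
  have : FiniteDimensional ℝ E' := FiniteDimensional.trans ℝ ℂ E'
  set B := C / 2 * ∑ k, |η k| with hB
  set R₀ := √(2 * B / c)
  set R₀' := √(2 * B / c')
  obtain ⟨M, hM⟩ := ((isCompact_closedBall (0 : E) R₀).image hF.continuous).isBounded.exists_norm_le
  obtain ⟨M', hM'⟩ :=
    ((isCompact_closedBall (0 : E') R₀').image hF'.continuous).isBounded.exists_norm_le
  refine ⟨max (max R₀ M) (max M' R₀'), fun a ha x hx => ?_⟩
  have key : (1 - a) * (c * ‖i x‖ ^ 2) + a * (c' * ‖i' x‖ ^ 2) ≤ B := by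
    calc (1 - a) * (c * ‖i x‖ ^ 2) + a * (c' * ‖i' x‖ ^ 2)
        ≤ (1 - a) * ∑ k, ρ.momentMap (i x) k * η k + a * ∑ k, ρ'.momentMap (i' x) k * η k := by
          have := sub_nonneg.2 ha.2
          have := ha.1
          gcongr
          · exact hcb x
          · exact hcb' x
      _ = ∑ k, ((1 - a) * ρ.momentMap (i x) k + a * ρ'.momentMap (i' x) k) * η k := by
          rw [Finset.mul_sum, Finset.mul_sum, ← Finset.sum_add_distrib]
          exact Finset.sum_congr rfl fun k _ => by ring
      _ ≤ ∑ k, C / 2 * |η k| := by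
          refine Finset.sum_le_sum fun k _ => (le_abs_self _).trans ?_
          rw [abs_mul]
          refine mul_le_mul_of_nonneg_right ?_ (abs_nonneg _)
          have h3 := hx k
          have h4 : (1 - a) * (2 * ρ.momentMap (i x) k) + a * (2 * ρ'.momentMap (i' x) k) =
            2 * ((1 - a) * ρ.momentMap (i x) k + a * ρ'.momentMap (i' x) k) := by ring
          rw [h4, abs_mul, abs_two] at h3
          linarith
      _ = B := by rw [hB, Finset.mul_sum]
  have hn1 : 0 ≤ c * ‖i x‖ ^ 2 := by positivity
  have hn2 : 0 ≤ c' * ‖i' x‖ ^ 2 := by positivity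
  rw [Prod.norm_def]
  rcases le_total a (1 / 2) with hle | hle
  · have h3 : ‖i x‖ ≤ R₀ := by
      refine Real.le_sqrt_of_sq_le ?_
      rw [le_div_iff₀ hc]
      nlinarith [mul_nonneg ha.1 hn2]
    refine max_le (le_max_of_le_left (le_max_of_le_left h3))
      (le_max_of_le_left (le_max_of_le_right ?_))
    have := hM (F (i x)) ⟨i x, by simpa using h3, rfl⟩
    rwa [hFi] at this
  · have h3 : ‖i' x‖ ≤ R₀' := by
      refine Real.le_sqrt_of_sq_le ?_
      rw [le_div_iff₀ hc']
      nlinarith [mul_nonneg (sub_nonneg.2 ha.2) hn1]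
    refine max_le (le_max_of_le_right (le_max_of_le_left ?_))
      (le_max_of_le_right (le_max_of_le_right h3))
    have := hM' (F' (i' x)) ⟨i' x, by simpa using h3, rfl⟩
    rwa [hFi'] at this

/-- The projection always lands in the closed piece. Near a point of the open piece it avoids, by
continuity, the finite and hence closed union of smaller closed pieces. -/
theorem eventually_coneProj_mem [Finite (V.Face r)] (hi : IsClosedEquivariantEmbedding V ρ i)
    (hi' : IsClosedEquivariantEmbedding V ρ' i') {σ : V.Face r} {x : X} (hx : x ∈ V.piece σ) :
    ∀ᶠ q in 𝓝[Set.range fun x => (i x, i' x)] (i x, i' x),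
      realProd (ρ.coneProj σ.1) (ρ'.coneProj σ.1) q ∈ (fun x => (i x, i' x)) '' V.piece σ := by
  have hxm : (i x, i' x) ∈ (fun x => (i x, i' x)) '' V.piece σ := ⟨x, hx, rfl⟩
  have hself : realProd (ρ.coneProj σ.1) (ρ'.coneProj σ.1) (i x, i' x) = (i x, i' x) := by
    rw [realProd_apply, hi.coneProj_eq hx.1, hi'.coneProj_eq hx.1]
  rw [hi.image_piece_eq hi'] at hxm ⊢
  have h1 : ∀ᶠ q in 𝓝 (i x, i' x), realProd (ρ.coneProj σ.1) (ρ'.coneProj σ.1) q ∈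
      (⋃ (G : V.Face r) (_ : G < σ), (fun x => (i x, i' x)) '' V.closedPiece G)ᶜ := by
    refine (realProd (ρ.coneProj σ.1) (ρ'.coneProj σ.1)).continuous.continuousAt.eventually_mem ?_
    rw [hself]
    exact (hi.isClosed_iUnion_image hi' σ).isOpen_compl.mem_nhds hxm.2
  filter_upwards [mem_nhdsWithin_of_mem_nhds h1, self_mem_nhdsWithin]
  rintro _ h2 ⟨y, rfl⟩
  obtain ⟨z, hz, h3, h4⟩ := hi.exists_eq_coneProj hi' σ y
  exact ⟨⟨z, hz, by rw [realProd_apply, ← h3, ← h4]⟩, h2⟩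

/-- Tangent vectors of the graph are `(u, dF u)`, so the approximation property in `E` passes to the
graph by continuity of `dF`. -/
theorem eventually_exists_tangent_pair (hi : IsClosedEquivariantEmbedding V ρ i)
    (hi' : IsClosedEquivariantEmbedding V ρ' i') {σ τ : V.Face r}
    (h : WhitneyA (i '' V.piece σ) (i '' V.piece τ)) {p : E × E'}
    (hp : p ∈ (fun x => (i x, i' x)) '' V.piece σ) {w : E × E'}
    (hw : w ∈ tangentSpaceOf ((fun x => (i x, i' x)) '' V.piece σ) p) {ε : ℝ} (hε : 0 < ε) :
    ∀ᶠ q in 𝓝[(fun x => (i x, i' x)) '' V.piece τ] p,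
      ∃ u ∈ tangentSpaceOf ((fun x => (i x, i' x)) '' V.piece τ) q, ‖u - w‖ < ε := by
  obtain ⟨F, hF, hFi⟩ := hi.exists_contDiff_real hi'
  have hFd : Differentiable ℝ F := hF.differentiable (by simp)
  have hw2 := snd_eq_fderiv_of_mem_tangentSpaceOf hFd hFi hp hw
  obtain ⟨x₀, hx₀, rfl⟩ := hp
  have hself : (w.1, fderiv ℝ F (i x₀) w.1) = w := Prod.ext rfl hw2.symm
  have h1 := fst_mem_tangentSpaceOf_image hw
  have h2 := eventually_exists_tangent_graph hF hFi (x₀ := x₀) (v := w.1) (A := V.piece τ)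
    (fun ε hε => h.eventually_exists_tangent ⟨x₀, hx₀, rfl⟩ h1 hε) hε
  rw [hself] at h2
  exact h2

/-- The Moser data on the product of the ambient spaces of two embeddings. -/
def moserData (hi : IsClosedEquivariantEmbedding V ρ i)
    (hi' : IsClosedEquivariantEmbedding V ρ' i')
    (hD1 : V.IsDecomposed (fun σ : V.Face r => V.piece σ))
    (hD2 : ∀ σ τ : V.Face r, WhitneyA (i '' V.piece σ) (i '' V.piece τ))
    (hμ : IsProperMap ρ.momentMap) (hμ' : IsProperMap ρ'.momentMap) :
    MoserData (E × E') (V.Face r) r where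
  S σ := (fun x => (i x, i' x)) '' V.piece σ
  g₀ := (reInner E).bilinearComp (ContinuousLinearMap.fst ℝ E E') (ContinuousLinearMap.fst ℝ E E')
  g₁ := (reInner E').bilinearComp (ContinuousLinearMap.snd ℝ E E') (ContinuousLinearMap.snd ℝ E E')
  J := realProd (Complex.I • ContinuousLinearMap.id ℂ E) (Complex.I • ContinuousLinearMap.id ℂ E')
  N k := realProd (ρ.weightOp (Pi.single k 1)) (ρ'.weightOp (Pi.single k 1))
  π σ := realProd (ρ.coneProj σ.1) (ρ'.coneProj σ.1)
  symm₀ v w := reInner_comm _ _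
  symm₁ v w := reInner_comm _ _
  J₀ v w := reInner_I_smul_left _ _
  J₁ v w := reInner_I_smul_left _ _
  N₀ k v w := ρ.reInner_weightOp_left _ _ _
  N₁ k v w := ρ'.reInner_weightOp_left _ _ _
  π₀ σ v w := congrArg Complex.re (ρ.inner_coneProj_left σ.1 v.1 w.1)
  π₁ σ v w := congrArg Complex.re (ρ'.inner_coneProj_left σ.1 v.2 w.2)
  smooth σ := (hi.isEmbedding.prodMk hi'.isEmbedding).isSmoothSubmanifold (hD1.locallyClosed σ)
    (hD1.smooth σ)
  locallyClosed σ := by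
    have := hD1.finite
    rw [hi.image_piece_eq hi']
    exact (hi.image_closedPiece hi' σ).isLocallyClosed.inter
      (hi.isClosed_iUnion_image hi' σ).isOpen_compl.isLocallyClosed
  closed := by
    rw [← Set.image_iUnion, hD1.cover, Set.image_univ]
    exact (hi.isEmbedding.prodMk hi'.isEmbedding).isClosed_range
  J_mem σ p hp v hv := (hi.isEmbedding.prodMk hi'.isEmbedding).I_smul_mem_tangentSpaceOf
    (hD1.locallyClosed σ) (hD1.smooth σ) hp hv
  N_mem := by
    rintro σ _ ⟨x, hx, rfl⟩ k
    -- The field `N k` is `-J` times the fundamental field, and the tangent space is complex.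
    have h1 := HasDerivAt.mem_tangentSpaceOf ((hi.hasDerivAt_orbit (Pi.single k 1) x).prodMk
      (hi'.hasDerivAt_orbit (Pi.single k 1) x)) (S := (fun x => (i x, i' x)) '' V.piece σ)
      fun s => ⟨_, (hi.smul_mem_piece_iff σ _).2 hx, rfl⟩
    rw [exp_zero_smul] at h1
    have h2 := (hi.isEmbedding.prodMk hi'.isEmbedding).I_smul_mem_tangentSpaceOf
      (hD1.locallyClosed σ) (hD1.smooth σ) ⟨x, hx, rfl⟩ h1
    have h3 : realProd (ρ.weightOp (Pi.single k 1)) (ρ'.weightOp (Pi.single k 1)) (i x, i' x) =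
        -(Complex.I • (ρ.fundVF (Pi.single k 1) (i x), ρ'.fundVF (Pi.single k 1) (i' x))) := by
      rw [ρ.fundVF_eq_smul, ρ'.fundVF_eq_smul, Prod.smul_mk, smul_smul, smul_smul, Complex.I_mul_I,
        neg_one_smul, neg_one_smul, realProd_apply, Prod.neg_mk, neg_neg, neg_neg]
    rw [h3]
    exact Submodule.neg_mem _ h2
  coercive p _ := by
    obtain ⟨c, hc, h⟩ := hi.eventually_coercive hi' (A := V.piece) p
    refine ⟨c, hc, h.mono fun q hq τ hqτ v hv a ha => ?_⟩
    refine (hq τ hqτ v hv a ha).trans_eq ?_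
    rw [← reInner_self, ← reInner_self]
    rfl
  bounded C := by
    obtain ⟨R, hR⟩ := hi.exists_norm_le hi' hμ hμ' C
    refine ⟨R, fun a ha q hq hk => ?_⟩
    obtain ⟨σ, x, -, rfl⟩ := Set.mem_iUnion.1 hq
    refine hR a ha x fun k => ?_
    rw [ρ.momentMap_apply_eq, ρ'.momentMap_apply_eq, mul_div_cancel₀ _ two_ne_zero,
      mul_div_cancel₀ _ two_ne_zero]
    exact hk k
  separated := by
    rintro σ τ _ ⟨x, hx, rfl⟩ _ ⟨y, hy, rfl⟩ a ha b hb h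
    refine hi.face_eq_of_moment_eq hi' hx hy ha hb ?_
    ext k
    simp only [Pi.add_apply, Pi.smul_apply, smul_eq_mul, ρ.momentMap_apply_eq,
      ρ'.momentMap_apply_eq]
    have h1 : (1 - a) * reInner E (ρ.weightOp (Pi.single k 1) (i x)) (i x) +
        a * reInner E' (ρ'.weightOp (Pi.single k 1) (i' x)) (i' x) =
        (1 - b) * reInner E (ρ.weightOp (Pi.single k 1) (i y)) (i y) +
        b * reInner E' (ρ'.weightOp (Pi.single k 1) (i' y)) (i' y) := h k
    linarith
  π_self := by
    rintro σ _ ⟨x, hx, rfl⟩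
    rw [realProd_apply, hi.coneProj_eq hx.1, hi'.coneProj_eq hx.1]
  π_maps := by
    have := hD1.finite
    rintro σ _ ⟨x, hx, rfl⟩
    rw [← Set.image_iUnion, hD1.cover, Set.image_univ]
    exact hi.eventually_coneProj_mem hi' hx
  whitney σ τ p hp w hw ε hε := hi.eventually_exists_tangent_pair hi' (hD2 σ τ) hp hw hε

end IsClosedEquivariantEmbedding

/-! ### The isomorphism given by the Moser flow -/

namespace MoserData

variable {W : Type*} [NormedAddCommGroup W] [NormedSpace ℝ W] [FiniteDimensional ℝ W]
  {ι X : Type*} {r : ℕ} (D : MoserData W ι r) {j : X → W} {P : ι → Set X}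

theorem forward_mem_Icc (s : ℝ) (hs : s ∈ Set.Icc (0 : ℝ) 1) : 0 + 1 * s ∈ Set.Icc (0 : ℝ) 1 := by
  simpa using hs

theorem backward_mem_Icc (s : ℝ) (hs : s ∈ Set.Icc (0 : ℝ) 1) :
    1 + -1 * s ∈ Set.Icc (0 : ℝ) 1 := by
  constructor <;> linarith [hs.1, hs.2]

theorem flow_backward_forward {σ : ι} {p : W} (hp : p ∈ D.S σ) :
    D.flow 1 (-1) (D.flow 0 1 p) = p := by
  have h := D.flow_reverse forward_mem_Icc (by rw [zero_add]; exact backward_mem_Icc) hp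
  rwa [zero_add] at h

theorem flow_forward_backward {σ : ι} {p : W} (hp : p ∈ D.S σ) :
    D.flow 0 1 (D.flow 1 (-1) p) = p := by
  have h := D.flow_reverse backward_mem_Icc
    (by rw [add_neg_cancel, neg_neg]; exact forward_mem_Icc) hp
  rwa [add_neg_cancel, neg_neg] at h

theorem exists_equiv (hj : Function.Injective j) (hS : ∀ σ, D.S σ = j '' P σ)
    (hP : ⋃ σ, P σ = Set.univ) :
    ∃ φ : X ≃ X, (∀ x, j (φ x) = D.flow 0 1 (j x)) ∧ (∀ x, j (φ.symm x) = D.flow 1 (-1) (j x)) ∧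
      ∀ σ, φ '' P σ = P σ := by
  have hmem : ∀ x, ∃ σ, x ∈ P σ := fun x => Set.mem_iUnion.1 (hP ▸ Set.mem_univ x)
  have key : ∀ {a₀ e : ℝ}, (∀ s ∈ Set.Icc (0 : ℝ) 1, a₀ + e * s ∈ Set.Icc (0 : ℝ) 1) → ∀ x σ,
      x ∈ P σ → ∃ y ∈ P σ, j y = D.flow a₀ e (j x) := fun ha x σ hx => by
    have := D.flow_mem ha (σ := σ) (p := j x) (by rw [hS]; exact ⟨x, hx, rfl⟩)
    rwa [hS] at this
  choose σ hσ using hmem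
  choose f hfP hf using fun x => key forward_mem_Icc x (σ x) (hσ x)
  choose g hgP hg using fun x => key backward_mem_Icc x (σ x) (hσ x)
  have hjS : ∀ x, j x ∈ D.S (σ x) := fun x => by rw [hS]; exact ⟨x, hσ x, rfl⟩
  let φ : X ≃ X :=
    { toFun := f
      invFun := g
      left_inv := fun x => hj (by rw [hg, hf, D.flow_backward_forward (hjS x)])
      right_inv := fun x => hj (by rw [hf, hg, D.flow_forward_backward (hjS x)]) }
  refine ⟨φ, hf, hg, fun τ => Set.Subset.antisymm ?_ fun x hx => ?_⟩
  · rintro _ ⟨x, hx, rfl⟩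
    obtain ⟨y, hy, h⟩ := key forward_mem_Icc x τ hx
    have h1 : φ x = y := hj ((hf x).trans h.symm)
    rwa [h1]
  · obtain ⟨y, hy, h⟩ := key backward_mem_Icc x τ hx
    have h1 : φ.symm x = y := hj ((hg x).trans h.symm)
    exact ⟨y, hy, by rw [← h1, φ.apply_symm_apply]⟩

theorem continuous_of_flow_eq [Finite ι] [TopologicalSpace X] (hj : Topology.IsInducing j)
    (hS : ∀ σ, D.S σ = j '' P σ) (hP : ⋃ σ, P σ = Set.univ) {a₀ e : ℝ}
    (ha : ∀ s ∈ Set.Icc (0 : ℝ) 1, a₀ + e * s ∈ Set.Icc (0 : ℝ) 1) {f : X → X}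
    (hf : ∀ x, j (f x) = D.flow a₀ e (j x)) : Continuous f := by
  rw [hj.continuous_iff]
  have h : j ∘ f = D.flow a₀ e ∘ j := funext hf
  rw [h]
  refine (D.continuousOn_flow ha).comp_continuous hj.continuous fun x => ?_
  obtain ⟨σ, hσ⟩ := Set.mem_iUnion.1 (hP ▸ Set.mem_univ x : x ∈ ⋃ σ, P σ)
  exact Set.mem_iUnion.2 ⟨σ, by rw [hS]; exact ⟨x, hσ, rfl⟩⟩

end MoserData

/-! ### From the flow on the graph to maps between the factors -/

section Graph

variable {X W W' ι : Type*} [NormedAddCommGroup W] [NormedSpace ℝ W] [NormedAddCommGroup W']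
  [NormedSpace ℝ W'] [FiniteDimensional ℝ (W × W')] {i : X → W} {i' : X → W'} {P : ι → Set X}
  {r : ℕ} {a₀ e : ℝ}

namespace MoserData

theorem contDiffOn_extend_fst (D : MoserData (W × W') ι r)
    (ha : ∀ s ∈ Set.Icc (0 : ℝ) 1, a₀ + e * s ∈ Set.Icc (0 : ℝ) 1)
    (hS : ∀ σ, D.S σ = (fun x => (i x, i' x)) '' P σ) (hi : Function.Injective i) {F : W → W'}
    (hF : ContDiff ℝ ∞ F) (hFi : ∀ x, F (i x) = i' x) {f : X → X}
    (hf : ∀ x, (i (f x), i' (f x)) = D.flow a₀ e (i x, i' x)) (σ : ι) :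
    ContDiffOn ℝ ∞ (Function.extend i (fun x => i' (f x)) 0) (i '' P σ) := by
  have hm : Set.MapsTo (fun q => (q, F q)) (i '' P σ) (D.S σ) := by
    rw [hS]
    rintro _ ⟨x, hx, rfl⟩
    exact ⟨x, hx, by simp only [hFi]⟩
  have h := contDiff_snd.comp_contDiffOn
    ((D.contDiffOn_flow ha σ).comp (contDiff_id.prodMk hF).contDiffOn hm)
  refine h.congr ?_
  rintro _ ⟨x, hx, rfl⟩
  rw [hi.extend_apply]
  have := congrArg Prod.snd (hf x)
  simpa [hFi] using this

theorem contDiffOn_extend_snd (D : MoserData (W × W') ι r)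
    (ha : ∀ s ∈ Set.Icc (0 : ℝ) 1, a₀ + e * s ∈ Set.Icc (0 : ℝ) 1)
    (hS : ∀ σ, D.S σ = (fun x => (i x, i' x)) '' P σ) (hi : Function.Injective i') {F : W' → W}
    (hF : ContDiff ℝ ∞ F) (hFi : ∀ x, F (i' x) = i x) {f : X → X}
    (hf : ∀ x, (i (f x), i' (f x)) = D.flow a₀ e (i x, i' x)) (σ : ι) :
    ContDiffOn ℝ ∞ (Function.extend i' (fun x => i (f x)) 0) (i' '' P σ) := by
  have hm : Set.MapsTo (fun q => (F q, q)) (i' '' P σ) (D.S σ) := by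
    rw [hS]
    rintro _ ⟨x, hx, rfl⟩
    exact ⟨x, hx, by simp only [hFi]⟩
  have h := contDiff_fst.comp_contDiffOn
    ((D.contDiffOn_flow ha σ).comp (hF.prodMk contDiff_id).contDiffOn hm)
  refine h.congr ?_
  rintro _ ⟨x, hx, rfl⟩
  rw [hi.extend_apply]
  have := congrArg Prod.fst (hf x)
  simpa [hFi] using this

/-- On the stratum, the map between the factors is the lift to the graph followed by the flow and
the second projection. The two derivatives within the stratum agree on tangent vectors. -/
theorem exists_fderivWithin_extend_eq (D : MoserData (W × W') ι r)
    (ha : ∀ s ∈ Set.Icc (0 : ℝ) 1, a₀ + e * s ∈ Set.Icc (0 : ℝ) 1)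
    (hS : ∀ σ, D.S σ = (fun x => (i x, i' x)) '' P σ) (hi : Function.Injective i) {F : W → W'}
    (hF : ContDiff ℝ ∞ F) (hFi : ∀ x, F (i x) = i' x) {f : X → X}
    (hf : ∀ x, (i (f x), i' (f x)) = D.flow a₀ e (i x, i' x)) {σ : ι} {x : X} (hx : x ∈ P σ) :
    ∃ A : (W × W') →L[ℝ] (W × W'),
      (∀ v ∈ tangentSpaceOf (i '' P σ) (i x),
        fderivWithin ℝ (Function.extend i (fun x => i' (f x)) 0) (i '' P σ) (i x) v =
          (A (v, fderiv ℝ F (i x) v)).2) ∧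
      ∀ v ∈ tangentSpaceOf (i '' P σ) (i x), ∀ w ∈ tangentSpaceOf (i '' P σ) (i x),
        D.form (a₀ + e) (A (v, fderiv ℝ F (i x) v)) (D.J (A (w, fderiv ℝ F (i x) w))) =
          D.form a₀ (v, fderiv ℝ F (i x) v) (D.J (w, fderiv ℝ F (i x) w)) := by
  have hFd : Differentiable ℝ F := hF.differentiable (by simp)
  have hjx : (i x, i' x) ∈ D.S σ := by rw [hS]; exact ⟨x, hx, rfl⟩
  obtain ⟨A, hA, hAf⟩ := D.exists_fderiv_flow ha hjx
  have hT : ∀ v ∈ tangentSpaceOf (i '' P σ) (i x),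
      (v, fderiv ℝ F (i x) v) ∈ tangentSpaceOf (D.S σ) (i x, i' x) := fun v hv => by
    have := graph_mem_tangentSpaceOf hFd hFi hv
    rwa [hFi, ← hS] at this
  refine ⟨A, fun v hv => ?_, fun v hv w hw => hAf _ (hT v hv) _ (hT w hw)⟩
  have hm : Set.MapsTo (fun q => (q, F q)) (i '' P σ) (D.S σ) := by
    rw [hS]
    rintro _ ⟨x, hx, rfl⟩
    exact ⟨x, hx, by simp only [hFi]⟩
  have h1 : HasFDerivWithinAt (fun q => (q, F q))
      ((ContinuousLinearMap.id ℝ W).prod (fderiv ℝ F (i x))) (i '' P σ) (i x) :=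
    ((hasFDerivAt_id (i x)).prodMk (hFd (i x)).hasFDerivAt).hasFDerivWithinAt
  have h2 : HasFDerivWithinAt (D.flow a₀ e) A (D.S σ) (i x, F (i x)) := by rwa [hFi]
  have h3 := hasFDerivAt_snd.comp_hasFDerivWithinAt (i x) (h2.comp (i x) h1 hm)
  have hdiff := ((D.contDiffOn_extend_fst ha hS hi hF hFi hf σ).differentiableOn (by simp)
    (i x) ⟨x, hx, rfl⟩).hasFDerivWithinAt
  have heq : Set.EqOn (Function.extend i (fun x => i' (f x)) 0)
      (fun q => (D.flow a₀ e (q, F q)).2) (i '' P σ) := by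
    rintro _ ⟨y, hy, rfl⟩
    simp only [hi.extend_apply, hFi, ← hf]
  exact hdiff.eq_on_tangentSpaceOf (h3.congr heq (heq ⟨x, hx, rfl⟩)) hv

end MoserData

end Graph

namespace UnitaryTorusModule

variable {r : ℕ} {E : Type*} [NormedAddCommGroup E] [InnerProductSpace ℂ E]
  [FiniteDimensional ℂ E] (ρ : UnitaryTorusModule r E)

/-- The action of an element of the torus, as a real linear automorphism. -/
def realRep (h : AlgTorus r) : E ≃L[ℝ] E :=
  have : FiniteDimensional ℝ E := FiniteDimensional.trans ℝ ℂ E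
  (LinearEquiv.ofLinearMap ((ρ.rep h).restrictScalars ℝ) ((ρ.rep h⁻¹).restrictScalars ℝ)
    (LinearMap.ext fun v => ρ.rep.self_inv_apply h v)
    (LinearMap.ext fun v => ρ.rep.inv_self_apply h v)).toContinuousLinearEquiv

end UnitaryTorusModule

namespace IsClosedEquivariantEmbedding

variable {r : ℕ} {X : Type*} [MulAction (AlgTorus r) X] {V : AffineVariety X}
  {E : Type*} [NormedAddCommGroup E] [InnerProductSpace ℂ E] [FiniteDimensional ℂ E]
  {ρ : UnitaryTorusModule r E}
  {E' : Type*} [NormedAddCommGroup E'] [InnerProductSpace ℂ E'] [FiniteDimensional ℂ E']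
  {ρ' : UnitaryTorusModule r E'} {i : X → E} {i' : X → E'}

/-- Moser data which interpolate between the structures induced by two embeddings give an
isomorphism of Hamiltonian spaces. -/
theorem exists_isHamiltonianIso [FiniteDimensional ℝ (E × E')]
    (hi : IsClosedEquivariantEmbedding V ρ i)
    (hi' : IsClosedEquivariantEmbedding V ρ' i')
    (hD1 : V.IsDecomposed (fun σ : V.Face r => V.piece σ))
    (D : MoserData (E × E') (V.Face r) r)
    (hS : ∀ σ, D.S σ = (fun x => (i x, i' x)) '' V.piece σ)
    (hg₀ : ∀ v w, D.g₀ v w = reInner E v.1 w.1) (hg₁ : ∀ v w, D.g₁ v w = reInner E' v.2 w.2)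
    (hJ : ∀ v, D.J v = (Complex.I • v.1, Complex.I • v.2))
    (hN : ∀ k v, D.N k v =
      (ρ.weightOp (Pi.single k 1) v.1, ρ'.weightOp (Pi.single k 1) v.2)) :
    ∃ φ : X ≃ X, IsHamiltonianIso V ρ ρ' i i' φ := by
  have hfin := hD1.finite
  have hemb := hi.isEmbedding.prodMk hi'.isEmbedding
  have hmem : ∀ x, ∃ σ, x ∈ V.piece σ := fun x =>
    Set.mem_iUnion.1 (hD1.cover ▸ Set.mem_univ x : x ∈ ⋃ σ : V.Face r, V.piece σ)
  have hjS : ∀ {x σ}, x ∈ V.piece σ → (i x, i' x) ∈ D.S σ := fun {x σ} hx => by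
    rw [hS]; exact ⟨x, hx, rfl⟩
  obtain ⟨φ, hφ, hφ', hφP⟩ := D.exists_equiv hemb.injective hS hD1.cover
  obtain ⟨F, hF, hFi⟩ := hi.exists_contDiff_real hi'
  obtain ⟨F', hF', hFi'⟩ := hi'.exists_contDiff_real hi
  have hinj := hi.isEmbedding.injective
  have hinj' := hi'.isEmbedding.injective
  have hind : @Topology.IsInducing X (E × E') V.analytic _ (fun x => (i x, i' x)) :=
    @Topology.IsInducing.mk _ _ V.analytic _ _ hemb.analytic_eq
  have hφsP : ∀ σ, ∀ x ∈ V.piece σ, φ.symm x ∈ V.piece σ := fun σ x hx => by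
    rw [← hφP σ] at hx
    obtain ⟨y, hy, rfl⟩ := hx
    rwa [φ.symm_apply_apply]
  refine ⟨φ, ⟨?_, ?_, ?_, hφP, fun σ => ⟨?_, ?_, ⟨?_, ?_⟩, ?_, ?_, ?_⟩, ?_⟩⟩
  · exact @MoserData.continuous_of_flow_eq _ _ _ _ _ _ _ D _ _ _ V.analytic hind hS hD1.cover _ _
      MoserData.forward_mem_Icc _ hφ
  · exact @MoserData.continuous_of_flow_eq _ _ _ _ _ _ _ D _ _ _ V.analytic hind hS hD1.cover _ _
      MoserData.backward_mem_Icc _ hφ'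
  · intro t x
    obtain ⟨σ, hσ⟩ := hmem x
    have hR : ∀ y, ((ρ.realRep t.incl).prodCongr (ρ'.realRep t.incl)) (i y, i' y) =
        (i (t.incl • y), i' (t.incl • y)) := fun y => by
      rw [hi.equivariant, hi'.equivariant]; rfl
    apply hemb.injective
    have h1 := D.flow_map MoserData.forward_mem_Icc
      ((ρ.realRep t.incl).prodCongr (ρ'.realRep t.incl)) (σ := σ)
      (fun v w => by rw [hg₀, hg₀]; exact ρ.reInner_rep t _ _)
      (fun v w => by rw [hg₁, hg₁]; exact ρ'.reInner_rep t _ _) (fun p => ?_) (hjS hσ)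
    · rw [hR, ← hφ, ← hφ, hR] at h1
      exact h1
    · rw [hS]
      constructor
      · rintro ⟨y, hy, h⟩
        refine ⟨t.incl⁻¹ • y, (hi.smul_mem_piece_iff σ _).2 hy, ?_⟩
        apply ((ρ.realRep t.incl).prodCongr (ρ'.realRep t.incl)).injective
        rw [← h, hR, smul_inv_smul]
      · rintro ⟨y, hy, rfl⟩
        exact ⟨t.incl • y, (hi.smul_mem_piece_iff σ _).2 hy, (hR y).symm⟩
  · rintro _ ⟨x, hx, rfl⟩
    rw [hinj.extend_apply]
    exact ⟨φ x, by rw [← hφP σ]; exact ⟨x, hx, rfl⟩, rfl⟩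
  · rintro _ ⟨x, hx, rfl⟩
    rw [hinj'.extend_apply]
    exact ⟨φ.symm x, hφsP σ x hx, rfl⟩
  · rintro _ ⟨x, hx, rfl⟩
    rw [hinj.extend_apply, hinj'.extend_apply, φ.symm_apply_apply]
  · rintro _ ⟨x, hx, rfl⟩
    rw [hinj'.extend_apply, hinj.extend_apply, φ.apply_symm_apply]
  · exact D.contDiffOn_extend_fst MoserData.forward_mem_Icc hS hinj hF hFi hφ σ
  · exact D.contDiffOn_extend_snd MoserData.backward_mem_Icc hS hinj' hF' hFi' hφ' σ
  · rintro _ ⟨x, hx, rfl⟩ v hv w hw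
    obtain ⟨A, hA, hform⟩ := D.exists_fderivWithin_extend_eq MoserData.forward_mem_Icc hS hinj hF
      hFi hφ hx
    have h := hform v hv w hw
    rw [hA v hv, hA w hw, symplForm_eq_reInner, symplForm_eq_reInner]
    -- At the parameters `0` and `1` the interpolated form is `g₀` and `g₁`, so the invariance of
    -- the form becomes the comparison of `ω_E` with `ω_{E'}`.
    simp only [MoserData.form_apply, hg₀, hg₁, hJ] at h
    simpa using h
  · intro x
    obtain ⟨σ, hσ⟩ := hmem x
    have h := D.moment_flow MoserData.forward_mem_Icc (hjS hσ)
    rw [← hφ] at h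
    ext k
    have hk := congrFun h k
    simp only [MoserData.moment, MoserData.form_apply, hg₀, hg₁, hN] at hk
    rw [ρ.momentMap_apply_eq, ρ'.momentMap_apply_eq]
    simpa using hk

end IsClosedEquivariantEmbedding

end

theorem theorem3p13 (r : ℕ) {X : Type*} [MulAction (AlgTorus r) X] (V : AffineVariety X)
    (hV : V.IsAlgebraicAction r)
    {E : Type*} [NormedAddCommGroup E] [InnerProductSpace ℂ E] [FiniteDimensional ℂ E]
    {E' : Type*} [NormedAddCommGroup E'] [InnerProductSpace ℂ E'] [FiniteDimensional ℂ E']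
    (ρ : UnitaryTorusModule r E) (ρ' : UnitaryTorusModule r E')
    (i : X → E) (i' : X → E')
    (hi : IsClosedEquivariantEmbedding V ρ i) (hi' : IsClosedEquivariantEmbedding V ρ' i')
    (hD1 : V.IsDecomposed (fun σ : V.Face r => V.piece σ))
    (hD2 : ∀ σ τ : V.Face r, WhitneyA (i '' V.piece σ) (i '' V.piece τ))
    (hD2' : ∀ σ τ : V.Face r, WhitneyA (i' '' V.piece σ) (i' '' V.piece τ))
    (hμ : IsProperMap ρ.momentMap) (hμ' : IsProperMap ρ'.momentMap) :
    (∀ σ : V.Face r, IsHamiltonianSubmanifold ρ (i '' V.piece σ)) ∧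
    (∀ σ : V.Face r, IsHamiltonianSubmanifold ρ' (i' '' V.piece σ)) ∧
    ∃ φ : X ≃ X, IsHamiltonianIso V ρ ρ' i i' φ := by
  have : FiniteDimensional ℝ E := FiniteDimensional.trans ℝ ℂ E
  have : FiniteDimensional ℝ E' := FiniteDimensional.trans ℝ ℂ E'
  exact ⟨fun σ => hi.isHamiltonianSubmanifold (hD1.locallyClosed σ) (hD1.smooth σ),
    fun σ => hi'.isHamiltonianSubmanifold (hD1.locallyClosed σ) (hD1.smooth σ),
    hi.exists_isHamiltonianIso hi' hD1 (hi.moserData hi' hD1 hD2 hμ hμ') (fun _ => rfl)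
      (fun _ _ => rfl) (fun _ _ => rfl) (fun _ => rfl) fun _ _ => rfl⟩
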